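/- Fix $t\in\mathbb Q^\times$ and put $a=-\frac1{4t^2}$, $A=\frac{t^2+4}{64}$. Consider the elliptic curves over $\mathbb Q$ $$E:\ y^2+xy+ay=x^3+ax^2,\qquad E':\ Y^2+XY+AY=X^3+AX^2,$$ and the 4-isogeny $\hat\phi:E'\to E$, $(X,Y)\mapsto(x,y)$, given by $$x=-a+\Big(\tfrac{X(2Y+X+A)}{2t(X+A)(X+2A)}\Big)^2,\qquad y=x^2-\Big(\tfrac{2(X+2A)(2Y+X+A)-tX(X+A)}{4t(X+A)(X+2A)}\Big)^4 ,$$ whose kernel $E'[\hat\phi]$ is cyclic of order 4, generated by $T'=\big(-2A,\ A\,\tfrac{2+it}{4}\big)$, $i=\sqrt{-1}$. Let $WC(E'/K)=H^1(\mathrm{Gal}(\overline K/K),E'(\overline K))$ be the Weil–Châtelet group, and let, with $\nu$ running over all places of $\mathbb Q$, $$S^{(\hat\phi)}(E'/\mathbb Q)=\ker\Big\{H^1(\mathrm{Gal}(\overline{\mathbb Q}/\mathbb Q),E'[\hat\phi])\to\prod_\nu WC(E'/\mathbb Q_\nu)\Big\},$$ $$\text{Ш}(E'/\mathbb Q)=\ker\Big\{WC(E'/\mathbb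 Q)\to\prod_\nu WC(E'/\mathbb Q_\nu)\Big\},$$ and let $\text{Ш}(E'/\mathbb Q)[\hat\phi]$ be the kernel of the map induced by $\hat\phi$ on $\text{Ш}(E'/\mathbb Q)$. For $d\in\mathbb Q^\times$ let $C'_d$ be the smooth projective curve with affine equation $d(w+az^2)z^2=(w^2-d)^2$; explicitly it is the curve $uz=w^2-ds^2$, $u^2=d(ws+az^2)$ in $\mathbb P^3$, with $s=1$ and $u=(w^2-d)/z$ on the affine part $z\ne0$. Choose $\delta\in\overline{\mathbb Q}$ with $\delta^4=d$. Over $\overline{\mathbb Q}$ the curve $C'_d$ is isomorphic to $E'$ by the map $\theta:C'_d\to E'$ whose inverse is $$z=\delta\,\tfrac{4t(X+A)(X+2A)}{2(X+2A)(2Y+X+A)-tX(X+A)},\qquad w=\delta^2\,\tfrac{2(X+2A)(2Y+X+A)+tX(X+A)}{2(X+2A)(2Y+X+A)-tX(X+A)},$$ and $\{C'_d\}\in WC(E'/\mathbb Q)$ denotes the class of the crossed homomorphism $f$ with $\theta(\sigma P)=\sigma(\theta(P))+f(\sigma)$ for all $P\in C'_d(\overline{\mathbb Q})$. This class is well defined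 and depends only on $d$ modulo $(\mathbb Q^\times)^4$. Let $\Sigma$ be the finite set of places of $\mathbb Q$ consisting of $2$, $\infty$ and the primes that occur, with positive or negative exponent, in the factorizations of the rational numbers $t$ and $t^2+4$. Let $D_\Sigma\subseteq\mathbb Q^\times/(\mathbb Q^\times)^4$ be the set of classes of the numbers $d=\pm\prod_{p\in\Sigma,\,p\ne\infty}p^{a_p}$ ($a_p\in\mathbb Z$) such that $C'_d(\mathbb Q_\nu)\neq\emptyset$ for all $\nu\in\Sigma$. Then: 1. There is a group isomorphism $\mathbb Q^\times/(\mathbb Q^\times)^4\simeq H^1(\mathrm{Gal}(\overline{\mathbb Q}/\mathbb Q),E'[\hat\phi])$ that sends $d$ to the class of the crossed homomorphism $\sigma\mapsto mT'$ whenever $\sigma(\delta)=i^m\delta$, $\delta^4=d$, and under it $S^{(\hat\phi)}(E'/\mathbb Q)$ corresponds to $D_\Sigma$. 2. $\text{Ш}(E'/\mathbb Q)[\hat\phi]=\{\,\{C'_d\} : d\in D_\Sigma\,\}$. -/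

import Mathlib

open scoped Classical

noncomputable section

namespace FourDescent

/-! ### First continuous cohomology, by crossed homomorphisms -/

section Cohomology

variable {G : Type*} [Group G] [TopologicalSpace G] {M : Type*} [AddCommGroup M]

/-- Continuous crossed homomorphisms `f : G → M` (for the discrete topology on `M`) all of whose
values lie in the subgroup `N` of `M`, where `G` acts on `M` through `ρ`. -/
def cocycles (ρ : G →* AddMonoid.End M) (N : AddSubgroup M) : AddSubgroup (G → M) where
  carrier := {f | IsLocallyConstant f ∧ (∀ σ τ, f (σ * τ) = ρ σ (f τ) + f σ) ∧ ∀ σ, f σ ∈ N}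
  zero_mem' := ⟨IsLocallyConstant.const 0, fun σ τ => by simp, fun σ => N.zero_mem⟩
  add_mem' := by
    rintro f g ⟨hf, hf', hf''⟩ ⟨hg, hg', hg''⟩
    refine ⟨hf.add hg, fun σ τ => ?_, fun σ => N.add_mem (hf'' σ) (hg'' σ)⟩
    simp only [Pi.add_apply, hf', hg', map_add]
    abel
  neg_mem' := by
    rintro f ⟨hf, hf', hf''⟩
    refine ⟨hf.neg, fun σ τ => ?_, fun σ => N.neg_mem (hf'' σ)⟩
    simp only [Pi.neg_apply, hf', map_neg]
    abel

/-- The principal crossed homomorphisms `σ ↦ σ m - m` with `m ∈ N`. -/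
def coboundaries (ρ : G →* AddMonoid.End M) (N : AddSubgroup M) : AddSubgroup (G → M) where
  carrier := {f | ∃ m ∈ N, ∀ σ, f σ = ρ σ m - m}
  zero_mem' := ⟨0, N.zero_mem, fun σ => by simp⟩
  add_mem' := by
    rintro f g ⟨m, hm, hf⟩ ⟨n, hn, hg⟩
    refine ⟨m + n, N.add_mem hm hn, fun σ => ?_⟩
    simp only [Pi.add_apply, hf, hg, map_add]
    abel
  neg_mem' := by
    rintro f ⟨m, hm, hf⟩
    refine ⟨-m, N.neg_mem hm, fun σ => ?_⟩
    simp only [Pi.neg_apply, hf, map_neg]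
    abel

/-- `H¹(G, N)` for a `G`-stable subgroup `N` of the discrete `G`-module `M`. -/
abbrev H1 (ρ : G →* AddMonoid.End M) (N : AddSubgroup M) : Type _ :=
  cocycles ρ N ⧸ (coboundaries ρ N).addSubgroupOf (cocycles ρ N)

/-- The class in `H¹(G, N)` of a crossed homomorphism. -/
def H1.mk (ρ : G →* AddMonoid.End M) (N : AddSubgroup M) : cocycles ρ N →+ H1 ρ N :=
  QuotientAddGroup.mk' _

end Cohomology

/-! ### Galois groups acting on points, and restriction to local Galois groups -/

section Galois

open WeierstrassCurve.Affine

/-- The action of `Gal(L/K)` on the group `W(L)`, for `W` defined over `ℚ`. -/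
def galAct (W : WeierstrassCurve.Affine ℚ) (K L : Type*) [Field K] [Field L] [Algebra ℚ K]
    [Algebra ℚ L] [Algebra K L] [IsScalarTower ℚ K L] :
    (L ≃ₐ[K] L) →* AddMonoid.End (W⁄L).Point where
  toFun σ := Point.map (W' := W) ((σ : L →ₐ[K] L).restrictScalars ℚ)
  map_one' := by
    ext P
    cases P <;> rfl
  map_mul' σ τ := by
    ext P
    cases P <;> rfl

section

variable {F : Type*} [Field F] {L₀ : Type*} [Field L₀] [Algebra F L₀] [Normal F L₀]
  {K L : Type*} [Field K] [Field L] [Algebra F K] [Algebra F L] [Algebra K L]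
  [IsScalarTower F K L]

/-- Restriction `Gal(L/K) → Gal(L₀/F)` along an embedding `ι : L₀ → L` of a normal extension. -/
def galRes (ι : L₀ →ₐ[F] L) : (L ≃ₐ[K] L) →* (L₀ ≃ₐ[F] L₀) :=
  letI : Algebra L₀ L := ι.toRingHom.toAlgebra
  haveI : IsScalarTower F L₀ L := IsScalarTower.of_algebraMap_eq fun x => (ι.commutes x).symm
  (AlgEquiv.restrictNormalHom (F := F) (K₁ := L) L₀).comp
    (MonoidHom.mk' (fun τ : L ≃ₐ[K] L => τ.restrictScalars F) fun _ _ => rfl)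

theorem galRes_commutes (ι : L₀ →ₐ[F] L) (τ : L ≃ₐ[K] L) (x : L₀) :
    ι (galRes ι τ x) = τ (ι x) := by
  let _ : Algebra L₀ L := ι.toRingHom.toAlgebra
  have _ : IsScalarTower F L₀ L := IsScalarTower.of_algebraMap_eq fun x => (ι.commutes x).symm
  exact AlgEquiv.restrictNormal_commutes (τ.restrictScalars F) L₀ x

theorem galRes_continuous [Algebra.IsAlgebraic K L] (ι : L₀ →ₐ[F] L) :
    Continuous (galRes (K := K) ι) := by
  refine continuous_of_continuousAt_one _ ?_
  rw [ContinuousAt, map_one]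
  intro U hU
  obtain ⟨E, hE, hEU⟩ := (krullTopology_mem_nhds_one_iff F L₀ U).1 hU
  let b := Module.finBasis F E
  have hV : (⋂ k, (MulAction.stabilizer (L ≃ₐ[K] L) (ι (b k)) : Set (L ≃ₐ[K] L))) ∈
      nhds (1 : L ≃ₐ[K] L) :=
    (isOpen_iInter_of_finite fun k => stabilizer_isOpen_of_isIntegral (K := K) (ι (b k))).mem_nhds
      (Set.mem_iInter.2 fun k => one_mem _)
  refine Filter.mem_map.2 (Filter.mem_of_superset hV fun τ hτ => hEU ?_)
  have h1 : ((galRes ι τ : L₀ ≃ₐ[F] L₀) : L₀ →ₐ[F] L₀).toLinearMap.comp E.val.toLinearMap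
      = E.val.toLinearMap := by
    refine b.ext fun k => ι.injective ?_
    have h2 : τ (ι (b k)) = ι (b k) := Set.mem_iInter.1 hτ k
    exact (galRes_commutes ι τ _).trans h2
  rw [SetLike.mem_coe, IntermediateField.mem_fixingSubgroup_iff]
  exact fun x hx => LinearMap.congr_fun h1 ⟨x, hx⟩

end

section

variable {L₀ : Type*} [Field L₀] [Algebra ℚ L₀] [Normal ℚ L₀]
  {K L : Type*} [Field K] [Field L] [Algebra ℚ K] [Algebra ℚ L] [Algebra K L]
  [IsScalarTower ℚ K L]

theorem map_galAct (W : WeierstrassCurve.Affine ℚ) (ι : L₀ →ₐ[ℚ] L) (τ : L ≃ₐ[K] L)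
    (P : (W⁄L₀).Point) :
    Point.map (W' := W) ι (galAct W ℚ L₀ (galRes ι τ) P) =
      galAct W K L τ (Point.map (W' := W) ι P) := by
  rcases P with _ | ⟨x, y, h⟩
  · rfl
  · refine (Point.some.injEq ..).mpr ?_
    exact ⟨galRes_commutes ι τ x, galRes_commutes ι τ y⟩

/-- The restriction of crossed homomorphisms along `ι`: a crossed homomorphism `f` goes to
`τ ↦ ι (f (τ|L₀))`. -/
def localizeCocycles [Algebra.IsAlgebraic K L] (W : WeierstrassCurve.Affine ℚ) (ι : L₀ →ₐ[ℚ] L)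
    (N : AddSubgroup (W⁄L₀).Point) :
    cocycles (galAct W ℚ L₀) N →+ cocycles (galAct W K L) ⊤ where
  toFun f := ⟨fun τ => Point.map (W' := W) ι (f.1 (galRes ι τ)), by
    obtain ⟨f, hf, hf', hf''⟩ := f
    refine ⟨(hf.comp_continuous (galRes_continuous ι)).comp _, fun σ τ => ?_, fun σ => trivial⟩
    simp only [map_mul, hf', map_add, map_galAct]⟩
  map_zero' := by
    ext τ
    exact map_zero (Point.map (W' := W) ι)
  map_add' f g := by
    ext τ
    exact map_add (Point.map (W' := W) ι) _ _

/-- The restriction map `H¹(Gal(L₀/ℚ), N) → H¹(Gal(L/K), W(L))`, for `N` inside `W(L₀)`. -/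
def localize [Algebra.IsAlgebraic K L] (W : WeierstrassCurve.Affine ℚ) (ι : L₀ →ₐ[ℚ] L)
    (N : AddSubgroup (W⁄L₀).Point) :
    H1 (galAct W ℚ L₀) N →+ H1 (galAct W K L) ⊤ :=
  QuotientAddGroup.map _ _ (localizeCocycles W ι N) (by
    rintro ⟨f, hf⟩ ⟨m, hm, hfm⟩
    refine ⟨Point.map (W' := W) ι m, trivial, fun τ => ?_⟩
    have h := congrArg (Point.map (W' := W) ι) (hfm (galRes ι τ))
    rw [map_sub, map_galAct] at h
    exact h)

end

end Galois

/-! ### The Weil–Châtelet group and the local conditions -/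

section Arithmetic

open WeierstrassCurve.Affine

/-- An algebraic closure of `ℚ`. -/
abbrev QBar : Type := AlgebraicClosure ℚ

/-- The `ℚ`-algebra structure of the algebraic closure, preferred to the generic one of a field of
characteristic zero (they are equal). -/
instance (priority := 5000) instAlgebraQBar : Algebra ℚ (AlgebraicClosure ℚ) :=
  AlgebraicClosure.instAlgebra ℚ

/-- `H¹(Gal(ℚ̄/ℚ), N)` for a Galois stable subgroup `N` of `W(ℚ̄)`. -/
abbrev H1Q (W : WeierstrassCurve.Affine ℚ) (N : AddSubgroup (W⁄QBar).Point) : Type :=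
  H1 (galAct W ℚ QBar) N

/-- The Weil–Châtelet group `WC(W/ℚ) = H¹(Gal(ℚ̄/ℚ), W(ℚ̄))`. -/
abbrev WC (W : WeierstrassCurve.Affine ℚ) : Type := H1Q W ⊤

/-- The elements of `H¹(Gal(ℚ̄/ℚ), N)` whose image in `WC(W/ℚ_ν) = H¹(Gal(ℚ̄_ν/ℚ_ν), W(ℚ̄_ν))` is
trivial for every place `ν` of `ℚ` (the finite primes, and the real place). The embeddings
`ℚ̄ → ℚ̄_ν` used to restrict are chosen arbitrarily; the kernels do not depend on them. -/
def everywhereLocallyTrivial (W : WeierstrassCurve.Affine ℚ) (N : AddSubgroup (W⁄QBar).Point) :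
    AddSubgroup (H1Q W N) :=
  (⨅ (p : ℕ) (_ : Fact p.Prime),
    (localize (K := ℚ_[p]) W
      (IsAlgClosed.lift : QBar →ₐ[ℚ] AlgebraicClosure ℚ_[p]) N).ker) ⊓
  (localize (K := ℝ) W (IsAlgClosed.lift : QBar →ₐ[ℚ] AlgebraicClosure ℝ) N).ker

/-- The Shafarevich–Tate group, the kernel of `WC(W/ℚ) → ∏_ν WC(W/ℚ_ν)`. -/
def Sha (W : WeierstrassCurve.Affine ℚ) : AddSubgroup (WC W) := everywhereLocallyTrivial W ⊤

/-! ### The two curves and the isogeny between them -/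

/-- `a = -1 / (4 t²)`. -/
def a (t : ℚˣ) : ℚ := -1 / (4 * (t : ℚ) ^ 2)

/-- `A = (t² + 4) / 64`. -/
def A (t : ℚˣ) : ℚ := ((t : ℚ) ^ 2 + 4) / 64

/-- `E : y² + x y + a y = x³ + a x²`. -/
def E (t : ℚˣ) : WeierstrassCurve.Affine ℚ := { a₁ := 1, a₂ := a t, a₃ := a t, a₄ := 0, a₆ := 0 }

/-- `E' : Y² + X Y + A Y = X³ + A X²`. -/
def E' (t : ℚˣ) : WeierstrassCurve.Affine ℚ := { a₁ := 1, a₂ := A t, a₃ := A t, a₄ := 0, a₆ := 0 }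

theorem dual_nonsingular (t : ℚˣ) {L : Type*} [Field L] [Algebra ℚ L] {X Y : L}
    (h : ((E' t)⁄L).Nonsingular X Y)
    (hX : (X + algebraMap ℚ L (A t)) * (X + 2 * algebraMap ℚ L (A t)) ≠ 0) :
    let τ := algebraMap ℚ L t
    let α := algebraMap ℚ L (A t)
    let x := -algebraMap ℚ L (a t) +
      (X * (2 * Y + X + α) / (2 * τ * (X + α) * (X + 2 * α))) ^ 2
    ((E t)⁄L).Nonsingular x (x ^ 2 -
      ((2 * (X + 2 * α) * (2 * Y + X + α) - τ * X * (X + α)) /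
        (4 * τ * (X + α) * (X + 2 * α))) ^ 4) := by
  intro τ α x
  have ht : (t : ℚ) ≠ 0 := t.ne_zero
  have hτ : τ ≠ 0 := (map_ne_zero _).2 ht
  have hchar : CharZero L := algebraRat.charZero L
  have hA : 64 * α = τ ^ 2 + 4 := by
    have h1 : 64 * A t = (t : ℚ) ^ 2 + 4 := by
      rw [A]
      ring
    have h2 := congrArg (algebraMap ℚ L) h1
    simpa only [map_mul, map_add, map_pow, map_ofNat] using h2
  have ha : 4 * τ ^ 2 * algebraMap ℚ L (a t) = -1 := by
    have h1 : 4 * (t : ℚ) ^ 2 * a t = -1 := by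
      rw [a]
      field_simp
    have h2 := congrArg (algebraMap ℚ L) h1
    simpa only [map_mul, map_neg, map_one, map_pow, map_ofNat] using h2
  have hE : Y ^ 2 + X * Y + α * Y = X ^ 3 + α * X ^ 2 := by
    have h1 := ((E' t)⁄L).equation_iff X Y |>.1 h.1
    simpa [E', WeierstrassCurve.Affine.baseChange, WeierstrassCurve.map, α] using h1
  have e1 : ((E t)⁄L).a₁ = 1 := map_one _
  have e2 : ((E t)⁄L).a₂ = algebraMap ℚ L (a t) := rfl
  have e3 : ((E t)⁄L).a₃ = algebraMap ℚ L (a t) := rfl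
  have e4 : ((E t)⁄L).a₄ = 0 := map_zero _
  have e6 : ((E t)⁄L).a₆ = 0 := map_zero _
  refine (((E t)⁄L).equation_iff_nonsingular_of_Δ_ne_zero ?_).1 ?_
  · have h1 : ((E t)⁄L).Δ = (algebraMap ℚ L (a t)) ^ 4 * (1 - 16 * algebraMap ℚ L (a t)) := by
      simp only [WeierstrassCurve.Δ, WeierstrassCurve.b₂, WeierstrassCurve.b₄,
        WeierstrassCurve.b₆, WeierstrassCurve.b₈, e1, e2, e3, e4, e6]
      ring
    have h2 : a t ≠ 0 := div_ne_zero (by norm_num) (by positivity)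
    have h3 : 1 - 16 * a t ≠ 0 := by
      have : a t < 0 := div_neg_of_neg_of_pos (by norm_num) (by positivity)
      linarith
    have h4 : 1 - 16 * algebraMap ℚ L (a t) ≠ 0 := by
      simpa only [map_sub, map_mul, map_one, map_ofNat] using (map_ne_zero (algebraMap ℚ L)).2 h3
    rw [h1]
    exact mul_ne_zero (pow_ne_zero 4 ((map_ne_zero _).2 h2)) h4
  · have hX1 : X + α ≠ 0 := left_ne_zero_of_mul hX
    have hX2 : X + 2 * α ≠ 0 := right_ne_zero_of_mul hX
    have h2 : (2 : L) ≠ 0 := two_ne_zero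
    have h4 : (4 : L) ≠ 0 := by exact_mod_cast (four_ne_zero : (4 : ℕ) ≠ 0)
    have hg : (2 * (X + 2 * α) * (2 * Y + X + α) - τ * X * (X + α)) /
        (4 * τ * (X + α) * (X + 2 * α)) =
        (2 * Y + X + α) / (2 * τ * (X + α)) - X / (4 * (X + 2 * α)) := by
      field_simp
      ring
    have hr : X * (2 * Y + X + α) / (2 * τ * (X + α) * (X + 2 * α)) =
        4 * ((2 * Y + X + α) / (2 * τ * (X + α))) * (X / (4 * (X + 2 * α))) := by
      field_simp
    have hp : ((2 * Y + X + α) / (2 * τ * (X + α))) ^ 2 =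
        (4 * X ^ 2 + X + α) / (4 * τ ^ 2 * (X + α)) := by
      rw [div_pow, div_eq_div_iff (by positivity) (by positivity)]
      linear_combination (16 * τ ^ 2 * (X + α)) * hE
    have hb : algebraMap ℚ L (a t) = -1 / (4 * τ ^ 2) := by
      rw [eq_div_iff (by positivity)]
      linear_combination ha
    have key : algebraMap ℚ L (a t) = (X / (4 * (X + 2 * α))) ^ 2 -
        ((2 * Y + X + α) / (2 * τ * (X + α))) ^ 2 +
        16 * ((2 * Y + X + α) / (2 * τ * (X + α))) ^ 2 * (X / (4 * (X + 2 * α))) ^ 2 := by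
      rw [hp, hb]
      field_simp
      linear_combination (4 * X ^ 2 * (X + α)) * hA
    rw [WeierstrassCurve.Affine.equation_iff, e1, e2, e3, e4, e6]
    simp only [x]
    rw [hg, hr, key]
    ring

/-- The isogeny `φ̂ : E' → E` on `L`-points. It sends `(X, Y)` to `(x, y)` with
`x = -a + (X (2Y + X + A) / (2t (X + A) (X + 2A)))²` and
`y = x² - ((2 (X + 2A) (2Y + X + A) - t X (X + A)) / (4t (X + A) (X + 2A)))⁴`,
and the point at infinity and the poles of these functions to the point at infinity. -/
def dualIsogeny (t : ℚˣ) (L : Type*) [Field L] [Algebra ℚ L] :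
    ((E' t)⁄L).Point → ((E t)⁄L).Point
  | .zero => .zero
  | .some X _ h =>
    if hX : (X + algebraMap ℚ L (A t)) * (X + 2 * algebraMap ℚ L (A t)) = 0 then .zero
    else .some _ _ (dual_nonsingular t h hX)

/-- `E'[φ̂]`, the subgroup formed by the `P ∈ E'(ℚ̄)` with `φ̂ P = 0`. (These points form a subgroup
already, so passing to the generated subgroup adds nothing.) -/
def dualKernel (t : ℚˣ) : AddSubgroup ((E' t)⁄QBar).Point :=
  AddSubgroup.closure {P | dualIsogeny t QBar P = 0}

/-- The Selmer group `S^(φ̂)(E'/ℚ)`, the kernel of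
`H¹(Gal(ℚ̄/ℚ), E'[φ̂]) → ∏_ν WC(E'/ℚ_ν)`. -/
def selmer (t : ℚˣ) : AddSubgroup (H1Q (E' t) (dualKernel t)) :=
  everywhereLocallyTrivial (E' t) (dualKernel t)

/-- `c ∈ WC(E'/ℚ)[φ̂]`: the map `WC(E'/ℚ) → WC(E/ℚ)` induced by `φ̂` kills `c`, that is, `φ̂ ∘ f` is
a principal crossed homomorphism for a crossed homomorphism `f` that represents `c`. -/
def KilledByDual (t : ℚˣ) (c : WC (E' t)) : Prop :=
  ∃ f : cocycles (galAct (E' t) ℚ QBar) ⊤, H1.mk _ _ f = c ∧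
    ∃ Q : ((E t)⁄QBar).Point, ∀ σ, dualIsogeny t QBar (f.1 σ) = galAct (E t) ℚ QBar σ Q - Q

/-- `Ш(E'/ℚ)[φ̂]`. -/
def ShaDual (t : ℚˣ) : Set (WC (E' t)) := {c | c ∈ Sha (E' t) ∧ KilledByDual t c}

/-- `ℚˣ / (ℚˣ)⁴`. -/
abbrev FourthPowerClasses : Type := ℚˣ ⧸ (powMonoidHom 4 : ℚˣ →* ℚˣ).range

/-- `c` is the class `δ_ℚ(d)` in `H¹(Gal(ℚ̄/ℚ), E'[φ̂])`, under the Kummer isomorphism for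
`μ₄ ≃ E'[φ̂]`, `i ↦ T' = (-2A, A (2 + i t) / 4)`: it is represented by the crossed homomorphism that
sends `σ` to `m T'` if `σ(δ) = i ^ m δ`, where `δ` is a fourth root of `d`. -/
def IsKummerClass (t d : ℚˣ) (c : H1Q (E' t) (dualKernel t)) : Prop :=
  ∃ (i δ : QBar) (T : ((E' t)⁄QBar).Point) (f : cocycles (galAct (E' t) ℚ QBar) (dualKernel t)),
    i ^ 2 = -1 ∧ δ ^ 4 = algebraMap ℚ QBar d ∧
    (∃ h, T = .some (-2 * algebraMap ℚ QBar (A t))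
      (algebraMap ℚ QBar (A t) * (2 + i * algebraMap ℚ QBar t) / 4) h) ∧
    H1.mk _ _ f = c ∧ ∀ (σ : QBar ≃ₐ[ℚ] QBar) (m : ℕ), σ δ = i ^ m * δ → f.1 σ = m • T

/-! ### The homogeneous spaces -/

/-- The homogeneous space `C'_d : d (w + a z²) z² = (w² - d)²` for `E'`, as a smooth projective
curve. The affine plane curve has singular points where `z = 0`; adjoining `u = (w² - d) / z`
resolves them, and gives the smooth intersection of two quadrics
`u z = w² - d s²`, `u² = d (w s + a z²)` in `ℙ³`, with `s = 1` on the affine part. This is the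
set of homogeneous coordinate vectors `(s, z, w, u)` of its `L`-points. -/
def spaceVectors (t d : ℚˣ) (L : Type*) [Field L] [Algebra ℚ L] : Set (Fin 4 → L) :=
  {v | v ≠ 0 ∧ v 3 * v 1 = v 2 ^ 2 - algebraMap ℚ L d * v 0 ^ 2 ∧
    v 3 ^ 2 = algebraMap ℚ L d * (v 2 * v 0 + algebraMap ℚ L (a t) * v 1 ^ 2)}

/-- `C'_d(L) ≠ ∅`. -/
def HasPoint (t d : ℚˣ) (L : Type*) [Field L] [Algebra ℚ L] : Prop :=
  (spaceVectors t d L).Nonempty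

/-- Away from `z = 0` the points of the smooth curve are those of the affine plane curve. -/
theorem mem_spaceVectors_iff (t d : ℚˣ) {L : Type*} [Field L] [Algebra ℚ L] {z w u : L}
    (hz : z ≠ 0) :
    ![1, z, w, u] ∈ spaceVectors t d L ↔ u = (w ^ 2 - algebraMap ℚ L d) / z ∧
      algebraMap ℚ L d * (w + algebraMap ℚ L (a t) * z ^ 2) * z ^ 2 =
        (w ^ 2 - algebraMap ℚ L d) ^ 2 := by
  have h0 : (![1, z, w, u] : Fin 4 → L) ≠ 0 := fun h => one_ne_zero (congrFun h 0)
  simp only [spaceVectors, Set.mem_ofPred_eq, ne_eq, h0, not_false_eq_true, true_and,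
    Matrix.cons_val, one_pow, mul_one, eq_div_iff hz]
  refine and_congr_right fun hu => ?_
  rw [← hu, mul_pow]
  exact ⟨fun h => by rw [h], fun h => (mul_right_cancel₀ (pow_ne_zero 2 hz) h).symm⟩

/-- The isomorphism `θ⁻¹ : E' → C'_d` over `ℚ̄` that a fourth root `δ` of `d` gives, with values in
homogeneous coordinates `(s, z, w, u)`. At a point `(X, Y)` it is
`z = δ · 4t (X + A) (X + 2A) / (2 (X + 2A) (2Y + X + A) - t X (X + A))` and
`w = δ² (2 (X + 2A) (2Y + X + A) + t X (X + A)) / (2 (X + 2A) (2Y + X + A) - t X (X + A))`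
in affine coordinates. At the point at infinity and at `(-A, 0)`, where these homogeneous
coordinates all vanish or have a pole, the value is the one of the extended morphism. -/
def thetaInv (t : ℚˣ) (δ : QBar) : ((E' t)⁄QBar).Point → Fin 4 → QBar
  | .zero => ![1, 0, δ ^ 2, δ ^ 3]
  | .some X Y _ =>
    let τ := algebraMap ℚ QBar t
    let α := algebraMap ℚ QBar (A t)
    if X + α = 0 then ![1, 0, δ ^ 2, -δ ^ 3]
    else ![2 * (X + 2 * α) * (2 * Y + X + α) - τ * X * (X + α),
      δ * (4 * τ * (X + α) * (X + 2 * α)),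
      δ ^ 2 * (2 * (X + 2 * α) * (2 * Y + X + α) + τ * X * (X + α)),
      2 * δ ^ 3 * X * (2 * Y + X + α)]

/-- `c` is the class `{C'_d/ℚ} ∈ WC(E'/ℚ)`: it is represented by the crossed homomorphism `f` by which
the Galois action on `C'_d(ℚ̄)` differs from the one on `E'(ℚ̄)` under the identification `θ`, that is,
`θ(σ C) = σ(θ C) + f(σ)` for all `C ∈ C'_d(ℚ̄)`, written here for `C = θ⁻¹(P)` and up to the scaling of
homogeneous coordinates. -/
def IsClassOfSpace (t d : ℚˣ) (c : WC (E' t)) : Prop :=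
  ∃ (δ : QBar) (f : cocycles (galAct (E' t) ℚ QBar) ⊤),
    δ ^ 4 = algebraMap ℚ QBar d ∧ H1.mk _ _ f = c ∧
    ∀ (σ : QBar ≃ₐ[ℚ] QBar) (P : ((E' t)⁄QBar).Point), ∃ r : QBar, r ≠ 0 ∧
      ∀ k, σ (thetaInv t δ P k) = r * thetaInv t δ (galAct (E' t) ℚ QBar σ P + f.1 σ) k

/-! ### The finite set of places -/

/-- The finite places in `Σ`: the prime 2 and the primes that occur, with positive or negative
exponent, in the factorization of `t` or of `t² + 4`. -/
def badPrimes (t : ℚˣ) : Finset ℕ :=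
  {2} ∪ ((t : ℚ).num.natAbs.primeFactors ∪ (t : ℚ).den.primeFactors) ∪
    (((t : ℚ) ^ 2 + 4).num.natAbs.primeFactors ∪ ((t : ℚ) ^ 2 + 4).den.primeFactors)

/-- `d = ± ∏_{p ∈ Σ} p ^ (e p)` for some integers `e p`. -/
def IsSupported (t d : ℚˣ) : Prop :=
  ∃ (ε : ℤˣ) (e : ℕ → ℤ), (d : ℚ) = ((ε : ℤ) : ℚ) * ∏ p ∈ badPrimes t, (p : ℚ) ^ e p

/-- `C'_d(ℚ_ν) ≠ ∅` for every `ν ∈ Σ`, where `∞ ∈ Σ`. -/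
def SolubleAtBadPlaces (t d : ℚˣ) : Prop :=
  (∀ (p : ℕ) [Fact p.Prime], p ∈ badPrimes t → HasPoint t d ℚ_[p]) ∧ HasPoint t d ℝ

end Arithmetic

end FourDescent

end

noncomputable section

namespace FourDescent

/-! ### Quadratic character sums -/

section FiniteField

variable {F : Type*} [Field F]

/-! Off the kernel of the isogeny, put `p = (2Y + X + A) / (2t (X + A))` and `q = X / (4 (X + 2A))`.
Then `E'` becomes `q² - p² + 16 p² q² = a`, the isogeny becomes `(p, q) ↦ (p² - q², 4 p q (p -
q)²)`, and adding `T'` becomes `(p, q) ↦ (-i q, -i p)`. The curve `C'_d` is parametrized by `(s : z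
: w : u) = (p - q : δ : δ² (p + q) : 4 δ³ p q)`, while the kernel goes to the four points with `z =
0`, one for each fourth root of `d`. So replacing `δ` by another fourth root of `d` is translation
by a point of the kernel (`theta_proportional_iff`).

Assertion 1. Since `i ^ m ↦ m T'` is an isomorphism of Galois modules from `μ₄` to the kernel,
Hilbert's Theorem 90 gives the Kummer isomorphism (`kummerEquiv`). Comparing Galois actions through
the parametrization shows that the class of `d` dies in `WC(E'/K)` exactly when `C'_d` has a
`K`-point (`localize_kummerClass_eq_zero_iff`). The Selmer group thus consists of the `d` with
`C'_d` soluble at every place. At a prime `p` outside `Σ`, a `p`-adic descent shows that solubility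
forces `4 ∣ v_p(d)` (`four_dvd_of_hasPoint`), so `d` is supported on `Σ` up to fourth powers.
Conversely, for a `p`-adic unit `d`, character sums over `𝔽_p` and Hensel's lemma give a point
(`hasPoint_of_norm_eq_one`). Only the places in `Σ` remain to be tested.

Assertion 2. The class of `C'_d` is the image of minus the Kummer class (`isClassOfSpace_iff`). That
the classes killed by the isogeny are those coming from its kernel (`killedByDual_iff`) requires a
surjective homomorphism on `ℚ̄`-points. The isogeny is given by formulas only, so its additivity is
proved by showing that it carries lines to lines, as a composite of two 2-isogenies
(`exists_line_of_ptPQ`). -/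

theorem ringChar_ne_two (h2 : (2 : F) ≠ 0) : ringChar F ≠ 2 := fun h => h2 <| by
  have := ringChar.Nat.cast_ringChar (R := F)
  rw [h] at this
  exact_mod_cast this

variable [Fintype F]

/-- The sum counts the points of the conic `y² = x² - D`. Since `(x + y)(x - y) = D`, these
correspond to the nonzero values of `x + y`. -/
theorem sum_one_add_quadraticChar_sq_sub (h2 : (2 : F) ≠ 0) {D : F} (hD : D ≠ 0) :
    ∑ x : F, (quadraticChar F (x ^ 2 - D) + 1) = Fintype.card F - 1 := by
  have h1 : ∀ x : F, quadraticChar F (x ^ 2 - D) + 1 =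
      ((Finset.univ.filter fun y : F => y ^ 2 = x ^ 2 - D).card : ℤ) := fun x => by
    rw [← quadraticChar_card_sqrts (ringChar_ne_two h2)]
    congr 2
    ext y
    simp
  simp_rw [h1]
  rw [← Nat.cast_sum, ← Finset.card_sigma]
  have h3 : (Finset.univ.sigma fun x : F => Finset.univ.filter fun y : F => y ^ 2 = x ^ 2 - D).card
      =
      (Finset.univ.erase (0 : F)).card := by
    refine Finset.card_bij' (fun z _ => z.1 + z.2)
      (fun u _ => ⟨(u + D / u) / 2, (u - D / u) / 2⟩) ?_ ?_ ?_ ?_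
    · rintro ⟨x, y⟩ h
      simp only [Finset.mem_sigma, Finset.mem_univ, Finset.mem_filter, true_and] at h
      refine Finset.mem_erase.2 ⟨fun h0 => hD ?_, Finset.mem_univ _⟩
      have h0' : x + y = 0 := h0
      linear_combination h + (x - y) * h0'
    · intro u hu
      have hu0 : u ≠ 0 := (Finset.mem_erase.1 hu).1
      simp only [Finset.mem_sigma, Finset.mem_univ, Finset.mem_filter, true_and]
      field_simp
      ring
    · rintro ⟨x, y⟩ h
      simp only [Finset.mem_sigma, Finset.mem_univ, Finset.mem_filter, true_and] at h
      have h0 : x + y ≠ 0 := fun h0 => hD (by linear_combination h + (x - y) * h0)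
      have h4 : D / (x + y) = x - y := by
        rw [div_eq_iff h0]
        linear_combination h
      simp only [h4]
      congr 1
      · field_simp; ring
      · field_simp; ring
    · intro u hu
      have hu0 : u ≠ 0 := (Finset.mem_erase.1 hu).1
      field_simp
      ring
  rw [h3, Finset.card_erase_of_mem (Finset.mem_univ _), Finset.card_univ,
    Nat.cast_sub Fintype.card_pos]
  simp

theorem sum_quadraticChar_sq_sub (h2 : (2 : F) ≠ 0) {D : F} (hD : D ≠ 0) :
    ∑ x : F, quadraticChar F (x ^ 2 - D) = -1 := by
  have h := sum_one_add_quadraticChar_sq_sub h2 hD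
  rw [Finset.sum_add_distrib] at h
  simp only [Finset.sum_const, Finset.card_univ, nsmul_eq_mul, mul_one] at h
  linarith

theorem quadraticChar_four (h2 : (2 : F) ≠ 0) : quadraticChar F 4 = 1 := by
  rw [show (4 : F) = 2 ^ 2 by norm_num]
  exact quadraticChar_sq_one' h2

/-- Completing the square reduces this to `x² - D` with `D` the discriminant. -/
theorem sum_quadraticChar_quadratic (h2 : (2 : F) ≠ 0) {a b c : F} (ha : a ≠ 0)
    (hD : b ^ 2 - 4 * a * c ≠ 0) :
    ∑ x : F, quadraticChar F (a * x ^ 2 + b * x + c) = -quadraticChar F a := by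
  have h2a : 2 * a ≠ 0 := mul_ne_zero h2 ha
  have h1 : ∀ x : F, quadraticChar F (a * x ^ 2 + b * x + c) =
      quadraticChar F a * quadraticChar F ((2 * a * x + b) ^ 2 - (b ^ 2 - 4 * a * c)) := fun x => by
    have h3 : a * ((2 * a * x + b) ^ 2 - (b ^ 2 - 4 * a * c)) =
        (2 * a) ^ 2 * (a * x ^ 2 + b * x + c) := by ring
    rw [← map_mul, h3, map_mul, quadraticChar_sq_one' h2a, one_mul]
  simp_rw [h1]
  rw [← Finset.mul_sum]
  have h4 := Fintype.sum_bijective (fun x : F => 2 * a * x + b)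
    ((Equiv.mulLeft₀ _ h2a).trans (Equiv.addRight b)).bijective
    (fun x => quadraticChar F ((2 * a * x + b) ^ 2 - (b ^ 2 - 4 * a * c)))
    (fun y => quadraticChar F (y ^ 2 - (b ^ 2 - 4 * a * c))) fun _ => rfl
  rw [h4, sum_quadraticChar_sq_sub h2 hD]
  ring

theorem quadraticChar_cases (x : F) :
    quadraticChar F x = 0 ∨ quadraticChar F x = 1 ∨ quadraticChar F x = -1 := by
  rcases eq_or_ne x 0 with rfl | hx
  · exact Or.inl quadraticChar_zero
  · exact Or.inr (quadraticChar_dichotomy hx)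

theorem neg_one_le_quadraticChar (x : F) : -1 ≤ quadraticChar F x := by
  rcases quadraticChar_cases x with h | h | h <;> omega

theorem quadraticChar_le_one (x : F) : quadraticChar F x ≤ 1 := by
  rcases quadraticChar_cases x with h | h | h <;> omega

/-- For a square `d = e²` the curve `P² = t e (w² + e t w - d)`, `R² = t e (-w² + e t w + d)` has an
affine point over a finite field. -/
theorem exists_isSquare_and_isSquare (h2 : (2 : F) ≠ 0) {e t : F} (he : e ≠ 0) (ht : t ≠ 0)
    (ht4 : t ^ 2 + 4 ≠ 0) :
    ∃ w : F, IsSquare (t * e * (w ^ 2 + e * t * w - e ^ 2)) ∧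
      IsSquare (t * e * (-w ^ 2 + e * t * w + e ^ 2)) := by
  by_contra! hcon
  set χ := quadraticChar F
  set f : F → F := fun w => t * e * (w ^ 2 + e * t * w - e ^ 2)
  set g : F → F := fun w => t * e * (-w ^ 2 + e * t * w + e ^ 2)
  have hc : t * e ≠ 0 := mul_ne_zero ht he
  have hdisc : ∀ c : F, c ≠ 0 → c ^ 2 * (e ^ 2 * (t ^ 2 + 4)) ≠ 0 := fun c h =>
    mul_ne_zero (pow_ne_zero 2 h) (mul_ne_zero (pow_ne_zero 2 he) ht4)
  have hf : ∑ w, χ (f w) = -χ (t * e) := by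
    rw [← sum_quadraticChar_quadratic h2 hc (b := t * e * (e * t)) (c := -(t * e * e ^ 2))]
    · refine Finset.sum_congr rfl fun w _ => congrArg χ ?_
      simp only [f]; ring
    · convert hdisc _ hc using 1; ring
  have hg : ∑ w, χ (g w) = -χ (-(t * e)) := by
    rw [← sum_quadraticChar_quadratic h2 (neg_ne_zero.2 hc) (b := t * e * (e * t))
      (c := t * e * e ^ 2)]
    · refine Finset.sum_congr rfl fun w _ => congrArg χ ?_
      simp only [g]; ring
    · convert hdisc _ hc using 1; ring
  have hzero : ∑ w, (1 + χ (f w)) * (1 + χ (g w)) = 0 := by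
    refine Finset.sum_eq_zero fun w _ => ?_
    by_cases h : IsSquare (f w)
    · have : χ (g w) = -1 := quadraticChar_neg_one_iff_not_isSquare.2 (hcon w h)
      rw [this]; ring
    · have : χ (f w) = -1 := quadraticChar_neg_one_iff_not_isSquare.2 h
      rw [this]; ring
  have hne : e ≠ -e := fun h => (mul_ne_zero h2 he) (by linear_combination h)
  -- At `w = ±e` the product `f w * g w` is a nonzero square, so these two terms equal 2, and no
  -- term is negative. The sums of `χ (f w)` and of `χ (g w)` are at least `-1` each, so the whole
  -- sum is at least 2 and cannot vanish.
  have hprod : 4 ≤ ∑ w, (1 + χ (f w * g w)) := by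
    have hw : ∀ w : F, w ^ 2 = e ^ 2 → 1 + χ (f w * g w) = 2 := fun w hw => by
      have h0 : f w * g w = (t * e * (e * t * w)) ^ 2 := by
        simp only [f, g, hw]; ring
      have hw0 : w ≠ 0 := by
        rintro rfl
        exact pow_ne_zero 2 he (by rw [← hw]; ring)
      rw [h0, quadraticChar_sq_one' (mul_ne_zero hc (mul_ne_zero (mul_ne_zero he ht) hw0))]
      norm_num
    calc (4 : ℤ) = ∑ w ∈ {e, -e}, (1 + χ (f w * g w)) := by
          rw [Finset.sum_pair hne, hw e rfl, hw (-e) (by ring)]; norm_num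
      _ ≤ _ := Finset.sum_le_sum_of_subset_of_nonneg (Finset.subset_univ _) fun w _ _ => by
          have := neg_one_le_quadraticChar (f w * g w)
          linarith
  have hexp : ∀ w, (1 + χ (f w)) * (1 + χ (g w)) = (1 + χ (f w * g w)) + χ (f w) + χ (g w) :=
    fun w => by rw [map_mul χ (f w) (g w)]; ring
  simp_rw [hexp] at hzero
  rw [Finset.sum_add_distrib, Finset.sum_add_distrib, hf, hg] at hzero
  have h5 := quadraticChar_le_one (t * e)
  have h6 := quadraticChar_le_one (-(t * e))
  linarith

/-- If `-1` is a square, then `v² = n (4 n² + (1 - 8 a) n + 4 a²)` has a point with `n` and the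
    other
factor not squares. -/
theorem exists_not_isSquare_and_not_isSquare (h2 : (2 : F) ≠ 0) (hneg : IsSquare (-1 : F)) {a : F}
    (ha : a ≠ 0) (ha16 : 1 - 16 * a ≠ 0) :
    ∃ n : F, ¬IsSquare n ∧ ¬IsSquare (4 * n ^ 2 + (1 - 8 * a) * n + 4 * a ^ 2) := by
  by_contra! hcon
  set χ := quadraticChar F
  set g : F → F := fun n => 4 * n ^ 2 + (1 - 8 * a) * n + 4 * a ^ 2
  have h4 : (4 : F) ≠ 0 := by
    rw [show (4 : F) = 2 ^ 2 by norm_num]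
    exact pow_ne_zero 2 h2
  have hg : ∑ n, χ (g n) = -1 := by
    rw [← quadraticChar_four h2]
    refine sum_quadraticChar_quadratic h2 h4 ?_
    convert ha16 using 1; ring
  have hn : ∑ n, χ n = 0 := quadraticChar_sum_zero (ringChar_ne_two h2)
  have hzero : ∑ n, (1 - χ n) * (1 - χ (g n)) = 0 := by
    refine Finset.sum_eq_zero fun n _ => ?_
    -- At `n = 0` the first factor is 1, but `g 0 = (2a)²` is a nonzero square and kills the second.
    rcases eq_or_ne n 0 with rfl | hn0
    · have h0 : g 0 = (2 * a) ^ 2 := by simp only [g]; ring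
      rw [h0, quadraticChar_sq_one' (mul_ne_zero h2 ha)]
      ring
    by_cases h : IsSquare n
    · rw [(quadraticChar_one_iff_isSquare hn0).2 h]; ring
    · have hgn := hcon n h
      -- Since `g n = 4 (n - a)² + n`, a zero of `g` would give `n = (2 i (n - a))²` with `i² = -1`.
      have hg0 : g n ≠ 0 := fun h0 => h <| by
        obtain ⟨i, hi⟩ := hneg
        refine ⟨2 * i * (n - a), ?_⟩
        have h0' : 4 * n ^ 2 + (1 - 8 * a) * n + 4 * a ^ 2 = 0 := h0
        linear_combination h0' + 4 * (n - a) ^ 2 * hi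
      rw [(quadraticChar_one_iff_isSquare hg0).2 hgn]; ring
  have hexp : ∀ n, (1 - χ n) * (1 - χ (g n)) = (1 + χ (n * g n)) - χ n - χ (g n) :=
    fun n => by rw [map_mul χ n (g n)]; ring
  simp_rw [hexp] at hzero
  rw [Finset.sum_sub_distrib, Finset.sum_sub_distrib, hn, hg] at hzero
  -- The expanded sum is this one plus 1, because `χ n` sums to 0 and `χ (g n)` sums to `-1`.
  have h7 : 0 ≤ ∑ n, (1 + χ (n * g n)) := Finset.sum_nonneg fun n _ => by
    have := neg_one_le_quadraticChar (n * g n)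
    linarith
  linarith

end FiniteField

/-! ### Points of the homogeneous spaces over `ℚ_p` at the good primes -/

section Padic

open PadicInt Polynomial

variable {p : ℕ} [Fact p.Prime]

theorem toZMod_eq_zero_iff {x : ℤ_[p]} : toZMod x = 0 ↔ ‖x‖ < 1 := by
  rw [← RingHom.mem_ker, ker_toZMod, IsLocalRing.mem_maximalIdeal, mem_nonunits]

theorem isUnit_iff_toZMod_ne_zero {x : ℤ_[p]} : IsUnit x ↔ toZMod x ≠ 0 := by
  rw [ne_eq, toZMod_eq_zero_iff, ← mem_nonunits, mem_nonunits_iff, not_not]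

theorem ne_zero_of_toZMod {x : ℤ_[p]} (h : toZMod x ≠ 0) : x ≠ 0 := fun h0 => h
    (by rw [h0, map_zero])

theorem exists_toZMod_eq (x : ZMod p) : ∃ y : ℤ_[p], toZMod y = x :=
  ZMod.ringHom_surjective toZMod x

/-- Hensel's lemma at a simple root modulo `p`. -/
theorem exists_root_of_toZMod (F : ℤ_[p][X]) (r : ℤ_[p]) (h0 : toZMod (F.eval r) = 0)
    (h1 : toZMod (F.derivative.eval r) ≠ 0) : ∃ z, F.eval z = 0 ∧ toZMod z = toZMod r := by
  have h1' : ‖F.derivative.aeval r‖ = 1 := by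
    rw [Polynomial.coe_aeval_eq_eval]
    exact isUnit_iff.1 (isUnit_iff_toZMod_ne_zero.2 h1)
  obtain ⟨z, hz, hzr, -⟩ := hensels_lemma (F := F) (a := r) (by
    rw [h1', Polynomial.coe_aeval_eq_eval, one_pow]
    exact toZMod_eq_zero_iff.1 h0)
  rw [Polynomial.coe_aeval_eq_eval] at hz
  rw [h1', ← toZMod_eq_zero_iff, map_sub, sub_eq_zero] at hzr
  exact ⟨z, hz, hzr⟩

theorem exists_sq_eq_of_isSquare_toZMod (h2 : (2 : ZMod p) ≠ 0) {x : ℤ_[p]} (hx : toZMod x ≠ 0)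
    (h : IsSquare (toZMod x)) : ∃ y, y ^ 2 = x := by
  obtain ⟨r, hr⟩ := h
  obtain ⟨r, rfl⟩ := exists_toZMod_eq r
  have hr0 : toZMod r ≠ 0 := fun h0 => hx (by rw [hr, h0, zero_mul])
  obtain ⟨z, hz, -⟩ := exists_root_of_toZMod (X ^ 2 - C x) r
    (by simp [hr, sq]) (by simpa [map_ofNat, one_add_one_eq_two] using ⟨h2, hr0⟩)
  refine ⟨z, ?_⟩
  simpa [sub_eq_zero] using hz

theorem exists_root_quadratic (b c : ℤ_[p]) {r : ℤ_[p]} (h0 : toZMod (r ^ 2 + b * r + c) = 0)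
    (h1 : toZMod (b ^ 2 - 4 * c) ≠ 0) : ∃ z, z ^ 2 + b * z + c = 0 ∧ toZMod z = toZMod r := by
  obtain ⟨z, hz, hzr⟩ := exists_root_of_toZMod (X ^ 2 + C b * X + C c) r (by simpa using h0)
    (fun h => h1 (by
      -- The discriminant is the square of the derivative minus four times the value, so a unit
      -- discriminant makes every root modulo `p` simple.
      have e : b ^ 2 - 4 * c = ((X ^ 2 + C b * X + C c).derivative.eval r) ^ 2 -
          4 * (r ^ 2 + b * r + c) := by
        simp
        ring
      rw [e, map_sub, map_pow, map_mul, h, h0]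
      ring))
  exact ⟨z, by simpa using hz, hzr⟩

theorem isSquare_mul_of_not_isSquare {F : Type*} [Field F] [Finite F] {x y : F} (hx : ¬IsSquare x)
    (hy : ¬IsSquare y) : IsSquare (x * y) := by
  have : Fintype F := Fintype.ofFinite F
  have hx0 : x ≠ 0 := fun h => hx (h ▸ IsSquare.zero)
  have hy0 : y ≠ 0 := fun h => hy (h ▸ IsSquare.zero)
  rw [← quadraticChar_one_iff_isSquare (mul_ne_zero hx0 hy0), map_mul,
    quadraticChar_neg_one_iff_not_isSquare.2 hx, quadraticChar_neg_one_iff_not_isSquare.2 hy]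
  norm_num

theorem exists_sq_eq_mul (h2 : (2 : ZMod p) ≠ 0) {x y : ℤ_[p]} (hx : ¬IsSquare (toZMod x))
    (hy : ¬IsSquare (toZMod y)) : ∃ z, z ^ 2 = x * y := by
  have hx0 : toZMod x ≠ 0 := fun h => hx (h ▸ IsSquare.zero)
  have hy0 : toZMod y ≠ 0 := fun h => hy (h ▸ IsSquare.zero)
  refine exists_sq_eq_of_isSquare_toZMod h2 ?_ ?_
  · rw [map_mul]; exact mul_ne_zero hx0 hy0
  · rw [map_mul]; exact isSquare_mul_of_not_isSquare hx hy

/-- The equations of the homogeneous space `C'_d`, cleared of denominators. -/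
def HasIntegralPoint (t d : ℤ_[p]) : Prop :=
  ∃ s z w u : ℤ_[p], (s ≠ 0 ∨ z ≠ 0) ∧ u * z = w ^ 2 - d * s ^ 2 ∧
    4 * t ^ 2 * u ^ 2 = d * (4 * t ^ 2 * w * s - z ^ 2)

/-- For `d = e²` the two equations read `2 (2tu)(ez) = 4te (w² - e² s²)` and `(2tu)² + (ez)² = 4t²
e² w s`. Adding and subtracting gives `(ez ± 2tu)² = 4te (± (w² - e² s²) + e t w s)`. With `s = 1`
the two right-hand sides are, up to the square 4, the values of `P²` and `R²` below; the witness is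
rescaled to be integral. -/
theorem hasIntegralPoint_sq (h2 : (2 : ZMod p) ≠ 0) {t e : ℤ_[p]} (ht : toZMod t ≠ 0)
    (he : toZMod e ≠ 0) (ht4 : toZMod (t ^ 2 + 4) ≠ 0) : HasIntegralPoint t (e ^ 2) := by
  suffices H : ∃ w P R : ℤ_[p], P ^ 2 = t * e * (w ^ 2 + e * t * w - e ^ 2) ∧
      R ^ 2 = t * e * (-w ^ 2 + e * t * w + e ^ 2) by
    obtain ⟨w, P, R, hP, hR⟩ := H
    refine ⟨2 * t * e, 2 * t * (P + R), 2 * t * e * w, e * (P - R), Or.inl ?_, ?_, ?_⟩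
    · refine ne_zero_of_toZMod ?_
      simp only [map_mul, map_ofNat]
      exact mul_ne_zero (mul_ne_zero h2 ht) he
    · linear_combination 2 * e * t * (hP - hR)
    · linear_combination 8 * t ^ 2 * e ^ 2 * (hP + hR)
  have hdisc : toZMod (e * t) ^ 2 + 4 * toZMod e ^ 2 ≠ 0 := by
    have e1 : toZMod (e * t) ^ 2 + 4 * toZMod e ^ 2 = toZMod e ^ 2 * toZMod (t ^ 2 + 4) := by
      simp only [map_mul, map_add, map_pow, map_ofNat]
      ring
    rw [e1]
    exact mul_ne_zero (pow_ne_zero 2 he) ht4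
  obtain ⟨w₀, hP, hR⟩ := exists_isSquare_and_isSquare h2 he ht (by simpa [map_ofNat] using ht4)
  obtain ⟨w, rfl⟩ := exists_toZMod_eq w₀
  have hP' : IsSquare (toZMod (t * e * (w ^ 2 + e * t * w - e ^ 2))) := by simpa using hP
  have hR' : IsSquare (toZMod (t * e * (-w ^ 2 + e * t * w + e ^ 2))) := by simpa using hR
  have hte : toZMod t * toZMod e ≠ 0 := mul_ne_zero ht he
  have hboth : toZMod (w ^ 2 + e * t * w - e ^ 2) = 0 → toZMod (-w ^ 2 + e * t * w + e ^ 2) ≠ 0 :=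
      by
    intro h1 h3
    simp only [map_mul, map_add, map_sub, map_neg, map_pow] at h1 h3
    have h4 : 2 * (toZMod t * toZMod e) * toZMod w = 0 := by linear_combination h1 + h3
    have h5 : toZMod w = 0 := (mul_eq_zero.1 h4).resolve_left (mul_ne_zero h2 hte)
    rw [h5] at h3
    exact pow_ne_zero 2 he (by linear_combination h3)
  by_cases h1 : toZMod (w ^ 2 + e * t * w - e ^ 2) = 0
  -- A square root of something divisible by `p` need not lift. Instead `w` is moved within its
  -- residue class to an exact root, so that `P = 0`; the discriminant `e² (t² + 4)` is a unit. The
  -- other expression keeps its residue, which is nonzero by `hboth`.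
  · obtain ⟨z, hz, hzw⟩ := exists_root_quadratic (e * t) (-e ^ 2) (r := w)
      (by rw [← h1]; ring_nf) (by convert hdisc using 1; simp [map_ofNat])
    have hR'' : toZMod (t * e * (-w ^ 2 + e * t * w + e ^ 2)) =
        toZMod (t * e * (-z ^ 2 + e * t * z + e ^ 2)) := by
      simp only [map_mul, map_add, map_neg, map_pow, hzw]
    rw [hR''] at hR'
    obtain ⟨R, hR0⟩ := exists_sq_eq_of_isSquare_toZMod h2
      (by rw [← hR'', map_mul, map_mul]; exact mul_ne_zero hte (hboth h1)) hR'
    exact ⟨z, 0, R, by linear_combination -(t * e) * hz, hR0⟩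
  obtain h3 | h3 := eq_or_ne (toZMod (-w ^ 2 + e * t * w + e ^ 2)) 0
  · obtain ⟨z, hz, hzw⟩ := exists_root_quadratic (-(e * t)) (-e ^ 2) (r := w)
      (by rw [← neg_eq_zero, ← map_neg, ← h3]; ring_nf) (by convert hdisc using 1; simp [map_ofNat])
    have hP'' : toZMod (t * e * (w ^ 2 + e * t * w - e ^ 2)) =
        toZMod (t * e * (z ^ 2 + e * t * z - e ^ 2)) := by
      simp only [map_mul, map_add, map_sub, map_pow, hzw]
    rw [hP''] at hP'
    obtain ⟨P, hP0⟩ := exists_sq_eq_of_isSquare_toZMod h2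
      (by rw [← hP'', map_mul, map_mul]; exact mul_ne_zero hte h1) hP'
    exact ⟨z, P, 0, hP0, by linear_combination (t * e) * hz⟩
  · obtain ⟨P, hP0⟩ := exists_sq_eq_of_isSquare_toZMod h2
      (by rw [map_mul, map_mul]; exact mul_ne_zero hte h1) hP'
    obtain ⟨R, hR0⟩ := exists_sq_eq_of_isSquare_toZMod h2
      (by rw [map_mul, map_mul]; exact mul_ne_zero hte h3) hR'
    exact ⟨w, P, R, hP0, hR0⟩

/-- With `s = 0` and `z = 2t` the equations become `u = ±f` and `w² = 2 t u`. One of `2tf`, `-2tf`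
is a square because `-1` is not. -/
theorem hasIntegralPoint_neg_sq (h2 : (2 : ZMod p) ≠ 0) (hneg : ¬IsSquare (-1 : ZMod p))
    {t f : ℤ_[p]} (ht : toZMod t ≠ 0) (hf : toZMod f ≠ 0) : HasIntegralPoint t (-f ^ 2) := by
  have h2tf : toZMod (2 * t * f) ≠ 0 := by
    simp only [map_mul, map_ofNat]
    exact mul_ne_zero (mul_ne_zero h2 ht) hf
  have h2t : (2 * t : ℤ_[p]) ≠ 0 := left_ne_zero_of_mul (ne_zero_of_toZMod h2tf)
  by_cases h : IsSquare (toZMod (2 * t * f))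
  · obtain ⟨g, hg⟩ := exists_sq_eq_of_isSquare_toZMod h2 h2tf h
    exact ⟨0, 2 * t, g, f, Or.inr h2t, by linear_combination -hg, by ring⟩
  · obtain ⟨g, hg⟩ := exists_sq_eq_mul h2 (x := -1) (by simpa using hneg) h
    exact ⟨0, 2 * t, g, -f, Or.inr h2t, by linear_combination -hg, by ring⟩

/-- When `-1` is a square, the nonsquare units form two classes modulo fourth powers, inverse to
each other. It therefore suffices to find a single nonsquare unit `D` with a point on `C'_D`, since
exchanging `s` and `w` carries `C'_D` to the space of `1 / D`. -/
theorem hasIntegralPoint_of_not_isSquare (h2 : (2 : ZMod p) ≠ 0) (hneg : IsSquare (-1 : ZMod p))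
    {t d : ℤ_[p]} (ht : toZMod t ≠ 0) (ht4 : toZMod (t ^ 2 + 4) ≠ 0)
    (hd : ¬IsSquare (toZMod d)) : HasIntegralPoint t d := by
  have h4 : (4 : ZMod p) ≠ 0 := by
    rw [show (4 : ZMod p) = 2 ^ 2 by norm_num]
    exact pow_ne_zero 2 h2
  have h4t : toZMod (4 * t ^ 2) ≠ 0 := by
    simp only [map_mul, map_pow, map_ofNat]
    exact mul_ne_zero h4 (pow_ne_zero 2 ht)
  obtain ⟨b, hb⟩ : ∃ b : ℤ_[p], 4 * t ^ 2 * b = -1 := by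
    obtain ⟨v, hv⟩ := isUnit_iff_exists_inv.1 (isUnit_iff_toZMod_ne_zero.2 h4t)
    exact ⟨-v, by linear_combination -hv⟩
  have hb' : 4 * toZMod t ^ 2 * toZMod b = -1 := by simpa [map_ofNat] using congrArg toZMod hb
  have hb0 : toZMod b ≠ 0 := fun h => by
    rw [h, mul_zero] at hb'
    exact one_ne_zero (by linear_combination hb' : (1 : ZMod p) = 0)
  have hb16 : 1 - 16 * toZMod b ≠ 0 := fun h => ht4 <| by
    simp only [map_add, map_pow, map_ofNat]
    linear_combination toZMod t ^ 2 * h + 4 * hb'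
  obtain ⟨n₀, hn, hg⟩ := exists_not_isSquare_and_not_isSquare h2 hneg hb0 hb16
  obtain ⟨n, rfl⟩ := exists_toZMod_eq n₀
  obtain ⟨v, hv⟩ := exists_sq_eq_mul h2 (x := n) (y := 4 * n ^ 2 + (1 - 8 * b) * n + 4 * b ^ 2) hn
    (by simpa [map_ofNat] using hg)
  have hv0 : toZMod v ≠ 0 := fun h => by
    have h5 := congrArg toZMod hv
    rw [map_pow, h, map_mul, zero_pow two_ne_zero] at h5
    rcases mul_eq_zero.1 h5.symm with h6 | h6
    · exact hn (h6 ▸ IsSquare.zero)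
    · exact hg (by
        have h7 : (4 * toZMod n ^ 2 + (1 - 8 * toZMod b) * toZMod n + 4 * toZMod b ^ 2) = 0 := by
          simpa [map_ofNat] using h6
        rw [h7]; exact IsSquare.zero)
  obtain ⟨half, hhalf⟩ : ∃ y : ℤ_[p], 2 * y = 1 :=
    isUnit_iff_exists_inv.1 (isUnit_iff_toZMod_ne_zero.2 (by simpa [map_ofNat] using h2))
  -- The equation says that `z = 1`, `w = n - b` is a point of `C'_D`, where `b = -1 / (4t²)`. As a
  -- quadratic in `D` it has discriminant `n (4n² + (1 - 8b) n + 4b²) = v²`. The two roots differ by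
  -- the unit `v`, so at least one of them is a unit.
  obtain ⟨D, hD0, hD⟩ : ∃ D : ℤ_[p], toZMod D ≠ 0 ∧ ((n - b) ^ 2 - D) ^ 2 = D * n := by
    have key : ∀ v : ℤ_[p], v ^ 2 = n * (4 * n ^ 2 + (1 - 8 * b) * n + 4 * b ^ 2) →
        ((n - b) ^ 2 - half * (2 * (n - b) ^ 2 + n + v)) ^ 2 =
          half * (2 * (n - b) ^ 2 + n + v) * n := fun v hv => by
      have h2' : (2 : ℤ_[p]) ≠ 0 := ne_zero_of_toZMod (by simpa [map_ofNat] using h2)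
      refine mul_left_cancel₀ (pow_ne_zero 2 h2') ?_
      have e1 : 2 * (half * (2 * (n - b) ^ 2 + n + v)) = 2 * (n - b) ^ 2 + n + v := by
        rw [← mul_assoc, hhalf, one_mul]
      calc 2 ^ 2 * ((n - b) ^ 2 - half * (2 * (n - b) ^ 2 + n + v)) ^ 2
          = (2 * (n - b) ^ 2 - 2 * (half * (2 * (n - b) ^ 2 + n + v))) ^ 2 := by ring
        _ = 2 * (2 * (half * (2 * (n - b) ^ 2 + n + v))) * n := by
          rw [e1]; linear_combination hv
        _ = _ := by ring
    by_cases h : toZMod (half * (2 * (n - b) ^ 2 + n + v)) = 0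
    · refine ⟨half * (2 * (n - b) ^ 2 + n + -v), fun h' => hv0 ?_, key (-v) (by rw [neg_sq, hv])⟩
      have e1 : v = half * (2 * (n - b) ^ 2 + n + v) - half * (2 * (n - b) ^ 2 + n + -v) := by
        linear_combination -v * hhalf
      rw [e1, map_sub, h, h', sub_zero]
    · exact ⟨_, h, key v hv⟩
  have hn0 : toZMod n ≠ 0 := fun h => hn (h ▸ IsSquare.zero)
  have hDn : ¬IsSquare (toZMod D) := by
    rintro ⟨r, hr⟩
    have hr0 : r ≠ 0 := fun h => hD0 (by rw [hr, h, zero_mul])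
    have h5 := congrArg toZMod hD
    rw [map_mul, hr, map_pow] at h5
    refine hn ⟨toZMod ((n - b) ^ 2 - D) / r, ?_⟩
    field_simp
    linear_combination -h5
  obtain ⟨D', hD'⟩ := isUnit_iff_exists_inv.1 (isUnit_iff_toZMod_ne_zero.2 hD0)
  obtain ⟨c, hc⟩ := exists_sq_eq_mul h2 hd hDn
  have hd0 : toZMod d ≠ 0 := fun h => hd (h ▸ IsSquare.zero)
  have hc0 : toZMod c ≠ 0 := fun h => mul_ne_zero hd0 hD0 (by
    rw [← map_mul, ← hc, map_pow, h, zero_pow two_ne_zero])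
  by_cases hcs : IsSquare (toZMod c)
  -- Here `d = k⁴ / D`: the point of `C'_D` is used with `s` and `w` exchanged, `z` negated and `u`
  -- divided by `D`, then scaled by powers of `k`.
  · obtain ⟨k, rfl⟩ := exists_sq_eq_of_isSquare_toZMod h2 hc0 hcs
    have hk : k ≠ 0 := fun h => hc0 (by rw [h, zero_pow two_ne_zero, map_zero])
    have hdk : d = k ^ 4 * D' := by linear_combination -D' * hc - d * hD'
    refine ⟨n - b, -k, k ^ 2, k ^ 3 * ((n - b) ^ 2 - D) * D', Or.inr (neg_ne_zero.2 hk), ?_, ?_⟩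
    · rw [hdk]
      linear_combination k ^ 4 * hD'
    · rw [hdk]
      linear_combination (4 * t ^ 2 * k ^ 6 * D' ^ 2) * hD + (4 * t ^ 2 * k ^ 6 * D' * n) * hD' +
        (k ^ 6 * D') * hb
  -- Here `c` and `D` are both nonsquares, so `c D = k²` and `d = D (k / D)⁴`.
  · obtain ⟨k, hk⟩ := exists_sq_eq_mul h2 hcs hDn
    have hdk : d = D * (k * D') ^ 4 := by
      have e1 : k ^ 4 = d * D ^ 3 := by
        linear_combination (k ^ 2 + c * D) * hk + D ^ 2 * hc
      have e2 : D * (k * D') ^ 4 = d * (D * D') ^ 4 := by linear_combination D * D' ^ 4 * e1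
      rw [e2, hD']; ring
    refine ⟨1, k * D', (k * D') ^ 2 * (n - b), (k * D') ^ 3 * ((n - b) ^ 2 - D),
      Or.inl one_ne_zero, ?_, ?_⟩
    · rw [hdk]; ring
    · rw [hdk]
      linear_combination (4 * t ^ 2 * (k * D') ^ 6) * hD + D * (k * D') ^ 6 * hb

/-- If neither `d` nor `-1` is a square modulo `p`, then `-d` is one, so the three cases above are
exhaustive. -/
theorem hasIntegralPoint_of_toZMod_ne_zero (h2 : (2 : ZMod p) ≠ 0) {t d : ℤ_[p]}
    (ht : toZMod t ≠ 0) (ht4 : toZMod (t ^ 2 + 4) ≠ 0) (hd : toZMod d ≠ 0) :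
    HasIntegralPoint t d := by
  by_cases h1 : IsSquare (toZMod d)
  · obtain ⟨e, rfl⟩ := exists_sq_eq_of_isSquare_toZMod h2 hd h1
    exact hasIntegralPoint_sq h2 ht (fun h => hd (by rw [map_pow, h, zero_pow two_ne_zero])) ht4
  by_cases h3 : IsSquare (-1 : ZMod p)
  · exact hasIntegralPoint_of_not_isSquare h2 h3 ht ht4 h1
  · obtain ⟨f, hf⟩ := exists_sq_eq_mul h2 (x := -1) (by simpa using h3) h1
    rw [show d = -f ^ 2 by linear_combination hf]
    refine hasIntegralPoint_neg_sq h2 h3 ht fun h => hd ?_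
    rw [show d = -f ^ 2 by linear_combination hf, map_neg, map_pow, h]
    ring

end Padic

/-! ### The curve `E'` in the coordinates `p = (2Y + X + A) / (2t (X + A))`, `q = X / (4 (X + 2A))`
    -/

section Geometry

open WeierstrassCurve.Affine

variable {L : Type*} [Field L] [Algebra ℚ L] {L' : Type*} [Field L'] [Algebra ℚ L']

theorem two_ne_zero_of_rat (L : Type*) [Field L] [Algebra ℚ L] : (2 : L) ≠ 0 :=
  have := algebraRat.charZero L
  two_ne_zero

theorem four_ne_zero_of_rat (L : Type*) [Field L] [Algebra ℚ L] : (4 : L) ≠ 0 := by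
  rw [show (4 : L) = 2 ^ 2 by norm_num]
  exact pow_ne_zero 2 (two_ne_zero_of_rat L)

theorem t_ne_zero (t : ℚˣ) (L : Type*) [Field L] [Algebra ℚ L] : algebraMap ℚ L t ≠ 0 :=
  (map_ne_zero _).2 t.ne_zero

theorem A_eq (t : ℚˣ) (L : Type*) [Field L] [Algebra ℚ L] :
    64 * algebraMap ℚ L (A t) = algebraMap ℚ L t ^ 2 + 4 := by
  have h1 : 64 * A t = (t : ℚ) ^ 2 + 4 := by
    rw [A]
    ring
  simpa only [map_mul, map_add, map_pow, map_ofNat] using congrArg (algebraMap ℚ L) h1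

theorem a_eq (t : ℚˣ) (L : Type*) [Field L] [Algebra ℚ L] :
    4 * algebraMap ℚ L t ^ 2 * algebraMap ℚ L (a t) = -1 := by
  have h1 : 4 * (t : ℚ) ^ 2 * a t = -1 := by
    rw [a]
    field_simp
  simpa only [map_mul, map_neg, map_one, map_pow, map_ofNat] using congrArg (algebraMap ℚ L) h1

theorem A_ne_zero (t : ℚˣ) (L : Type*) [Field L] [Algebra ℚ L] : algebraMap ℚ L (A t) ≠ 0 := by
  have ht := t.ne_zero
  refine (map_ne_zero _).2 ?_
  rw [A]
  positivity

theorem a_ne_zero (t : ℚˣ) (L : Type*) [Field L] [Algebra ℚ L] : algebraMap ℚ L (a t) ≠ 0 := by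
  have ht := t.ne_zero
  exact (map_ne_zero _).2 (div_ne_zero (by norm_num) (by positivity))

theorem one_sub_sixteen_a_ne_zero (t : ℚˣ) (L : Type*) [Field L] [Algebra ℚ L] :
    1 - 16 * algebraMap ℚ L (a t) ≠ 0 := by
  have ht := t.ne_zero
  have h3 : 1 - 16 * a t ≠ 0 := by
    have : a t < 0 := div_neg_of_neg_of_pos (by norm_num) (by positivity)
    linarith
  simpa only [map_sub, map_mul, map_one, map_ofNat] using (map_ne_zero (algebraMap ℚ L)).2 h3

theorem nonsingular_E_iff (t : ℚˣ) {x y : L} : ((E t)⁄L).Nonsingular x y ↔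
    y ^ 2 + x * y + algebraMap ℚ L (a t) * y = x ^ 3 + algebraMap ℚ L (a t) * x ^ 2 := by
  have e1 : ((E t)⁄L).a₁ = 1 := map_one _
  have e2 : ((E t)⁄L).a₂ = algebraMap ℚ L (a t) := rfl
  have e3 : ((E t)⁄L).a₃ = algebraMap ℚ L (a t) := rfl
  have e4 : ((E t)⁄L).a₄ = 0 := map_zero _
  have e6 : ((E t)⁄L).a₆ = 0 := map_zero _
  rw [← ((E t)⁄L).equation_iff_nonsingular_of_Δ_ne_zero, equation_iff, e1, e2, e3, e4, e6]
  · ring_nf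
  · have h1 : ((E t)⁄L).Δ = (algebraMap ℚ L (a t)) ^ 4 * (1 - 16 * algebraMap ℚ L (a t)) := by
      simp only [WeierstrassCurve.Δ, WeierstrassCurve.b₂, WeierstrassCurve.b₄,
        WeierstrassCurve.b₆, WeierstrassCurve.b₈, e1, e2, e3, e4, e6]
      ring
    rw [h1]
    exact mul_ne_zero (pow_ne_zero 4 (a_ne_zero t L)) (one_sub_sixteen_a_ne_zero t L)

theorem nonsingular_E'_iff (t : ℚˣ) {x y : L} : ((E' t)⁄L).Nonsingular x y ↔
    y ^ 2 + x * y + algebraMap ℚ L (A t) * y = x ^ 3 + algebraMap ℚ L (A t) * x ^ 2 := by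
  have e1 : ((E' t)⁄L).a₁ = 1 := map_one _
  have e2 : ((E' t)⁄L).a₂ = algebraMap ℚ L (A t) := rfl
  have e3 : ((E' t)⁄L).a₃ = algebraMap ℚ L (A t) := rfl
  have e4 : ((E' t)⁄L).a₄ = 0 := map_zero _
  have e6 : ((E' t)⁄L).a₆ = 0 := map_zero _
  rw [← ((E' t)⁄L).equation_iff_nonsingular_of_Δ_ne_zero, equation_iff, e1, e2, e3, e4, e6]
  · ring_nf
  · have h1 : ((E' t)⁄L).Δ = (algebraMap ℚ L (A t)) ^ 4 * (1 - 16 * algebraMap ℚ L (A t)) := by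
      simp only [WeierstrassCurve.Δ, WeierstrassCurve.b₂, WeierstrassCurve.b₄,
        WeierstrassCurve.b₆, WeierstrassCurve.b₈, e1, e2, e3, e4, e6]
      ring
    rw [h1]
    refine mul_ne_zero (pow_ne_zero 4 (A_ne_zero t L)) fun h => ?_
    refine pow_ne_zero 2 (t_ne_zero t L) ?_
    linear_combination -4 * h - A_eq t L

theorem neg_some_E' (t : ℚˣ) {x y : L} (h : ((E' t)⁄L).Nonsingular x y) :
    ∃ h', -Point.some x y h = Point.some x (-y - x - algebraMap ℚ L (A t)) h' := by
  have e : ((E' t)⁄L).negY x y = -y - x - algebraMap ℚ L (A t) := by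
    have e1 : ((E' t)⁄L).a₁ = 1 := map_one _
    have e3 : ((E' t)⁄L).a₃ = algebraMap ℚ L (A t) := rfl
    rw [negY, e1, e3, one_mul]
  rw [← e]
  exact ⟨_, Point.neg_some h⟩

theorem neg_some_E (t : ℚˣ) {x y : L} (h : ((E t)⁄L).Nonsingular x y) :
    ∃ h', -Point.some x y h = Point.some x (-y - x - algebraMap ℚ L (a t)) h' := by
  have e : ((E t)⁄L).negY x y = -y - x - algebraMap ℚ L (a t) := by
    have e1 : ((E t)⁄L).a₁ = 1 := map_one _
    have e3 : ((E t)⁄L).a₃ = algebraMap ℚ L (a t) := rfl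
    rw [negY, e1, e3, one_mul]
  rw [← e]
  exact ⟨_, Point.neg_some h⟩

/-- Three points of `E'` on a line, two of them with distinct `x`-coordinates. -/
theorem add_some_E' (t : ℚˣ) {x₁ y₁ x₂ y₂ l x₃ y₃ : L} (h₁ : ((E' t)⁄L).Nonsingular x₁ y₁)
    (h₂ : ((E' t)⁄L).Nonsingular x₂ y₂) (hx : x₁ ≠ x₂) (hl : l * (x₁ - x₂) = y₁ - y₂)
    (h3 : x₃ = l ^ 2 + l - algebraMap ℚ L (A t) - x₁ - x₂)
    (h4 : y₃ = -(l * (x₃ - x₁) + y₁) - x₃ - algebraMap ℚ L (A t)) :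
    ∃ h₃, Point.some x₁ y₁ h₁ + Point.some x₂ y₂ h₂ = Point.some x₃ y₃ h₃ := by
  have e1 : ((E' t)⁄L).a₁ = 1 := map_one _
  have e2 : ((E' t)⁄L).a₂ = algebraMap ℚ L (A t) := rfl
  have e3 : ((E' t)⁄L).a₃ = algebraMap ℚ L (A t) := rfl
  have hs : ((E' t)⁄L).slope x₁ x₂ y₁ y₂ = l := by
    rw [slope_of_X_ne hx, div_eq_iff (sub_ne_zero.2 hx), hl]
  have hX : ((E' t)⁄L).addX x₁ x₂ l = x₃ := by
    rw [addX, e1, e2, h3]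
    ring
  have hY : ((E' t)⁄L).addY x₁ x₂ y₁ l = y₃ := by
    rw [addY, negAddY, negY, hX, e1, e3, h4, one_mul]
  subst hX hY hs
  exact ⟨_, Point.add_of_X_ne hx⟩

theorem add_some_E (t : ℚˣ) {x₁ y₁ x₂ y₂ l x₃ y₃ : L} (h₁ : ((E t)⁄L).Nonsingular x₁ y₁)
    (h₂ : ((E t)⁄L).Nonsingular x₂ y₂) (hx : x₁ ≠ x₂) (hl : l * (x₁ - x₂) = y₁ - y₂)
    (h3 : x₃ = l ^ 2 + l - algebraMap ℚ L (a t) - x₁ - x₂)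
    (h4 : y₃ = -(l * (x₃ - x₁) + y₁) - x₃ - algebraMap ℚ L (a t)) :
    ∃ h₃, Point.some x₁ y₁ h₁ + Point.some x₂ y₂ h₂ = Point.some x₃ y₃ h₃ := by
  have e1 : ((E t)⁄L).a₁ = 1 := map_one _
  have e2 : ((E t)⁄L).a₂ = algebraMap ℚ L (a t) := rfl
  have e3 : ((E t)⁄L).a₃ = algebraMap ℚ L (a t) := rfl
  have hs : ((E t)⁄L).slope x₁ x₂ y₁ y₂ = l := by
    rw [slope_of_X_ne hx, div_eq_iff (sub_ne_zero.2 hx), hl]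
  have hX : ((E t)⁄L).addX x₁ x₂ l = x₃ := by
    rw [addX, e1, e2, h3]
    ring
  have hY : ((E t)⁄L).addY x₁ x₂ y₁ l = y₃ := by
    rw [addY, negAddY, negY, hX, e1, e3, h4, one_mul]
  subst hX hY hs
  exact ⟨_, Point.add_of_X_ne hx⟩

theorem point_some_congr {L : Type*} [Field L] {W : WeierstrassCurve.Affine L} {x y x' y' : L}
    {h : W.Nonsingular x y}
    {h' : W.Nonsingular x' y'} (hx : x = x') (hy : y = y') :
    Point.some x y h = Point.some x' y' h' := by
  subst hx hy
  rfl

/-- The equation of `E'` in the coordinates `p`, `q`. -/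
def OnCurve (t : ℚˣ) (p q : L) : Prop := q ^ 2 - p ^ 2 + 16 * p ^ 2 * q ^ 2 = algebraMap ℚ L (a t)

/-- The equation factors as `(1 + 16 p²)(1 - 16 q²) = 1 - 16 a`, and the right side is nonzero
because `a` is a negative rational. Hence `q ≠ ±1/4`. -/
theorem OnCurve.one_sub_ne_zero {t : ℚˣ} {p q : L} (h : OnCurve t p q) : 1 - 4 * q ≠ 0 := fun h0 =>
    by
  refine one_sub_sixteen_a_ne_zero t L ?_
  rw [← h]
  linear_combination (1 + 4 * q) * (1 + 16 * p ^ 2) * h0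

theorem OnCurve.one_add_ne_zero {t : ℚˣ} {p q : L} (h : OnCurve t p q) : 1 + 4 * q ≠ 0 := fun h0 =>
    by
  refine one_sub_sixteen_a_ne_zero t L ?_
  rw [← h]
  linear_combination (1 - 4 * q) * (1 + 16 * p ^ 2) * h0

theorem OnCurve.rotate {t : ℚˣ} {p q i : L} (h : OnCurve t p q) (hi : i ^ 2 = -1) :
    OnCurve t (-(i * q)) (-(i * p)) := by
  rw [OnCurve, ← h]
  linear_combination (p ^ 2 - q ^ 2 + 16 * p ^ 2 * q ^ 2 * (i ^ 2 - 1)) * hi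

theorem OnCurve.nonsingular {t : ℚˣ} {p q : L} (h : OnCurve t p q) :
    ((E' t)⁄L).Nonsingular (8 * algebraMap ℚ L (A t) * q / (1 - 4 * q))
      (algebraMap ℚ L (A t) * (1 + 4 * q) * (2 * algebraMap ℚ L t * p - 1) / (2 * (1 - 4 * q))) :=
          by
  have h1 := h.one_sub_ne_zero
  have h2 := two_ne_zero_of_rat L
  have hA := A_eq t L
  have ha := a_eq t L
  have hα := A_ne_zero t L
  rw [nonsingular_E'_iff]
  rw [OnCurve] at h
  rw [← h] at ha
  field_simp
  linear_combination (1 + 4 * q) * (-4 * q ^ 2) * hA - (1 + 4 * q) * ha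

/-- The point of `E'` with coordinates `p`, `q`. -/
def ptPQ (t : ℚˣ) (p q : L) (h : OnCurve t p q) : ((E' t)⁄L).Point := .some _ _ h.nonsingular

/-- The point `(-A, 0)` of order two. -/
def ptS (t : ℚˣ) (L : Type*) [Field L] [Algebra ℚ L] : ((E' t)⁄L).Point :=
  .some (-algebraMap ℚ L (A t)) 0 ((nonsingular_E'_iff t).2 (by ring))

theorem ptT_nonsingular (t : ℚˣ) {i : L} (hi : i ^ 2 = -1) : ((E' t)⁄L).Nonsingular
    (-2 * algebraMap ℚ L (A t)) (algebraMap ℚ L (A t) * (2 + i * algebraMap ℚ L t) / 4) := by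
  rw [nonsingular_E'_iff]
  have hA := A_eq t L
  have h2 := two_ne_zero_of_rat L
  have h4 := four_ne_zero_of_rat L
  field_simp
  linear_combination algebraMap ℚ L (A t) ^ 2 * (hA + (algebraMap ℚ L t) ^ 2 * hi)

/-- The generator `T = (-2A, A (2 + i t) / 4)` of the kernel of the isogeny. -/
def ptT (t : ℚˣ) (i : L) (hi : i ^ 2 = -1) : ((E' t)⁄L).Point := .some _ _ (ptT_nonsingular t hi)

theorem neg_sq_I {L : Type*} [Field L] {i : L} (hi : i ^ 2 = -1) : (-i) ^ 2 = -1 := by rw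
    [neg_sq, hi]

theorem neg_ptT (t : ℚˣ) {i : L} (hi : i ^ 2 = -1) :
    -ptT t i hi = ptT t (-i) (neg_sq_I hi) := by
  obtain ⟨h', e⟩ := neg_some_E' t (ptT_nonsingular t hi)
  rw [ptT, e]
  have h4 := four_ne_zero_of_rat L
  refine point_some_congr rfl ?_
  field_simp
  ring

theorem ptS_add_ptS (t : ℚˣ) : ptS t L + ptS t L = 0 := by
  obtain ⟨h', e⟩ := neg_some_E' t (x := -algebraMap ℚ L (A t)) (y := 0)
    ((nonsingular_E'_iff t).2 (by ring))
  have h1 : -ptS t L = ptS t L := by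
    rw [ptS, e]
    exact point_some_congr rfl (by ring)
  nth_rewrite 1 [← h1]
  exact neg_add_cancel _

theorem ptT_add_ptS (t : ℚˣ) {i : L} (hi : i ^ 2 = -1) : ptT t i hi + ptS t L = -ptT t i hi := by
  rw [neg_ptT]
  have hA := A_eq t L
  have h2 := two_ne_zero_of_rat L
  have h4 := four_ne_zero_of_rat L
  have hα := A_ne_zero t L
  obtain ⟨h₃, e⟩ := add_some_E' t (l := -(2 + i * algebraMap ℚ L t) / 4)
    (x₃ := -2 * algebraMap ℚ L (A t))
    (y₃ := algebraMap ℚ L (A t) * (2 + -i * algebraMap ℚ L t) / 4) (ptT_nonsingular t hi)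
    ((nonsingular_E'_iff t).2 (by ring) :
      ((E' t)⁄L).Nonsingular (-algebraMap ℚ L (A t)) 0)
    (fun h => hα (by linear_combination -h)) (by field_simp; ring)
    (by field_simp; linear_combination -hA - (algebraMap ℚ L t) ^ 2 * hi) (by field_simp; ring)
  exact e

theorem two_nsmul_ptT (t : ℚˣ) {i : L} (hi : i ^ 2 = -1) : 2 • ptT t i hi = ptS t L := by
  have h1 : ptT t i hi + ptT t i hi = -ptS t L := by
    rw [← sub_eq_zero, sub_neg_eq_add, add_assoc, ptT_add_ptS, add_neg_cancel]
  rw [two_nsmul, h1, neg_eq_iff_add_eq_zero, ptS_add_ptS]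

theorem three_nsmul_ptT (t : ℚˣ) {i : L} (hi : i ^ 2 = -1) :
    3 • ptT t i hi = ptT t (-i) (neg_sq_I hi) := by
  rw [succ_nsmul', two_nsmul_ptT, ptT_add_ptS, neg_ptT]

theorem four_nsmul_ptT (t : ℚˣ) {i : L} (hi : i ^ 2 = -1) : 4 • ptT t i hi = 0 := by
  rw [show 4 = 2 * 2 from rfl, mul_nsmul', two_nsmul_ptT, two_nsmul, ptS_add_ptS]

/-- In these coordinates translation by the kernel is linear: it multiplies `p - q` by `i` and `p +
q` by `-i`. The invariance of the isogeny and the behaviour of the homogeneous spaces under change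
of `δ` both come from this. -/
theorem ptPQ_add_ptT (t : ℚˣ) {p q i : L} (h : OnCurve t p q) (hi : i ^ 2 = -1) :
    ptPQ t p q h + ptT t i hi = ptPQ t (-(i * q)) (-(i * p)) (h.rotate hi) := by
  -- With `u = i p` the new second coordinate is `-u`, so that no `i` is left in the denominator `1
  -- + 4u` of the translated point.
  obtain ⟨u, rfl⟩ : ∃ u, p = -(i * u) := ⟨i * p, by linear_combination p * hi⟩
  have hu : -(i * -(i * u)) = -u := by linear_combination u * hi
  have h1 := h.one_sub_ne_zero
  have h1' : 1 + 4 * u ≠ 0 := by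
    have := (h.rotate hi).one_sub_ne_zero
    rwa [hu, mul_neg, sub_neg_eq_add] at this
  have hA := A_eq t L
  have h2 := two_ne_zero_of_rat L
  have h4 := four_ne_zero_of_rat L
  have h8 : (8 : L) ≠ 0 := by
    rw [show (8 : L) = 2 ^ 3 by norm_num]
    exact pow_ne_zero 3 h2
  have hα := A_ne_zero t L
  have ha : 4 * algebraMap ℚ L t ^ 2 * (q ^ 2 + u ^ 2 - 16 * u ^ 2 * q ^ 2) = -1 := by
    have h' := h
    rw [OnCurve] at h'
    rw [← a_eq t L, ← h']
    linear_combination (4 * algebraMap ℚ L t ^ 2 * u ^ 2 * (1 - 16 * q ^ 2)) * hi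
  obtain ⟨h₃, e⟩ := add_some_E' t (l := -1 / 2 -
      (i * algebraMap ℚ L t / 8) * (1 + 4 * u + 16 * u * q - 4 * q))
    (x₃ := -8 * algebraMap ℚ L (A t) * u / (1 + 4 * u))
    (y₃ := algebraMap ℚ L (A t) * (1 - 4 * u) * (-2 * algebraMap ℚ L t * i * q - 1) /
      (2 * (1 + 4 * u))) h.nonsingular (ptT_nonsingular t hi)
    (fun h5 => by
      rw [div_eq_iff h1] at h5
      exact mul_ne_zero h2 hα (by linear_combination h5))
    (by field_simp; ring)
    (by
      have h1'' : 1 + u * 4 ≠ 0 := by rwa [mul_comm u]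
      field_simp
      linear_combination (-4 * (1 + 12 * u - 12 * q - 80 * u * q)) * hA -
        4 * (-12 - 16 * u + 16 * q - 64 * u * q) * ha - 4 * algebraMap ℚ L t ^ 2 *
        (1 + 4 * u + 16 * u * q - 4 * q) ^ 2 * ((1 + 4 * u) * (1 - 4 * q)) * hi)
    (by field_simp; ring)
  rw [ptPQ, ptT, e, ptPQ]
  refine point_some_congr ?_ ?_
  · rw [hu]; ring_nf
  · rw [hu]; ring_nf

end Geometry

/-! ### The points of `E'` and the isogeny in these coordinates -/

section Geometry

open WeierstrassCurve.Affine

variable {L : Type*} [Field L] [Algebra ℚ L] {L' : Type*} [Field L'] [Algebra ℚ L']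

theorem dualIsogeny_some_of_eq_zero (t : ℚˣ) {X Y : L} (h : ((E' t)⁄L).Nonsingular X Y)
    (hX : (X + algebraMap ℚ L (A t)) * (X + 2 * algebraMap ℚ L (A t)) = 0) :
    dualIsogeny t L (.some X Y h) = 0 := by
  rw [dualIsogeny, dif_pos hX]
  rfl

/-- The excluded values `X = -A` and `X = -2A` belong to the nonzero points of the kernel, so every
point outside the kernel has coordinates `p`, `q`. -/
theorem exists_ptPQ (t : ℚˣ) {X Y : L} (h : ((E' t)⁄L).Nonsingular X Y)
    (hX : (X + algebraMap ℚ L (A t)) * (X + 2 * algebraMap ℚ L (A t)) ≠ 0) :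
    ∃ h', Point.some X Y h = ptPQ t ((2 * Y + X + algebraMap ℚ L (A t)) /
      (2 * algebraMap ℚ L t * (X + algebraMap ℚ L (A t))))
          (X / (4 * (X + 2 * algebraMap ℚ L (A t))))
      h' := by
  have h1 := left_ne_zero_of_mul hX
  have h2 := right_ne_zero_of_mul hX
  have hτ := t_ne_zero t L
  have hA := A_eq t L
  have hα := A_ne_zero t L
  have h20 := two_ne_zero_of_rat L
  have h40 := four_ne_zero_of_rat L
  have hE := (nonsingular_E'_iff t).1 h
  have hp : ((2 * Y + X + algebraMap ℚ L (A t)) /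
      (2 * algebraMap ℚ L t * (X + algebraMap ℚ L (A t)))) ^ 2 =
      (4 * X ^ 2 + X + algebraMap ℚ L (A t)) /
        (4 * algebraMap ℚ L t ^ 2 * (X + algebraMap ℚ L (A t))) := by
    rw [div_pow, div_eq_div_iff (by positivity) (by positivity)]
    linear_combination (16 * algebraMap ℚ L t ^ 2 * (X + algebraMap ℚ L (A t))) * hE
  have hb : algebraMap ℚ L (a t) = -1 / (4 * algebraMap ℚ L t ^ 2) := by
    rw [eq_div_iff (by positivity)]
    linear_combination a_eq t L
  have hcurve : OnCurve t ((2 * Y + X + algebraMap ℚ L (A t)) /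
      (2 * algebraMap ℚ L t * (X + algebraMap ℚ L (A t))))
      (X / (4 * (X + 2 * algebraMap ℚ L (A t)))) := by
    rw [OnCurve, hp, hb]
    field_simp
    linear_combination (-4 * X ^ 2 * (X + algebraMap ℚ L (A t))) * hA
  refine ⟨hcurve, ?_⟩
  have h3 : 1 - 4 * (X / (4 * (X + 2 * algebraMap ℚ L (A t)))) =
      2 * algebraMap ℚ L (A t) / (X + 2 * algebraMap ℚ L (A t)) := by
    field_simp
    ring
  have h2' : X + algebraMap ℚ L (A t) * 2 ≠ 0 := by rwa [mul_comm _ (2 : L)]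
  refine point_some_congr ?_ ?_
  · rw [h3]
    field_simp
    ring
  · rw [h3]
    field_simp
    ring

theorem ptPQ_X_add_A (t : ℚˣ) {p q : L} (h : OnCurve t p q) :
    8 * algebraMap ℚ L (A t) * q / (1 - 4 * q) + algebraMap ℚ L (A t) =
      algebraMap ℚ L (A t) * (1 + 4 * q) / (1 - 4 * q) := by
  have h1 := h.one_sub_ne_zero
  have h1' : 1 - q * 4 ≠ 0 := by rwa [mul_comm q]
  field_simp
  ring

theorem ptPQ_X_add_two_A (t : ℚˣ) {p q : L} (h : OnCurve t p q) :
    8 * algebraMap ℚ L (A t) * q / (1 - 4 * q) + 2 * algebraMap ℚ L (A t) =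
      2 * algebraMap ℚ L (A t) / (1 - 4 * q) := by
  have h1 := h.one_sub_ne_zero
  have h1' : 1 - q * 4 ≠ 0 := by rwa [mul_comm q]
  field_simp
  ring

theorem ptPQ_X_ne (t : ℚˣ) {p q : L} (h : OnCurve t p q) :
    (8 * algebraMap ℚ L (A t) * q / (1 - 4 * q) + algebraMap ℚ L (A t)) *
      (8 * algebraMap ℚ L (A t) * q / (1 - 4 * q) + 2 * algebraMap ℚ L (A t)) ≠ 0 := by
  have h1 := h.one_sub_ne_zero
  have h2 := h.one_add_ne_zero
  have hα := A_ne_zero t L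
  have h20 := two_ne_zero_of_rat L
  rw [ptPQ_X_add_A t h, ptPQ_X_add_two_A t h]
  positivity

theorem OnCurve.nonsingular_E {t : ℚˣ} {p q : L} (h : OnCurve t p q) :
    ((E t)⁄L).Nonsingular (p ^ 2 - q ^ 2) (4 * p * q * (p - q) ^ 2) := by
  rw [nonsingular_E_iff, ← h]
  ring

/-- The two quotients in the definition of the isogeny are `4 p q` and `p - q`; the equation of the
curve then simplifies `-a + (4pq)²` to `p² - q²`. -/
theorem dualIsogeny_ptPQ (t : ℚˣ) {p q : L} (h : OnCurve t p q) :
    dualIsogeny t L (ptPQ t p q h) = .some _ _ h.nonsingular_E := by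
  have hX := ptPQ_X_ne t h
  have h1 := h.one_sub_ne_zero
  have h1' := h.one_add_ne_zero
  have h1'' : 1 - q * 4 ≠ 0 := by rwa [mul_comm q]
  have h1''' : 1 + q * 4 ≠ 0 := by rwa [mul_comm q]
  have hτ := t_ne_zero t L
  have hα := A_ne_zero t L
  have h2 := two_ne_zero_of_rat L
  have h4 := four_ne_zero_of_rat L
  rw [ptPQ, dualIsogeny, dif_neg hX]
  have e0 : 2 * (algebraMap ℚ L (A t) * (1 + 4 * q) * (2 * algebraMap ℚ L t * p - 1) /
      (2 * (1 - 4 * q))) + 8 * algebraMap ℚ L (A t) * q / (1 - 4 * q) + algebraMap ℚ L (A t) =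
      2 * algebraMap ℚ L (A t) * algebraMap ℚ L t * p * (1 + 4 * q) / (1 - 4 * q) := by
    field_simp
    ring
  have e1 : 8 * algebraMap ℚ L (A t) * q / (1 - 4 * q) *
      (2 * algebraMap ℚ L (A t) * algebraMap ℚ L t * p * (1 + 4 * q) / (1 - 4 * q)) /
      (2 * algebraMap ℚ L t * (algebraMap ℚ L (A t) * (1 + 4 * q) / (1 - 4 * q)) *
        (2 * algebraMap ℚ L (A t) / (1 - 4 * q))) = 4 * p * q := by
    field_simp
    ring
  have e2 : (2 * (2 * algebraMap ℚ L (A t) / (1 - 4 * q)) *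
      (2 * algebraMap ℚ L (A t) * algebraMap ℚ L t * p * (1 + 4 * q) / (1 - 4 * q)) -
      algebraMap ℚ L t * (8 * algebraMap ℚ L (A t) * q / (1 - 4 * q)) *
        (algebraMap ℚ L (A t) * (1 + 4 * q) / (1 - 4 * q))) /
      (4 * algebraMap ℚ L t * (algebraMap ℚ L (A t) * (1 + 4 * q) / (1 - 4 * q)) *
        (2 * algebraMap ℚ L (A t) / (1 - 4 * q))) = p - q := by
    field_simp
    ring
  refine point_some_congr ?_ ?_
  · rw [e0, ptPQ_X_add_A t h, ptPQ_X_add_two_A t h, e1, ← h]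
    ring
  · rw [e0, ptPQ_X_add_A t h, ptPQ_X_add_two_A t h, e1, e2, ← h]
    ring

theorem dualIsogeny_ptPQ_ne_zero (t : ℚˣ) {p q : L} (h : OnCurve t p q) :
    dualIsogeny t L (ptPQ t p q h) ≠ 0 := by
  rw [dualIsogeny_ptPQ]
  exact Point.some_ne_zero _

theorem nsmul_ptT_mod (t : ℚˣ) {i : L} (hi : i ^ 2 = -1) (m : ℕ) :
    m • ptT t i hi = (m % 4) • ptT t i hi := by
  conv_lhs => rw [← Nat.div_add_mod m 4, add_nsmul, mul_nsmul, four_nsmul_ptT, nsmul_zero, zero_add]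

theorem exists_nsmul_ptT_of_X (t : ℚˣ) {i : L} (hi : i ^ 2 = -1) {X Y : L}
    (h : ((E' t)⁄L).Nonsingular X Y)
    (hX : (X + algebraMap ℚ L (A t)) * (X + 2 * algebraMap ℚ L (A t)) = 0) :
    ∃ m < 4, Point.some X Y h = m • ptT t i hi := by
  have hE := (nonsingular_E'_iff t).1 h
  have h4 := four_ne_zero_of_rat L
  have hA := A_eq t L
  rcases mul_eq_zero.1 hX with h0 | h0
  · obtain rfl : X = -algebraMap ℚ L (A t) := by linear_combination h0
    obtain rfl : Y = 0 := pow_eq_zero_iff two_ne_zero |>.1 (by linear_combination hE)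
    exact ⟨2, by norm_num, (two_nsmul_ptT t hi).symm⟩
  · obtain rfl : X = -2 * algebraMap ℚ L (A t) := by linear_combination h0
    have h5 : (Y - algebraMap ℚ L (A t) * (2 + i * algebraMap ℚ L t) / 4) *
        (Y - algebraMap ℚ L (A t) * (2 + -i * algebraMap ℚ L t) / 4) = 0 := by
      field_simp
      linear_combination 16 * hE - algebraMap ℚ L (A t) ^ 2 * (hA + algebraMap ℚ L t ^ 2 * hi)
    rcases mul_eq_zero.1 h5 with h6 | h6
    · exact ⟨1, by norm_num, by rw [one_nsmul]; exact point_some_congr rfl (sub_eq_zero.1 h6)⟩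
    · exact ⟨3, by norm_num, by
        rw [three_nsmul_ptT]; exact point_some_congr rfl (sub_eq_zero.1 h6)⟩

theorem point_cases (t : ℚˣ) {i : L} (hi : i ^ 2 = -1) (P : ((E' t)⁄L).Point) :
    (∃ m < 4, P = m • ptT t i hi) ∨ ∃ p q, ∃ h : OnCurve t p q, P = ptPQ t p q h := by
  rcases P with _ | ⟨X, Y, h⟩
  · exact Or.inl ⟨0, by norm_num, (zero_nsmul _).symm⟩
  · by_cases hX : (X + algebraMap ℚ L (A t)) * (X + 2 * algebraMap ℚ L (A t)) = 0
    · exact Or.inl (exists_nsmul_ptT_of_X t hi h hX)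
    · exact Or.inr ⟨_, _, exists_ptPQ t h hX⟩

theorem dualIsogeny_nsmul_ptT (t : ℚˣ) {i : L} (hi : i ^ 2 = -1) (m : ℕ) :
    dualIsogeny t L (m • ptT t i hi) = 0 := by
  have hT : ∀ {i : L} (hi : i ^ 2 = -1), dualIsogeny t L (ptT t i hi) = 0 := fun hi =>
    dualIsogeny_some_of_eq_zero t _ (by ring)
  rw [nsmul_ptT_mod]
  have hm := Nat.mod_lt m (by norm_num : 4 > 0)
  interval_cases m % 4
  · rw [zero_nsmul]; rfl
  · rw [one_nsmul]; exact hT hi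
  · rw [two_nsmul_ptT]; exact dualIsogeny_some_of_eq_zero t _ (by ring)
  · rw [three_nsmul_ptT]; exact hT _

theorem dualIsogeny_eq_zero_iff (t : ℚˣ) {i : L} (hi : i ^ 2 = -1) {P : ((E' t)⁄L).Point} :
    dualIsogeny t L P = 0 ↔ ∃ m : ℕ, P = m • ptT t i hi := by
  refine ⟨fun h => ?_, ?_⟩
  · rcases point_cases t hi P with ⟨m, -, hm⟩ | ⟨p, q, hpq, rfl⟩
    · exact ⟨m, hm⟩
    · exact absurd h (dualIsogeny_ptPQ_ne_zero t hpq)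
  · rintro ⟨m, rfl⟩
    exact dualIsogeny_nsmul_ptT t hi m

theorem ptPQ_congr {t : ℚˣ} {p q p' q' : L} {h : OnCurve t p q} {h' : OnCurve t p' q'}
    (hp : p = p') (hq : q = q') : ptPQ t p q h = ptPQ t p' q' h' := by
  subst hp hq
  rfl

theorem OnCurve.neg {t : ℚˣ} {p q : L} (h : OnCurve t p q) : OnCurve t (-p) q := by
  rw [OnCurve, ← h]
  ring

theorem neg_ptPQ (t : ℚˣ) {p q : L} (h : OnCurve t p q) : -ptPQ t p q h = ptPQ t (-p) q h.neg := by
  have h1 := h.one_sub_ne_zero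
  have h2 := two_ne_zero_of_rat L
  obtain ⟨h', e⟩ := neg_some_E' t h.nonsingular
  rw [ptPQ, e]
  refine point_some_congr rfl ?_
  field_simp
  ring

theorem dualIsogeny_neg (t : ℚˣ) {i : L} (hi : i ^ 2 = -1) (P : ((E' t)⁄L).Point) :
    dualIsogeny t L (-P) = -dualIsogeny t L P := by
  rcases point_cases t hi P with ⟨m, -, rfl⟩ | ⟨p, q, h, rfl⟩
  · rw [dualIsogeny_nsmul_ptT, neg_zero, dualIsogeny_eq_zero_iff t hi]
    refine ⟨3 * m, ?_⟩
    rw [neg_eq_iff_add_eq_zero, ← add_nsmul, show m + 3 * m = m * 4 by ring, mul_nsmul',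
      four_nsmul_ptT, nsmul_zero]
  · obtain ⟨h', e⟩ := neg_some_E t h.nonsingular_E
    rw [neg_ptPQ, dualIsogeny_ptPQ, dualIsogeny_ptPQ, e]
    refine point_some_congr (by ring) ?_
    rw [← h]
    ring

theorem dualIsogeny_add_ptT (t : ℚˣ) {i : L} (hi : i ^ 2 = -1) (P : ((E' t)⁄L).Point) :
    dualIsogeny t L (P + ptT t i hi) = dualIsogeny t L P := by
  rcases point_cases t hi P with ⟨m, -, rfl⟩ | ⟨p, q, h, rfl⟩
  · rw [← succ_nsmul, dualIsogeny_nsmul_ptT, dualIsogeny_nsmul_ptT]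
  · rw [ptPQ_add_ptT, dualIsogeny_ptPQ, dualIsogeny_ptPQ]
    refine point_some_congr ?_ ?_
    · linear_combination (q ^ 2 - p ^ 2) * hi
    · linear_combination (4 * p * q * (p - q) ^ 2 * (i ^ 2 - 1)) * hi

theorem dualIsogeny_add_nsmul_ptT (t : ℚˣ) {i : L} (hi : i ^ 2 = -1) (P : ((E' t)⁄L).Point)
    (m : ℕ) : dualIsogeny t L (P + m • ptT t i hi) = dualIsogeny t L P := by
  induction m with
  | zero => rw [zero_nsmul, add_zero]
  | succ m ih => rw [succ_nsmul, ← add_assoc, dualIsogeny_add_ptT, ih]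

/-- The isogeny is surjective over an algebraically closed field. -/
theorem dualIsogeny_surjective (t : ℚˣ) [IsAlgClosed L] :
    Function.Surjective (dualIsogeny t L) := by
  rintro (_ | ⟨x, y, h⟩)
  · exact ⟨0, rfl⟩
  have h2 := two_ne_zero_of_rat L
  have hE := (nonsingular_E_iff t).1 h
  -- The unknowns stand for `g = p - q`, `k = p + q`, `r = 4 p q`. The last equation fixes `r` up to
  -- sign; for `r ≠ 0` one takes `g² = y / r` and `k² = y / r + r`, and the equation of `E` yields
  -- `(g k)² = x²`, leaving only the sign of `k` to adjust.
  suffices H : ∃ g k r : L, g * k = x ∧ g ^ 2 * r = y ∧ k ^ 2 = g ^ 2 + r ∧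
      r ^ 2 = x + algebraMap ℚ L (a t) by
    obtain ⟨g, k, r, h1, h3, h4, h5⟩ := H
    have hc : OnCurve t ((g + k) / 2) ((k - g) / 2) := by
      rw [OnCurve]
      field_simp
      linear_combination 16 * (k ^ 2 - g ^ 2 + r) * h4 + 16 * h5 - 16 * h1
    refine ⟨ptPQ t _ _ hc, ?_⟩
    rw [dualIsogeny_ptPQ]
    refine point_some_congr ?_ ?_
    · field_simp
      linear_combination 4 * h1
    · field_simp
      linear_combination 16 * g ^ 2 * h4 + 16 * h3
  obtain ⟨r, hr⟩ := IsAlgClosed.exists_pow_nat_eq (x + algebraMap ℚ L (a t)) (n := 2) (by norm_num)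
  rcases eq_or_ne r 0 with rfl | hr0
  · obtain ⟨g, hg⟩ := IsAlgClosed.exists_pow_nat_eq x (n := 2) (by norm_num)
    have hy : y = 0 := pow_eq_zero_iff two_ne_zero |>.1 (by
      linear_combination hE + (y - x ^ 2) * hr)
    exact ⟨g, g, 0, by linear_combination hg, by rw [hy, mul_zero], by ring, hr⟩
  · obtain ⟨g, hg⟩ := IsAlgClosed.exists_pow_nat_eq (y / r) (n := 2) (by norm_num)
    obtain ⟨k, hk⟩ := IsAlgClosed.exists_pow_nat_eq (y / r + r) (n := 2) (by norm_num)
    have h6 : (g * k) ^ 2 = x ^ 2 := by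
      rw [mul_pow, hg, hk]
      field_simp
      linear_combination hE + (y - x ^ 2) * hr
    rcases sq_eq_sq_iff_eq_or_eq_neg.1 h6 with h7 | h7
    · exact ⟨g, k, r, h7, by rw [hg]; field_simp, by rw [hk, hg], hr⟩
    · exact ⟨g, -k, r, by linear_combination -h7, by rw [hg]; field_simp, by rw [neg_sq, hk, hg],
        hr⟩

/-- The value `(x, y)` determines `(p - q)⁴ = x² - y`, so `p - q` is known up to a power of `i`,
which a translation by a multiple of `T` removes. If `p ≠ q`, then `p + q = x / (p - q)` is
determined as well. If `p = q`, only `(p q)² = (x + a) / 16` is known: adding `T` changes the sign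
of `p q`, and adding `2T` changes the sign of `p`. -/
theorem dualIsogeny_fiber (t : ℚˣ) {i : L} (hi : i ^ 2 = -1) {P Q : ((E' t)⁄L).Point}
    (hPQ : dualIsogeny t L P = dualIsogeny t L Q) : ∃ m : ℕ, Q = P + m • ptT t i hi := by
  rcases point_cases t hi P with ⟨m, hm4, rfl⟩ | ⟨p, q, h, rfl⟩
  · rw [dualIsogeny_nsmul_ptT, eq_comm, dualIsogeny_eq_zero_iff t hi] at hPQ
    obtain ⟨n, rfl⟩ := hPQ
    refine ⟨n + (4 - m), ?_⟩
    rw [← add_nsmul, show m + (n + (4 - m)) = n + 4 by omega, add_nsmul, four_nsmul_ptT, add_zero]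
  rcases point_cases t hi Q with ⟨m, -, rfl⟩ | ⟨p', q', h', rfl⟩
  · rw [dualIsogeny_nsmul_ptT] at hPQ
    exact absurd hPQ (dualIsogeny_ptPQ_ne_zero t h)
  rw [dualIsogeny_ptPQ, dualIsogeny_ptPQ, Point.some.injEq] at hPQ
  obtain ⟨hx, hy⟩ := hPQ
  have h2 := two_ne_zero_of_rat L
  -- translate so that the quantities `p - q` agree, and treat the point `(0, 0)` apart
  have main : ∀ {p q p' q' : L} (h : OnCurve t p q) (h' : OnCurve t p' q'),
      p ^ 2 - q ^ 2 = p' ^ 2 - q' ^ 2 → p - q = p' - q' → 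
      (p - q = 0 → p * q = p' * q') →
      ∃ m : ℕ, ptPQ t p' q' h' = ptPQ t p q h + m • ptT t i hi := by
    intro p q p' q' h h' hx hg hr
    by_cases hg0 : p - q = 0
    · have e1 : q = p := by linear_combination -hg0
      have e2 : q' = p' := by linear_combination hg - hg0
      have h3 : p ^ 2 = p' ^ 2 := by
        have := hr hg0
        rw [e1, e2] at this
        linear_combination this
      rcases sq_eq_sq_iff_eq_or_eq_neg.1 h3 with h4 | h4
      · exact ⟨0, by rw [zero_nsmul, add_zero]; exact ptPQ_congr h4.symm (by rw [e1, e2, h4])⟩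
      · refine ⟨2, ?_⟩
        rw [two_nsmul, ← add_assoc, ptPQ_add_ptT, ptPQ_add_ptT]
        exact ptPQ_congr (by rw [h4]; linear_combination p' * hi)
          (by rw [e1, e2, h4]; linear_combination p' * hi)
    · have h3 : p + q = p' + q' := mul_left_cancel₀ hg0 (by
        linear_combination hx - (p' + q') * hg)
      refine ⟨0, ?_⟩
      rw [zero_nsmul, add_zero]
      refine ptPQ_congr (mul_left_cancel₀ h2 ?_) (mul_left_cancel₀ h2 ?_)
      · linear_combination -h3 - hg
      · linear_combination -h3 + hg
  have hshift : ∀ {p q : L} (h : OnCurve t p q),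
      (∃ m : ℕ, ptPQ t p' q' h' = ptPQ t (-(i * q)) (-(i * p)) (h.rotate hi) + m • ptT t i hi) →
      ∃ m : ℕ, ptPQ t p' q' h' = ptPQ t p q h + m • ptT t i hi := by
    rintro p q h ⟨m, hm⟩
    exact ⟨m + 1, by rw [hm, ← ptPQ_add_ptT t h hi, succ_nsmul', add_assoc]⟩
  have hrot : ∀ p q : L, (-(i * q)) ^ 2 - (-(i * p)) ^ 2 = p ^ 2 - q ^ 2 := fun p q => by
    linear_combination (q ^ 2 - p ^ 2) * hi
  have main' : ∀ {p q : L} (h : OnCurve t p q), p ^ 2 - q ^ 2 = p' ^ 2 - q' ^ 2 →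
      p - q = p' - q' → ∃ m : ℕ, ptPQ t p' q' h' = ptPQ t p q h + m • ptT t i hi := by
    intro p q h hx hg
    have hpq : (p * q) ^ 2 = (p' * q') ^ 2 := by
      have h16 : (16 : L) ≠ 0 := by
        rw [show (16 : L) = 2 ^ 4 by norm_num]
        exact pow_ne_zero 4 h2
      refine mul_left_cancel₀ h16 ?_
      have h0 := h
      have h0' := h'
      rw [OnCurve] at h0 h0'
      linear_combination h0 - h0' + hx
    by_cases hg0 : p - q = 0
    · rcases sq_eq_sq_iff_eq_or_eq_neg.1 hpq with h4 | h4
      · exact main h h' hx hg fun _ => h4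
      · refine hshift h (main (h.rotate hi) h' ((hrot p q).trans hx) ?_ fun _ => ?_)
        · rw [← hg, hg0]
          linear_combination i * hg0
        · linear_combination p * q * hi - h4
    · exact main h h' hx hg fun h0 => absurd h0 hg0
  have hg4 : (p - q) ^ 4 = (p' - q') ^ 4 := by
    linear_combination (p ^ 2 - q ^ 2 + p' ^ 2 - q' ^ 2) * hx - hy
  have hfac : (p' - q' - (p - q)) * (p' - q' + (p - q)) * (p' - q' - i * (p - q)) *
      (p' - q' + i * (p - q)) = 0 := by
    linear_combination -hg4 + (p - q) ^ 2 * ((p - q) ^ 2 - (p' - q') ^ 2) * hi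
  rcases mul_eq_zero.1 hfac with h3 | h3
  · rcases mul_eq_zero.1 h3 with h3 | h3
    · rcases mul_eq_zero.1 h3 with h3 | h3
      · exact main' h hx (by linear_combination -h3)
      · refine hshift h (hshift _ (main' _ ?_ ?_))
        · rw [hrot, hrot, hx]
        · linear_combination (p - q) * hi - h3
    · refine hshift h (main' _ ?_ ?_)
      · rw [hrot, hx]
      · linear_combination -h3
  · refine hshift h (hshift _ (hshift _ (main' _ ?_ ?_)))
    · rw [hrot, hrot, hrot, hx]
    · linear_combination i * (p - q) * hi - h3

/-! ### The parametrization of the homogeneous spaces -/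

/-- Equality of homogeneous coordinate vectors up to scaling. -/
def Proportional (v w : Fin 4 → L) : Prop := ∃ r : L, r ≠ 0 ∧ ∀ k, v k = r * w k

theorem Proportional.refl {L : Type*} [Field L] (v : Fin 4 → L) : Proportional v v :=
    ⟨1, one_ne_zero, fun k => by simp⟩

theorem Proportional.symm {L : Type*} [Field L] {v w : Fin 4 → L} (h : Proportional v w) :
    Proportional w v := by
  obtain ⟨r, hr, h⟩ := h
  exact ⟨r⁻¹, inv_ne_zero hr, fun k => by rw [h k, inv_mul_cancel_left₀ hr]⟩

theorem Proportional.trans {L : Type*} [Field L] {u v w : Fin 4 → L} (h : Proportional u v)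
    (h' : Proportional v w) :
    Proportional u w := by
  obtain ⟨r, hr, h⟩ := h
  obtain ⟨s, hs, h'⟩ := h'
  exact ⟨r * s, mul_ne_zero hr hs, fun k => by rw [h k, h' k, mul_assoc]⟩

/-- The formula of `thetaInv` over any field. -/
def theta (t : ℚˣ) (δ : L) : ((E' t)⁄L).Point → Fin 4 → L
  | .zero => ![1, 0, δ ^ 2, δ ^ 3]
  | .some X Y _ =>
    let τ := algebraMap ℚ L t
    let α := algebraMap ℚ L (A t)
    if X + α = 0 then ![1, 0, δ ^ 2, -δ ^ 3]
    else ![2 * (X + 2 * α) * (2 * Y + X + α) - τ * X * (X + α),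
      δ * (4 * τ * (X + α) * (X + 2 * α)),
      δ ^ 2 * (2 * (X + 2 * α) * (2 * Y + X + α) + τ * X * (X + α)),
      2 * δ ^ 3 * X * (2 * Y + X + α)]

theorem thetaInv_eq_theta (t : ℚˣ) (δ : QBar) : thetaInv t δ = theta t δ := by
  funext P
  cases P <;> rfl

/-- The image of the kernel of the isogeny in a homogeneous space. -/
def kerVec (δ : L) : Fin 4 → L := ![1, 0, δ ^ 2, δ ^ 3]

/-- The image of a point with coordinates `p`, `q` in a homogeneous space. -/
def pqVec (δ p q : L) : Fin 4 → L := ![p - q, δ, δ ^ 2 * (p + q), 4 * δ ^ 3 * p * q]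

theorem forall_fin_four {P : Fin 4 → Prop} (h0 : P 0) (h1 : P 1) (h2 : P 2) (h3 : P 3) : ∀ k, P k :=
    by
  intro k
  fin_cases k <;> assumption

theorem theta_ptS (t : ℚˣ) (δ : L) : theta t δ (ptS t L) = kerVec (-δ) := by
  rw [ptS, theta, if_pos (neg_add_cancel _), kerVec]
  ring_nf

theorem theta_ptT (t : ℚˣ) (δ : L) {i : L} (hi : i ^ 2 = -1) :
    Proportional (theta t δ (ptT t i hi)) (kerVec (-i * δ)) := by
  have hα := A_ne_zero t L
  have hτ := t_ne_zero t L
  have h2 := two_ne_zero_of_rat L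
  rw [ptT, theta, if_neg (fun h => hα (by linear_combination -h)), kerVec]
  refine ⟨-2 * algebraMap ℚ L t * algebraMap ℚ L (A t) ^ 2, by
    rw [neg_mul, neg_mul, neg_ne_zero]; positivity, forall_fin_four ?_ ?_ ?_ ?_⟩ <;>
  simp only [Matrix.cons_val]
  · ring
  · ring
  · linear_combination (2 * algebraMap ℚ L t * algebraMap ℚ L (A t) ^ 2 * δ ^ 2) * hi
  · have h4 := four_ne_zero_of_rat L
    field_simp
    linear_combination (-4 * algebraMap ℚ L t * δ ^ 3 * i) * hi

theorem theta_ptPQ (t : ℚˣ) (δ : L) {p q : L} (h : OnCurve t p q) :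
    Proportional (theta t δ (ptPQ t p q h)) (pqVec δ p q) := by
  have hX := ptPQ_X_ne t h
  have h1 := h.one_sub_ne_zero
  have h1'' : 1 - q * 4 ≠ 0 := by rwa [mul_comm q]
  have hτ := t_ne_zero t L
  have h2 := two_ne_zero_of_rat L
  have h4 := four_ne_zero_of_rat L
  rw [ptPQ, theta, if_neg (left_ne_zero_of_mul hX), pqVec]
  refine ⟨4 * algebraMap ℚ L t * ((8 * algebraMap ℚ L (A t) * q / (1 - 4 * q) +
    algebraMap ℚ L (A t)) * (8 * algebraMap ℚ L (A t) * q / (1 - 4 * q) +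
    2 * algebraMap ℚ L (A t))), mul_ne_zero (mul_ne_zero h4 hτ) hX, forall_fin_four ?_ ?_ ?_ ?_⟩ <;>
  simp only [Matrix.cons_val] <;> field_simp <;> ring

theorem I_pow_four {L : Type*} [Field L] {i : L} (hi : i ^ 2 = -1) : i ^ 4 = 1 := by
  linear_combination (i ^ 2 - 1) * hi

/-- The points of `C'_d` with `z = 0` are `(1 : 0 : ε² : ε³)` with `ε⁴ = d`, and the kernel runs
through them. -/
theorem theta_nsmul_ptT (t : ℚˣ) (δ : L) {i : L} (hi : i ^ 2 = -1) (m : ℕ) :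
    Proportional (theta t δ (m • ptT t i hi)) (kerVec ((-i) ^ m * δ)) := by
  rw [nsmul_ptT_mod, ← Nat.div_add_mod m 4, pow_add, pow_mul, I_pow_four (neg_sq_I hi), one_pow,
    one_mul, Nat.mul_add_mod, Nat.mod_mod]
  have hm := Nat.mod_lt m (by norm_num : 4 > 0)
  interval_cases m % 4
  · rw [zero_nsmul, pow_zero, one_mul]
    exact .refl _
  · rw [one_nsmul, pow_one]
    exact theta_ptT t δ hi
  · rw [two_nsmul_ptT, theta_ptS, neg_sq_I hi, neg_one_mul]
    exact .refl _
  · rw [three_nsmul_ptT, show (-i) ^ 3 * δ = -(-i) * δ by linear_combination (-i * δ) * hi]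
    exact theta_ptT t δ _

/-- Translation by `T` corresponds to a change of the fourth root `δ`. -/
theorem theta_add_ptT (t : ℚˣ) (δ : L) {i : L} (hi : i ^ 2 = -1) (P : ((E' t)⁄L).Point) :
    Proportional (theta t δ (P + ptT t i hi)) (theta t (-i * δ) P) := by
  rcases point_cases t hi P with ⟨m, -, rfl⟩ | ⟨p, q, h, rfl⟩
  · rw [← succ_nsmul]
    refine (theta_nsmul_ptT t δ hi (m + 1)).trans ?_
    rw [pow_succ, mul_assoc]
    exact (theta_nsmul_ptT t (-i * δ) hi m).symm
  · rw [ptPQ_add_ptT]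
    refine (theta_ptPQ t δ _).trans (.trans ?_ (theta_ptPQ t (-i * δ) h).symm)
    -- The scaling factor is `i` because translation by `T` multiplies `s = p - q` by `i`.
    refine ⟨i, fun h0 => by simp [h0] at hi, forall_fin_four ?_ ?_ ?_ ?_⟩ <;>
    simp only [Matrix.cons_val, pqVec]
    · ring
    · linear_combination δ * hi
    · linear_combination (-i * δ ^ 2 * (p + q)) * hi
    · linear_combination (4 * δ ^ 3 * p * q * i ^ 2) * hi

theorem theta_add_nsmul_ptT (t : ℚˣ) (δ : L) {i : L} (hi : i ^ 2 = -1) (P : ((E' t)⁄L).Point)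
    (m : ℕ) : Proportional (theta t δ (P + m • ptT t i hi)) (theta t ((-i) ^ m * δ) P) := by
  induction m generalizing δ with
  | zero =>
    rw [zero_nsmul, add_zero, pow_zero, one_mul]
    exact .refl _
  | succ m ih =>
    rw [succ_nsmul, ← add_assoc]
    refine (theta_add_ptT t δ hi _).trans ?_
    rw [pow_succ, mul_assoc]
    exact ih (-i * δ)

theorem theta_injective (t : ℚˣ) {δ : L} (hδ : δ ≠ 0) {i : L} (hi : i ^ 2 = -1)
    {P Q : ((E' t)⁄L).Point} (h : Proportional (theta t δ P) (theta t δ Q)) : P = Q := by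
  have hi0 : i ≠ 0 := fun h0 => by simp [h0] at hi
  rcases point_cases t hi P with ⟨m, hm4, rfl⟩ | ⟨p, q, hpq, rfl⟩ <;>
  rcases point_cases t hi Q with ⟨n, hn4, rfl⟩ | ⟨p', q', hpq', rfl⟩
  · obtain ⟨r, hr, h1⟩ := (theta_nsmul_ptT t δ hi m).symm.trans (h.trans (theta_nsmul_ptT t δ hi n))
    have e0 := h1 0
    have e2 := h1 2
    have e3 := h1 3
    simp only [kerVec, Matrix.cons_val] at e0 e2 e3
    have hr1 : r = 1 := by linear_combination -e0
    rw [hr1, one_mul] at e2 e3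
    -- The fourth root is recovered as the ratio of the last two coordinates `ε³` and `ε²`.
    have e4 : (-i) ^ m * δ = (-i) ^ n * δ := by
      have h5 : ((-i) ^ n * δ) ^ 2 ≠ 0 :=
        pow_ne_zero 2 (mul_ne_zero (pow_ne_zero n (neg_ne_zero.2 hi0)) hδ)
      refine mul_right_cancel₀ h5 ?_
      linear_combination e3 - (-i) ^ m * δ * e2
    have e5 := mul_right_cancel₀ hδ e4
    -- the powers of `-i` with exponents below four are distinct
    have hinj : m = n := by
      have h2 := two_ne_zero_of_rat L
      have hi1 : i ≠ 1 := fun h0 => h2 (by rw [h0] at hi; linear_combination hi)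
      have hi2 : i ≠ -1 := fun h0 => h2 (by rw [h0] at hi; linear_combination hi)
      have key : ∀ k < 4, (-i) ^ k = 1 → k = 0 := by
        intro k hk hk1
        interval_cases k
        · rfl
        · exact absurd (by linear_combination -hk1) hi2
        · exact absurd (by linear_combination hi - hk1) h2
        · exact absurd (by linear_combination hk1 + i * hi) hi1
      have hni := neg_ne_zero.2 hi0
      rcases le_total m n with hmn | hmn
      · obtain ⟨k, rfl⟩ := Nat.exists_eq_add_of_le hmn
        rw [pow_add] at e5
        have := key k (by omega) (mul_left_cancel₀ (pow_ne_zero m hni) (by rw [← e5, mul_one]))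
        omega
      · obtain ⟨k, rfl⟩ := Nat.exists_eq_add_of_le hmn
        rw [pow_add] at e5
        have := key k (by omega) (mul_left_cancel₀ (pow_ne_zero n hni) (by rw [e5, mul_one]))
        omega
    rw [hinj]
  · obtain ⟨r, hr, h1⟩ := (theta_nsmul_ptT t δ hi m).symm.trans (h.trans (theta_ptPQ t δ hpq'))
    have e1 := h1 1
    simp only [kerVec, pqVec, Matrix.cons_val] at e1
    exact absurd e1.symm (mul_ne_zero hr hδ)
  · obtain ⟨r, hr, h1⟩ := (theta_nsmul_ptT t δ hi n).symm.trans (h.symm.trans (theta_ptPQ t δ hpq))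
    have e1 := h1 1
    simp only [kerVec, pqVec, Matrix.cons_val] at e1
    exact absurd e1.symm (mul_ne_zero hr hδ)
  · obtain ⟨r, hr, h1⟩ := (theta_ptPQ t δ hpq).symm.trans (h.trans (theta_ptPQ t δ hpq'))
    have e0 := h1 0
    have e1 := h1 1
    have e2 := h1 2
    simp only [pqVec, Matrix.cons_val] at e0 e1 e2
    have hr1 : r = 1 := mul_right_cancel₀ hδ (by rw [← e1, one_mul])
    rw [hr1, one_mul] at e0 e2
    have e3 := mul_left_cancel₀ (pow_ne_zero 2 hδ) e2
    have h2 := two_ne_zero_of_rat L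
    refine ptPQ_congr (mul_left_cancel₀ h2 ?_) (mul_left_cancel₀ h2 ?_)
    · linear_combination e0 + e3
    · linear_combination e3 - e0

/-- The equations of the homogeneous space attached to an element `d` of `L`. -/
def OnSpace (t : ℚˣ) (d : L) (v : Fin 4 → L) : Prop :=
  v ≠ 0 ∧ v 3 * v 1 = v 2 ^ 2 - d * v 0 ^ 2 ∧
    v 3 ^ 2 = d * (v 2 * v 0 + algebraMap ℚ L (a t) * v 1 ^ 2)

theorem mem_spaceVectors (t d : ℚˣ) (v : Fin 4 → L) :
    v ∈ spaceVectors t d L ↔ OnSpace t (algebraMap ℚ L d) v := Iff.rfl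

theorem OnSpace.of_proportional {t : ℚˣ} {d : L} {v w : Fin 4 → L} (h : OnSpace t d w)
    (hvw : Proportional v w) : OnSpace t d v := by
  obtain ⟨r, hr, e⟩ := hvw
  obtain ⟨h0, h1, h2⟩ := h
  refine ⟨fun h => h0 ?_, ?_, ?_⟩
  · funext k
    have := e k
    rw [h] at this
    exact (mul_eq_zero.1 this.symm).resolve_left hr
  · rw [e, e, e, e]
    linear_combination r ^ 2 * h1
  · rw [e, e, e, e]
    linear_combination r ^ 2 * h2

theorem onSpace_theta (t : ℚˣ) {δ : L} (hδ : δ ≠ 0) {i : L} (hi : i ^ 2 = -1)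
    (P : ((E' t)⁄L).Point) : OnSpace t (δ ^ 4) (theta t δ P) := by
  rcases point_cases t hi P with ⟨m, -, rfl⟩ | ⟨p, q, h, rfl⟩
  · refine OnSpace.of_proportional ?_ (theta_nsmul_ptT t δ hi m)
    have h4 : δ ^ 4 = ((-i) ^ m * δ) ^ 4 := by
      rw [mul_pow, ← pow_mul, mul_comm m, pow_mul, I_pow_four (neg_sq_I hi), one_pow, one_mul]
    rw [h4]
    refine ⟨fun h => one_ne_zero (congrFun h 0), ?_, ?_⟩ <;> simp only [kerVec, Matrix.cons_val] <;>
    ring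
  · refine OnSpace.of_proportional ⟨fun h0 => hδ (congrFun h0 1), ?_, ?_⟩ (theta_ptPQ t δ h) <;>
    simp only [pqVec, Matrix.cons_val]
    · ring
    · rw [← h]; ring

/-- Every point of the homogeneous space comes from `E'`. -/
theorem exists_theta (t : ℚˣ) {δ : L} (hδ : δ ≠ 0) {i : L} (hi : i ^ 2 = -1) {v : Fin 4 → L}
    (hv : OnSpace t (δ ^ 4) v) : ∃ P : ((E' t)⁄L).Point, Proportional v (theta t δ P) := by
  obtain ⟨h0, h1, h2⟩ := hv
  have h20 := two_ne_zero_of_rat L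
  by_cases hz : v 1 = 0
  · rw [hz, mul_zero] at h1
    rw [hz] at h2
    have hs : v 0 ≠ 0 := fun hs => h0 <| by
      rw [hs] at h1 h2
      have hw : v 2 = 0 := pow_eq_zero_iff two_ne_zero |>.1 (by linear_combination -h1)
      have hu : v 3 = 0 := pow_eq_zero_iff two_ne_zero |>.1 (by linear_combination h2)
      funext k
      revert k
      exact forall_fin_four hs hz hw hu
    -- `ε` is the fourth root of `d` with `w = ε² s` and `u = ε³ s`
    obtain ⟨ε, he2, he3⟩ : ∃ ε : L, v 2 = ε ^ 2 * v 0 ∧ v 3 = ε ^ 3 * v 0 := by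
      have hw : v 2 ≠ 0 := fun hw => by
        rw [hw] at h1
        exact mul_ne_zero (pow_ne_zero 4 hδ) (pow_ne_zero 2 hs) (by linear_combination h1)
      refine ⟨v 3 / v 2, ?_, ?_⟩
      · field_simp
        linear_combination -v 2 * h1 - v 0 * h2
      · rw [div_pow, div_mul_eq_mul_div, eq_div_iff (pow_ne_zero 3 hw)]
        linear_combination -v 3 * (v 2 * h1 + v 0 * h2)
    have he4 : ε ^ 4 = δ ^ 4 := by
      refine mul_right_cancel₀ (pow_ne_zero 2 hs) ?_
      rw [he2] at h1
      linear_combination -h1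
    obtain ⟨m, hm⟩ : ∃ m : ℕ, ε = (-i) ^ m * δ := by
      have hfac : (ε - δ) * (ε + δ) * (ε - i * δ) * (ε + i * δ) = 0 := by
        linear_combination he4 + δ ^ 2 * (δ ^ 2 - ε ^ 2) * hi
      rcases mul_eq_zero.1 hfac with h3 | h3
      · rcases mul_eq_zero.1 h3 with h3 | h3
        · rcases mul_eq_zero.1 h3 with h3 | h3
          · exact ⟨0, by linear_combination h3⟩
          · exact ⟨2, by linear_combination h3 - δ * hi⟩
        · exact ⟨3, by linear_combination h3 + i * δ * hi⟩
      · exact ⟨1, by linear_combination h3⟩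
    refine ⟨m • ptT t i hi, .trans ?_ (theta_nsmul_ptT t δ hi m).symm⟩
    rw [← hm]
    refine ⟨v 0, hs, forall_fin_four ?_ ?_ ?_ ?_⟩ <;> simp only [kerVec, Matrix.cons_val]
    · ring
    · rw [hz]; ring
    · rw [he2]; ring
    · rw [he3]; ring
  -- After scaling to `z = δ`, the coordinates `s` and `w` give `p - q = s δ / z` and `p + q = w /
  -- (z δ)`, which are solved for `p` and `q`. The first equation of the space then gives `4 p q = u
  -- / (z δ²)` and the second becomes the equation of the curve.
  · have hc : OnCurve t ((v 0 * δ / v 1 + v 2 / (v 1 * δ)) / 2)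
        ((v 2 / (v 1 * δ) - v 0 * δ / v 1) / 2) := by
      rw [OnCurve]
      have e1 : (v 2 / (v 1 * δ)) ^ 2 - (v 0 * δ / v 1) ^ 2 = v 3 / (v 1 * δ ^ 2) := by
        field_simp
        linear_combination -h1
      have e2 : (v 3 / (v 1 * δ ^ 2)) ^ 2 = v 2 / (v 1 * δ) * (v 0 * δ / v 1) +
          algebraMap ℚ L (a t) := by
        field_simp
        linear_combination h2
      rw [← e1] at e2
      field_simp at e2 ⊢
      linear_combination 16 * e2
    refine ⟨ptPQ t _ _ hc, .trans ?_ (theta_ptPQ t δ hc).symm⟩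
    refine ⟨v 1 / δ, div_ne_zero hz hδ, forall_fin_four ?_ ?_ ?_ ?_⟩ <;>
    simp only [pqVec, Matrix.cons_val] <;> field_simp
    · ring
    · ring
    · linear_combination 4 * h1

/-! ### Functoriality -/

theorem map_ptT (t : ℚˣ) (f : L →ₐ[ℚ] L') {i : L} (hi : i ^ 2 = -1) (hi' : f i ^ 2 = -1) :
    Point.map (W' := E' t) f (ptT t i hi) = ptT t (f i) hi' := by
  rw [ptT, Point.map_some]
  refine point_some_congr ?_ ?_ <;> simp [map_ofNat]

theorem map_theta (t : ℚˣ) (f : L →ₐ[ℚ] L') (δ : L) (P : ((E' t)⁄L).Point) (k : Fin 4) :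
    f (theta t δ P k) = theta t (f δ) (Point.map (W' := E' t) f P) k := by
  revert k
  rcases P with _ | ⟨X, Y, h⟩
  · refine forall_fin_four ?_ ?_ ?_ ?_
    · exact map_one f
    · exact map_zero f
    · exact map_pow f δ 2
    · exact map_pow f δ 3
  · rw [Point.map_some, theta, theta]
    have hX : f X + algebraMap ℚ L' (A t) = f (X + algebraMap ℚ L (A t)) := by simp
    by_cases h0 : X + algebraMap ℚ L (A t) = 0
    · rw [if_pos h0, hX, h0, map_zero, if_pos rfl]
      refine forall_fin_four ?_ ?_ ?_ ?_ <;> simp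
    · rw [if_neg h0, hX, if_neg (by rwa [map_eq_zero])]
      refine forall_fin_four ?_ ?_ ?_ ?_ <;> simp [map_ofNat]

end Geometry

/-! ### The isogeny is a homomorphism -/

section Additivity

open WeierstrassCurve.Affine

/-- The line `y = l x + m` meets `y² = x (x² + a x + b)` in the points with `x`-coordinates `x k`,
with multiplicities. -/
structure LineSection {L : Type*} [Field L] (a b : L) (x y : Fin 3 → L) (l m : L) : Prop where
  line : ∀ k, y k = l * x k + m
  sum : x 0 + x 1 + x 2 = l ^ 2 - a
  sum_mul : x 0 * x 1 + x 0 * x 2 + x 1 * x 2 = b - 2 * l * m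
  prod : x 0 * x 1 * x 2 = m ^ 2

theorem forall_fin_three {P : Fin 3 → Prop} (h0 : P 0) (h1 : P 1) (h2 : P 2) : ∀ k, P k := by
  intro k
  fin_cases k <;> assumption

namespace LineSection

variable {L : Type*} [Field L] {a b l m : L} {x y : Fin 3 → L}

theorem cubic (h : LineSection a b x y l m) (k : Fin 3) :
    x k ^ 3 + a * x k ^ 2 + b * x k = (l * x k + m) ^ 2 := by
  have h1 := h.sum
  have h2 := h.sum_mul
  have h3 := h.prod
  have h4 : (x k - x 0) * (x k - x 1) * (x k - x 2) = 0 := by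
    revert k
    refine forall_fin_three ?_ ?_ ?_ <;> ring
  linear_combination h4 + x k ^ 2 * h1 - x k * h2 + h3

/-- The difference of the two cubic equations is divisible by `x 0 - x 1`, which gives the second
symmetric function; either equation then gives the product. -/
theorem of_ne (h0 : y 0 ^ 2 = x 0 ^ 3 + a * x 0 ^ 2 + b * x 0)
    (h1 : y 1 ^ 2 = x 1 ^ 3 + a * x 1 ^ 2 + b * x 1) (hx : x 0 ≠ x 1)
    (hl : ∀ k, y k = l * x k + m) (h2 : x 2 = l ^ 2 - a - x 0 - x 1) : LineSection a b x y l m := by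
  rw [hl] at h0 h1
  have hs : x 0 * x 1 + x 0 * x 2 + x 1 * x 2 = b - 2 * l * m := by
    refine mul_left_cancel₀ (sub_ne_zero.2 hx) ?_
    rw [h2]
    linear_combination h0 - h1
  refine ⟨hl, by rw [h2]; ring, hs, ?_⟩
  linear_combination x 0 * hs - x 0 ^ 2 * h2 - h0

/-- The image of a line under the isogeny with kernel `{0, (0, 0)}`. -/
theorem isogeny (h : LineSection a b x y l m) (hm : m ≠ 0) {x' y' : Fin 3 → L}
    (hx' : ∀ k, x' k = x k + a + b / x k) (hy' : ∀ k, y' k = y k * (b / x k ^ 2 - 1)) :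
    LineSection (-2 * a) (a ^ 2 - 4 * b) x' y' (b / m - l) (l * a - l ^ 2 * b / m - m) := by
  have hp := h.prod
  have hx0 : x 0 ≠ 0 := fun h0 => hm (pow_eq_zero_iff two_ne_zero |>.1 (by rw [← hp, h0]; ring))
  have hx1 : x 1 ≠ 0 := fun h0 => hm (pow_eq_zero_iff two_ne_zero |>.1 (by rw [← hp, h0]; ring))
  have hx2 : x 2 ≠ 0 := fun h0 => hm (pow_eq_zero_iff two_ne_zero |>.1 (by rw [← hp, h0]; ring))
  have hx : ∀ k, x k ≠ 0 := forall_fin_three hx0 hx1 hx2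
  -- Since `x' = (y / x)²`, the product of the `x' k` follows from the product of the values `l * x
  -- k + m`.
  have hsq : ∀ k, x' k = (l * x k + m) ^ 2 / x k ^ 2 := fun k => by
    have := hx k
    rw [hx', ← h.cubic k]
    field_simp
  have hinv : b / x 0 + b / x 1 + b / x 2 = b * (b - 2 * l * m) / m ^ 2 := by
    rw [← h.sum_mul, ← hp]
    field_simp
    ring
  have hsum : x' 0 + x' 1 + x' 2 = (b / m - l) ^ 2 - -2 * a := by
    rw [hx', hx', hx']
    have h1 := h.sum
    have h2 : (b / m - l) ^ 2 - -2 * a = (l ^ 2 - a) + 3 * a + b * (b - 2 * l * m) / m ^ 2 := by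
      field_simp
      ring
    rw [h2]
    linear_combination h1 + hinv
  have hline : ∀ k, y' k = (b / m - l) * x' k + (l * a - l ^ 2 * b / m - m) := fun k => by
    have := hx k
    have hc := h.cubic k
    rw [hy', hx', h.line]
    field_simp
    linear_combination (-b) * hc
  have hprod : x' 0 * x' 1 * x' 2 = (l * a - l ^ 2 * b / m - m) ^ 2 := by
    have h1 := h.sum
    have h2 := h.sum_mul
    have h3 : (l * x 0 + m) * (l * x 1 + m) * (l * x 2 + m) =
        -m ^ 2 * (l * a - l ^ 2 * b / m - m) := by
      field_simp
      linear_combination l ^ 3 * hp + l ^ 2 * m * h2 + l * m ^ 2 * h1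
    have h4 : x' 0 * x' 1 * x' 2 = ((l * x 0 + m) * (l * x 1 + m) * (l * x 2 + m)) ^ 2 /
        (x 0 * x 1 * x 2) ^ 2 := by
      rw [hsq, hsq, hsq]
      field_simp
    rw [h4, h3, hp]
    field_simp
  refine ⟨hline, hsum, ?_, hprod⟩
  have hsym : x' 0 * x' 1 + x' 0 * x' 2 + x' 1 * x' 2 =
      (x 0 * x 1 + x 0 * x 2 + x 1 * x 2) + 2 * a * (x 0 + x 1 + x 2) + 3 * a ^ 2 +
      b * ((x 0 + x 1 + x 2) * (x 0 * x 1 + x 0 * x 2 + x 1 * x 2) / (x 0 * x 1 * x 2) - 3) +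
      2 * a * b * ((x 0 * x 1 + x 0 * x 2 + x 1 * x 2) / (x 0 * x 1 * x 2)) +
      b ^ 2 * ((x 0 + x 1 + x 2) / (x 0 * x 1 * x 2)) := by
    rw [hx', hx', hx']
    field_simp
    ring
  rw [hsym, h.sum, h.sum_mul, hp]
  field_simp
  ring

/-- Translation of the `x`-coordinate by a root of `x² + a x + b`. -/
theorem shift (h : LineSection a b x y l m) {c : L} (hc : c ^ 2 + a * c + b = 0)
    {x' : Fin 3 → L} (hx' : ∀ k, x' k = x k - c) :
    LineSection (3 * c + a) (2 * c ^ 2 + a * c) x' y l (m + l * c) := by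
  obtain ⟨h0, h1, h2, h3⟩ := h
  refine ⟨fun k => by rw [h0, hx']; ring, ?_, ?_, ?_⟩
  · rw [hx', hx', hx']
    linear_combination h1
  · rw [hx', hx', hx']
    linear_combination h2 - 2 * c * h1 + hc
  · rw [hx', hx', hx']
    linear_combination h3 - c * h2 + c ^ 2 * h1 - c * hc

end LineSection

variable {L : Type*} [Field L] [Algebra ℚ L]

/-- A line through three points of `E'` outside the kernel goes to a line. -/
theorem exists_line_of_ptPQ (t : ℚˣ) {p q : Fin 3 → L} (h : ∀ k, OnCurve t (p k) (q k)) {l m : L}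
    (hX : 8 * algebraMap ℚ L (A t) * q 0 / (1 - 4 * q 0) ≠
      8 * algebraMap ℚ L (A t) * q 1 / (1 - 4 * q 1))
    (hl : ∀ k, algebraMap ℚ L (A t) * (1 + 4 * q k) * (2 * algebraMap ℚ L t * p k - 1) /
      (2 * (1 - 4 * q k)) = l * (8 * algebraMap ℚ L (A t) * q k / (1 - 4 * q k)) + m)
    (hs : 8 * algebraMap ℚ L (A t) * q 2 / (1 - 4 * q 2) = l ^ 2 + l - algebraMap ℚ L (A t) -
      8 * algebraMap ℚ L (A t) * q 0 / (1 - 4 * q 0) -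
      8 * algebraMap ℚ L (A t) * q 1 / (1 - 4 * q 1)) :
    ∃ l' m' : L, (∀ k, 4 * p k * q k * (p k - q k) ^ 2 = l' * (p k ^ 2 - q k ^ 2) + m') ∧
      p 2 ^ 2 - q 2 ^ 2 = l' ^ 2 + l' - algebraMap ℚ L (a t) - (p 0 ^ 2 - q 0 ^ 2) -
        (p 1 ^ 2 - q 1 ^ 2) := by
  have hchar := algebraRat.charZero L
  have hA := A_eq t L
  have ha := a_eq t L
  have hα := A_ne_zero t L
  have hτ := t_ne_zero t L
  have h2 := two_ne_zero_of_rat L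
  have h4 := four_ne_zero_of_rat L
  have h16 : (16 : L) ≠ 0 := by
    rw [show (16 : L) = 2 ^ 4 by norm_num]
    exact pow_ne_zero 4 h2
  have h64 : (64 : L) ≠ 0 := by
    rw [show (64 : L) = 2 ^ 6 by norm_num]
    exact pow_ne_zero 6 h2
  have hn1 := fun k => (h k).one_sub_ne_zero
  have hn2 := fun k => (h k).one_add_ne_zero
  set τ := algebraMap ℚ L t
  set α := algebraMap ℚ L (A t)
  set X : Fin 3 → L := fun k => 8 * α * q k / (1 - 4 * q k)
  set Y : Fin 3 → L := fun k => α * (1 + 4 * q k) * (2 * τ * p k - 1) / (2 * (1 - 4 * q k))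
  have hE : ∀ k, Y k ^ 2 + X k * Y k + α * Y k = X k ^ 3 + α * X k ^ 2 := fun k =>
    (nonsingular_E'_iff t).1 (h k).nonsingular
  -- This change of variables moves the 2-torsion point `(-A, 0) = 2T` to the origin.
  have s1 : LineSection (1 - 8 * α) (16 * α ^ 2) (fun k => 4 * (X k + α))
      (fun k => 4 * (2 * Y k + X k + α)) (2 * l + 1) (8 * (m - l * α)) := by
    refine LineSection.of_ne ?_ ?_ ?_ ?_ ?_
    · linear_combination 64 * hE 0
    · linear_combination 64 * hE 1
    · exact fun h0 => hX (mul_left_cancel₀ h4 (by linear_combination h0))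
    · intro k
      have : Y k = l * X k + m := hl k
      rw [this]
      ring
    · have : X 2 = l ^ 2 + l - α - X 0 - X 1 := hs
      simp only [this]
      ring
  have hXα : ∀ k, X k + α = α * (1 + 4 * q k) / (1 - 4 * q k) := fun k => ptPQ_X_add_A t (h k)
  have hXα0 : ∀ k, X k + α ≠ 0 := fun k => left_ne_zero_of_mul (ptPQ_X_ne t (h k))
  have hη : ∀ k, 2 * Y k + X k + α = 2 * τ * p k * (X k + α) := fun k => by
    have h0 := hn1 k
    have h0' : 1 - q k * 4 ≠ 0 := by rwa [mul_comm (q k)]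
    rw [hXα]
    simp only [X, Y]
    field_simp
    ring
  have hne : ∀ k, 16 * p k ^ 2 + 1 ≠ 0 := fun k h0 => one_sub_sixteen_a_ne_zero t L (by
    rw [← h k]
    linear_combination (1 - 16 * q k ^ 2) * h0)
  -- The equation of the curve in factored form, with `1 - 16 a = 64 A / t²`.
  have hpq : ∀ k, 64 * α = τ ^ 2 * (16 * p k ^ 2 + 1) * (1 - 16 * q k ^ 2) := fun k => by
    have h0 := h k
    rw [OnCurve] at h0
    linear_combination hA + 4 * ha + 16 * τ ^ 2 * h0
  -- The quotient by `2T`: the new `x`-coordinate is `(2 t p)²`.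
  have s2 := s1.isogeny (x' := fun k => 4 * τ ^ 2 * p k ^ 2)
    (y' := fun k => -2 * τ ^ 3 * p k * q k * (16 * p k ^ 2 + 1)) (fun h0 => by
      have h1 := s1.prod
      rw [h0, zero_pow two_ne_zero] at h1
      exact mul_ne_zero (mul_ne_zero (mul_ne_zero h4 (hXα0 0)) (mul_ne_zero h4 (hXα0 1)))
        (mul_ne_zero h4 (hXα0 2)) h1)
    (fun k => by
      have h0 := hn1 k
      have h1 := hn2 k
      have h0' : 1 - q k * 4 ≠ 0 := by rwa [mul_comm (q k)]
      have h1' : 1 + q k * 4 ≠ 0 := by rwa [mul_comm (q k)]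
      have e : 4 * τ ^ 2 * p k ^ 2 = 1 + 256 * α * q k ^ 2 / ((1 - 4 * q k) * (1 + 4 * q k)) := by
        rw [← sub_eq_iff_eq_add', eq_div_iff (mul_ne_zero h0 h1)]
        refine mul_left_cancel₀ h4 ?_
        linear_combination -hpq k + (1 - 16 * q k ^ 2) * hA
      rw [e, hXα]
      field_simp
      ring)
    (fun k => by
      have h0 := hn1 k
      have h1 := hn2 k
      have h0' : 1 - q k * 4 ≠ 0 := by rwa [mul_comm (q k)]
      have h1' : 1 + q k * 4 ≠ 0 := by rwa [mul_comm (q k)]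
      have e : τ ^ 2 * (16 * p k ^ 2 + 1) = 64 * α / ((1 - 4 * q k) * (1 + 4 * q k)) := by
        rw [eq_div_iff (mul_ne_zero h0 h1)]
        linear_combination -hpq k
      have e' : -2 * τ ^ 3 * p k * q k * (16 * p k ^ 2 + 1) =
          -2 * τ * p k * q k * (τ ^ 2 * (16 * p k ^ 2 + 1)) := by ring
      rw [e', e, hη, hXα]
      field_simp
      ring)
  -- The image of `T` is the 2-torsion point with `x`-coordinate `1 - 16 A`; it is moved to the
  -- origin, ready for the second quotient.
  have s3 := s2.shift (c := 1 - 16 * α) (by ring) (x' := fun k => τ ^ 2 * (16 * p k ^ 2 + 1) / 4)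
    (fun k => by
      field_simp
      linear_combination -hA)
  have s4 := s3.isogeny (x' := fun k => 4 * τ ^ 2 * (p k ^ 2 - q k ^ 2 + algebraMap ℚ L (a t)))
    (y' := fun k => 32 * τ ^ 3 * p k * q k * (p k ^ 2 + q k ^ 2)) (fun h0 => by
      have h1 := s3.prod
      rw [h0, zero_pow two_ne_zero] at h1
      have h2 : ∀ k, τ ^ 2 * (16 * p k ^ 2 + 1) / 4 ≠ 0 := fun k =>
        div_ne_zero (mul_ne_zero (pow_ne_zero 2 hτ) (hne k)) h4
      exact mul_ne_zero (mul_ne_zero (h2 0) (h2 1)) (h2 2) h1)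
    (fun k => by
      have h0 := hne k
      have e1 : α = (τ ^ 2 + 4) / 64 := by
        rw [eq_div_iff h64, ← hA]
        ring
      have e2 : q k ^ 2 = (1 - (τ ^ 2 + 4) / (τ ^ 2 * (16 * p k ^ 2 + 1))) / 16 := by
        have hk := hpq k
        rw [hA] at hk
        field_simp
        linear_combination hk
      have e3 : algebraMap ℚ L (a t) = -1 / (4 * τ ^ 2) := by
        field_simp
        linear_combination ha
      rw [e2, e3, e1]
      field_simp
      ring)
    (fun k => by
      have h0 := hne k
      have e1 : α = (τ ^ 2 + 4) / 64 := by
        rw [eq_div_iff h64, ← hA]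
        ring
      have e2 : (2 * (1 - 16 * α) ^ 2 + -2 * (1 - 8 * α) * (1 - 16 * α)) /
          (τ ^ 2 * (16 * p k ^ 2 + 1) / 4) ^ 2 = (1 - 16 * q k ^ 2) / (16 * p k ^ 2 + 1) := by
        have eN : 2 * (1 - 16 * α) ^ 2 + -2 * (1 - 8 * α) * (1 - 16 * α) =
            τ ^ 2 * (τ ^ 2 * (16 * p k ^ 2 + 1) * (1 - 16 * q k ^ 2)) / 16 := by
          linear_combination 4 * α * hA + τ ^ 2 / 16 * hpq k
        rw [eN]
        field_simp
        ring
      have h0' : p k ^ 2 * 16 + 1 ≠ 0 := by rwa [mul_comm (p k ^ 2)]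
      rw [e2]
      field_simp
      ring)
  obtain ⟨l', m', hline, hsum⟩ : ∃ l' m' : L,
      (∀ k, 32 * τ ^ 3 * p k * q k * (p k ^ 2 + q k ^ 2) =
        l' * (4 * τ ^ 2 * (p k ^ 2 - q k ^ 2 + algebraMap ℚ L (a t))) + m') ∧
      4 * τ ^ 2 * (p 0 ^ 2 - q 0 ^ 2 + algebraMap ℚ L (a t)) +
      4 * τ ^ 2 * (p 1 ^ 2 - q 1 ^ 2 + algebraMap ℚ L (a t)) +
      4 * τ ^ 2 * (p 2 ^ 2 - q 2 ^ 2 + algebraMap ℚ L (a t)) =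
        l' ^ 2 - -2 * (3 * (1 - 16 * α) + -2 * (1 - 8 * α)) :=
    ⟨_, _, s4.line, s4.sum⟩
  -- On the last model the coordinates are `4 t² (x + a)` and `4 t³ (2 y + x + a)` in terms of `E`,
  -- because `x + a = 16 p² q²`. Undoing this substitution gives slope and intercept on `E`.
  refine ⟨(l' / τ - 1) / 2, m' / (8 * τ ^ 3) + (l' / τ - 1) * algebraMap ℚ L (a t) / 2,
    fun k => ?_, ?_⟩
  · have hc := h k
    rw [OnCurve] at hc
    have h0 : 8 * p k * q k * (p k ^ 2 + q k ^ 2) =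
        l' / τ * (p k ^ 2 - q k ^ 2 + algebraMap ℚ L (a t)) + m' / (4 * τ ^ 3) := by
      have := hline k
      field_simp
      linear_combination this
    have h8 : m' / (8 * τ ^ 3) = 1 / 2 * (m' / (4 * τ ^ 3)) := by
      field_simp
      ring
    rw [h8]
    linear_combination 1 / 2 * h0 - 1 / 2 * hc
  · have h0 : ((l' / τ - 1) / 2) ^ 2 + (l' / τ - 1) / 2 = (l' ^ 2 - τ ^ 2) / (4 * τ ^ 2) := by
      field_simp
      ring
    rw [h0]
    refine mul_left_cancel₀ (mul_ne_zero h4 (pow_ne_zero 2 hτ)) ?_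
    have h5 : 4 * τ ^ 2 * ((l' ^ 2 - τ ^ 2) / (4 * τ ^ 2)) = l' ^ 2 - τ ^ 2 := by
      field_simp
    linear_combination hsum - h5 - hA - 2 * ha

theorem mem_zmultiples_ptT (t : ℚˣ) {i : L} (hi : i ^ 2 = -1) {P : ((E' t)⁄L).Point} :
    P ∈ AddSubgroup.zmultiples (ptT t i hi) ↔ ∃ m : ℕ, P = m • ptT t i hi := by
  rw [AddSubgroup.mem_zmultiples_iff]
  constructor
  · rintro ⟨n, rfl⟩
    refine ⟨(n % 4).toNat, ?_⟩
    rw [← natCast_zsmul, Int.toNat_of_nonneg (Int.emod_nonneg _ (by norm_num))]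
    conv_lhs => rw [← Int.mul_ediv_add_emod n 4, add_zsmul, mul_comm, mul_zsmul]
    rw [show (4 : ℤ) • ptT t i hi = 0 from (natCast_zsmul _ 4).trans (four_nsmul_ptT t hi),
      zsmul_zero, zero_add]
  · rintro ⟨m, rfl⟩
    exact ⟨m, natCast_zsmul _ _⟩

theorem dualIsogeny_eq_zero_iff_mem (t : ℚˣ) {i : L} (hi : i ^ 2 = -1) {P : ((E' t)⁄L).Point} :
    dualIsogeny t L P = 0 ↔ P ∈ AddSubgroup.zmultiples (ptT t i hi) := by
  rw [dualIsogeny_eq_zero_iff t hi, mem_zmultiples_ptT]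

theorem dualIsogeny_add_of_mem (t : ℚˣ) {i : L} (hi : i ^ 2 = -1) (P : ((E' t)⁄L).Point)
    {K : ((E' t)⁄L).Point} (hK : K ∈ AddSubgroup.zmultiples (ptT t i hi)) :
    dualIsogeny t L (P + K) = dualIsogeny t L P := by
  obtain ⟨m, rfl⟩ := (mem_zmultiples_ptT t hi).1 hK
  exact dualIsogeny_add_nsmul_ptT t hi P m

theorem sub_mem_of_dualIsogeny_eq (t : ℚˣ) {i : L} (hi : i ^ 2 = -1) {P Q : ((E' t)⁄L).Point}
    (h : dualIsogeny t L P = dualIsogeny t L Q) :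
    P - Q ∈ AddSubgroup.zmultiples (ptT t i hi) := by
  obtain ⟨m, rfl⟩ := dualIsogeny_fiber t hi h
  rw [sub_add_cancel_left]
  exact neg_mem ((mem_zmultiples_ptT t hi).2 ⟨m, rfl⟩)

theorem exists_ptPQ_of_notMem (t : ℚˣ) {i : L} (hi : i ^ 2 = -1) {P : ((E' t)⁄L).Point}
    (hP : P ∉ AddSubgroup.zmultiples (ptT t i hi)) :
    ∃ p q, ∃ h : OnCurve t p q, P = ptPQ t p q h := by
  rcases point_cases t hi P with ⟨m, -, rfl⟩ | h
  · exact absurd ((mem_zmultiples_ptT t hi).2 ⟨m, rfl⟩) hP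
  · exact h

/-- The points `P`, `Q`, `-(P + Q)` are collinear and outside the kernel, so their images are
collinear. The conditions on `P + Q` and `P - Q` make both chords genuine: the two points on each
have distinct `x`-coordinates. -/
theorem dualIsogeny_add_of_notMem (t : ℚˣ) {i : L} (hi : i ^ 2 = -1) {P Q : ((E' t)⁄L).Point}
    (hP : P ∉ AddSubgroup.zmultiples (ptT t i hi)) (hQ : Q ∉ AddSubgroup.zmultiples (ptT t i hi))
    (hadd : P + Q ∉ AddSubgroup.zmultiples (ptT t i hi))
    (hsub : P - Q ∉ AddSubgroup.zmultiples (ptT t i hi)) :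
    dualIsogeny t L (P + Q) = dualIsogeny t L P + dualIsogeny t L Q := by
  have hx' : dualIsogeny t L P ≠ dualIsogeny t L Q := fun h =>
    hsub (sub_mem_of_dualIsogeny_eq t hi h)
  have hx'' : dualIsogeny t L P ≠ -dualIsogeny t L Q := fun h => hadd (by
    rw [← dualIsogeny_neg t hi] at h
    have := sub_mem_of_dualIsogeny_eq t hi h
    rwa [sub_neg_eq_add] at this)
  have hR : -(P + Q) ∉ AddSubgroup.zmultiples (ptT t i hi) := fun h => hadd (neg_mem_iff.1 h)
  rw [← neg_neg (P + Q), dualIsogeny_neg t hi]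
  obtain ⟨p₂, q₂, h₂, e₂⟩ := exists_ptPQ_of_notMem t hi hR
  obtain ⟨p₀, q₀, h₀, rfl⟩ := exists_ptPQ_of_notMem t hi hP
  obtain ⟨p₁, q₁, h₁, rfl⟩ := exists_ptPQ_of_notMem t hi hQ
  have hX : 8 * algebraMap ℚ L (A t) * q₀ / (1 - 4 * q₀) ≠
      8 * algebraMap ℚ L (A t) * q₁ / (1 - 4 * q₁) := fun hX => by
    rcases Point.X_eq_iff (h₁ := h₀.nonsingular) (h₂ := h₁.nonsingular) |>.1 hX with h3 | h3
    · refine hsub ?_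
      rw [ptPQ, ptPQ, h3, sub_self]
      exact zero_mem _
    · refine hadd ?_
      rw [ptPQ, ptPQ, h3, neg_add_cancel]
      exact zero_mem _
  set X₀ := 8 * algebraMap ℚ L (A t) * q₀ / (1 - 4 * q₀) with hX₀
  set X₁ := 8 * algebraMap ℚ L (A t) * q₁ / (1 - 4 * q₁) with hX₁
  set Y₀ := algebraMap ℚ L (A t) * (1 + 4 * q₀) * (2 * algebraMap ℚ L t * p₀ - 1) /
    (2 * (1 - 4 * q₀)) with hY₀
  set Y₁ := algebraMap ℚ L (A t) * (1 + 4 * q₁) * (2 * algebraMap ℚ L t * p₁ - 1) /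
    (2 * (1 - 4 * q₁)) with hY₁
  obtain ⟨l, hl⟩ : ∃ l, l * (X₀ - X₁) = Y₀ - Y₁ :=
    ⟨(Y₀ - Y₁) / (X₀ - X₁), div_mul_cancel₀ _ (sub_ne_zero.2 hX)⟩
  obtain ⟨h₃, e₃⟩ := add_some_E' t h₀.nonsingular h₁.nonsingular hX hl rfl rfl
  have e₃' : ptPQ t p₀ q₀ h₀ + ptPQ t p₁ q₁ h₁ = Point.some _ _ h₃ := e₃
  obtain ⟨h₄, e₄⟩ := neg_some_E' t h₃
  rw [e₃', e₄, ptPQ, Point.some.injEq] at e₂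
  obtain ⟨e₅, e₆⟩ := e₂
  obtain ⟨l', m', hline, hsum⟩ := exists_line_of_ptPQ t (p := ![p₀, p₁, p₂]) (q := ![q₀, q₁, q₂])
    (forall_fin_three h₀ h₁ h₂) (l := l) (m := Y₀ - l * X₀) hX
    (forall_fin_three
      (by change Y₀ = l * X₀ + (Y₀ - l * X₀); ring)
      (by change Y₁ = l * X₁ + (Y₀ - l * X₀); linear_combination hl)
      (by
        simp only [Matrix.cons_val]
        rw [← e₆, ← e₅]
        ring))
    (by
      simp only [Matrix.cons_val]
      rw [← e₅])
  have hl0 := hline 0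
  have hl1 := hline 1
  have hl2 := hline 2
  simp only [Matrix.cons_val] at hl0 hl1 hl2 hsum
  rw [ptPQ, ptPQ] at e₃'
  have e₇ : -(ptPQ t p₀ q₀ h₀ + ptPQ t p₁ q₁ h₁) = ptPQ t p₂ q₂ h₂ := by
    rw [ptPQ, ptPQ, e₃', e₄, ptPQ]
    exact point_some_congr e₅ e₆
  rw [e₇]
  rw [dualIsogeny_ptPQ, dualIsogeny_ptPQ] at hx' hx'' ⊢
  rw [dualIsogeny_ptPQ]
  have hx : p₀ ^ 2 - q₀ ^ 2 ≠ p₁ ^ 2 - q₁ ^ 2 := fun h => by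
    rcases Point.X_eq_iff (h₁ := h₀.nonsingular_E) (h₂ := h₁.nonsingular_E) |>.1 h with h3 | h3
    · exact hx' h3
    · exact hx'' h3
  obtain ⟨h₈, e₈⟩ := add_some_E t h₀.nonsingular_E h₁.nonsingular_E hx (l := l')
    (by linear_combination hl1 - hl0) hsum rfl
  obtain ⟨h₉, e₉⟩ := neg_some_E t h₂.nonsingular_E
  rw [e₈, e₉]
  refine point_some_congr rfl ?_
  linear_combination hl0 - hl2

/-- On `E` one has `(2y + x + a)² = 4x³ + 4a x² + (x + a)²`; it is enough that `x` avoids `x₀` and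
the finitely many roots of the right side. -/
theorem exists_pt_E (t : ℚˣ) [IsAlgClosed L] (x₀ : L) : ∃ x y, ∃ h : ((E t)⁄L).Nonsingular x y,
    x ≠ x₀ ∧ Point.some x y h ≠ -Point.some x y h := by
  have hchar := algebraRat.charZero L
  let f : Polynomial L := (Polynomial.X - Polynomial.C x₀) * (4 * Polynomial.X ^ 3 +
    4 * Polynomial.C (algebraMap ℚ L (a t)) * Polynomial.X ^ 2 +
    (Polynomial.X + Polynomial.C (algebraMap ℚ L (a t))) ^ 2)
  have hf : f ≠ 0 := by
    refine mul_ne_zero (Polynomial.X_sub_C_ne_zero x₀) fun h => ?_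
    have := congrArg (Polynomial.eval 0) h
    simp at this
    exact a_ne_zero t L (by rw [this, map_zero])
  obtain ⟨x, hx⟩ := Infinite.exists_notMem_finset f.roots.toFinset
  rw [Multiset.mem_toFinset, Polynomial.mem_roots hf, Polynomial.IsRoot.def] at hx
  simp only [f, Polynomial.eval_mul, Polynomial.eval_sub, Polynomial.eval_X, Polynomial.eval_C,
    Polynomial.eval_add, Polynomial.eval_pow, Polynomial.eval_ofNat] at hx
  obtain ⟨s, hs⟩ := IsAlgClosed.exists_pow_nat_eq (4 * x ^ 3 + 4 * algebraMap ℚ L (a t) * x ^ 2 +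
    (x + algebraMap ℚ L (a t)) ^ 2) (n := 2) (by norm_num)
  have hs0 : s ≠ 0 := fun h0 => right_ne_zero_of_mul hx (by rw [← hs, h0]; ring)
  have h : ((E t)⁄L).Nonsingular x ((s - x - algebraMap ℚ L (a t)) / 2) := by
    rw [nonsingular_E_iff]
    field_simp
    linear_combination hs
  refine ⟨x, _, h, sub_ne_zero.1 (left_ne_zero_of_mul hx), fun h1 => hs0 ?_⟩
  obtain ⟨h', e⟩ := neg_some_E t h
  rw [e, Point.some.injEq] at h1
  linear_combination h1.2

/-- If `P`, `Q` or `P + Q` is in the kernel, invariance under the kernel suffices. If `P - Q` is,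
the claim reduces to doubling `P`. Tangents are avoided by writing `P + P = (P + S) + (P - S)`,
where the image of the auxiliary point `S` is not 2-torsion and has an `x`-coordinate different from
that of the image of `P`; the chord case then applies three times. -/
theorem dualIsogeny_add (t : ℚˣ) [IsAlgClosed L] (P Q : ((E' t)⁄L).Point) :
    dualIsogeny t L (P + Q) = dualIsogeny t L P + dualIsogeny t L Q := by
  obtain ⟨i, hi⟩ := IsAlgClosed.exists_pow_nat_eq (-1 : L) (n := 2) (by norm_num)
  set K := AddSubgroup.zmultiples (ptT t i hi) with hK
  have h0 : ∀ {P}, P ∈ K → dualIsogeny t L P = 0 := fun h => (dualIsogeny_eq_zero_iff_mem t hi).2 h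
  by_cases hQ : Q ∈ K
  · rw [dualIsogeny_add_of_mem t hi P hQ, h0 hQ, add_zero]
  by_cases hP : P ∈ K
  · rw [add_comm P, dualIsogeny_add_of_mem t hi Q hP, h0 hP, zero_add]
  by_cases hadd : P + Q ∈ K
  · have e : Q = -P + (P + Q) := by abel
    nth_rewrite 2 [e]
    rw [dualIsogeny_add_of_mem t hi _ hadd, dualIsogeny_neg t hi, add_neg_cancel, h0 hadd]
  by_cases hsub : P - Q ∈ K
  swap
  · exact dualIsogeny_add_of_notMem t hi hP hQ hadd hsub
  have e1 : P + Q = (P + P) + -(P - Q) := by abel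
  have e2 : Q = P + -(P - Q) := by abel
  rw [e1, dualIsogeny_add_of_mem t hi _ (neg_mem hsub)]
  have e5 := dualIsogeny_add_of_mem t hi P (neg_mem hsub)
  rw [← e2] at e5
  rw [e5]
  have hPP : P + P ∉ K := fun h => hadd (by rw [e1]; exact add_mem h (neg_mem hsub))
  obtain ⟨p, q, h, hpq⟩ := exists_ptPQ_of_notMem t hi hP
  obtain ⟨x, y, hxy, hx, hneg⟩ := exists_pt_E t (p ^ 2 - q ^ 2)
  obtain ⟨S, hS⟩ := dualIsogeny_surjective t (Point.some x y hxy)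
  have hφP : dualIsogeny t L P = .some _ _ h.nonsingular_E := by rw [hpq, dualIsogeny_ptPQ]
  have hSK : S ∉ K := fun h => by
    have := h0 h
    rw [hS] at this
    exact Point.some_ne_zero _ this
  have hPS : P - S ∉ K := fun h1 => by
    have h2 := dualIsogeny_add_of_mem t hi S h1
    rw [add_sub_cancel, hφP, hS, Point.some.injEq] at h2
    exact hx h2.1.symm
  have hPS' : P + S ∉ K := fun h1 => by
    have h2 := dualIsogeny_add_of_mem t hi (-S) h1
    rw [show -S + (P + S) = P by abel, dualIsogeny_neg t hi, hφP, hS] at h2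
    obtain ⟨h', e⟩ := neg_some_E t hxy
    rw [e, Point.some.injEq] at h2
    exact hx h2.1.symm
  have hSS : S + S ∉ K := fun h1 => by
    have h2 := dualIsogeny_add_of_mem t hi (-S) h1
    rw [neg_add_cancel_left, dualIsogeny_neg t hi, hS] at h2
    exact hneg h2
  have e3 : P + P = (P + S) + (P - S) := by abel
  have e4 : (P + S) - (P - S) = S + S := by abel
  rw [e3, dualIsogeny_add_of_notMem t hi hPS' hPS (by rwa [← e3]) (by rwa [e4]),
    dualIsogeny_add_of_notMem t hi hP hSK hPS' hPS, sub_eq_add_neg P S,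
    dualIsogeny_add_of_notMem t hi hP (fun h => hSK (neg_mem_iff.1 h)) (by rwa [← sub_eq_add_neg])
      (by rwa [sub_neg_eq_add]), dualIsogeny_neg t hi]
  abel

end Additivity

/-! ### The Kummer map -/

section Kummer

open WeierstrassCurve.Affine

section

variable {L : Type*} [Field L] [Algebra ℚ L]

theorem I_ne_zero {L : Type*} [Field L] {i : L} (hi : i ^ 2 = -1) : i ≠ 0 := fun h => by
  simp [h] at hi

theorem orderOf_I {i : L} (hi : i ^ 2 = -1) : orderOf i = 4 := by
  have := algebraRat.charZero L
  refine orderOf_eq_prime_pow (p := 2) (n := 1) ?_ (I_pow_four hi)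
  rw [pow_one, hi]
  norm_num

theorem addOrderOf_ptT (t : ℚˣ) {i : L} (hi : i ^ 2 = -1) : addOrderOf (ptT t i hi) = 4 := by
  refine addOrderOf_eq_prime_pow (p := 2) (n := 1) ?_ (four_nsmul_ptT t hi)
  rw [pow_one, two_nsmul_ptT]
  exact Point.some_ne_zero _

theorem I_pow_eq_iff (t : ℚˣ) {i : L} (hi : i ^ 2 = -1) {m n : ℕ} :
    i ^ m = i ^ n ↔ m • ptT t i hi = n • ptT t i hi := by
  rw [(isOfFinOrder_iff_pow_eq_one.2 ⟨4, by norm_num, I_pow_four hi⟩).pow_eq_pow_iff_modEq,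
    (isOfFinAddOrder_iff_nsmul_eq_zero.2
      ⟨4, by norm_num, four_nsmul_ptT t hi⟩).nsmul_eq_nsmul_iff_modEq, orderOf_I hi, addOrderOf_ptT]

theorem exists_I_pow {L : Type*} [Field L] {i : L} (hi : i ^ 2 = -1) {δ δ' : L} (h : δ' ^ 4 = δ ^ 4)
    :
    ∃ m : ℕ, δ' = i ^ m * δ := by
  have h1 : (δ' - δ) * ((δ' + δ) * ((δ' - i * δ) * (δ' + i * δ))) = 0 := by
    linear_combination h + (δ ^ 4 - δ ^ 2 * δ' ^ 2) * hi
  rcases mul_eq_zero.1 h1 with h1 | h1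
  · exact ⟨0, by linear_combination h1⟩
  rcases mul_eq_zero.1 h1 with h1 | h1
  · exact ⟨2, by linear_combination h1 - δ * hi⟩
  rcases mul_eq_zero.1 h1 with h1 | h1
  · exact ⟨1, by linear_combination h1⟩
  · exact ⟨3, by linear_combination h1 - i * δ * hi⟩

/-- The isomorphism `i ^ m ↦ m T` from the fourth roots of unity to the kernel of the isogeny. -/
def kerPt (t : ℚˣ) {i : L} (hi : i ^ 2 = -1) (ζ : L) : ((E' t)⁄L).Point :=
  if h : ∃ m : ℕ, ζ = i ^ m then h.choose • ptT t i hi else 0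

theorem kerPt_pow (t : ℚˣ) {i : L} (hi : i ^ 2 = -1) (m : ℕ) :
    kerPt t hi (i ^ m) = m • ptT t i hi := by
  have h : ∃ n : ℕ, i ^ m = i ^ n := ⟨m, rfl⟩
  rw [kerPt, dif_pos h]
  exact ((I_pow_eq_iff t hi).1 h.choose_spec).symm

theorem kerPt_mul (t : ℚˣ) {i : L} (hi : i ^ 2 = -1) {ζ ζ' : L} (h : ζ ^ 4 = 1) (h' : ζ' ^ 4 = 1) :
    kerPt t hi (ζ * ζ') = kerPt t hi ζ + kerPt t hi ζ' := by
  obtain ⟨m, rfl⟩ := exists_I_pow hi (h.trans (one_pow 4).symm)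
  obtain ⟨n, rfl⟩ := exists_I_pow hi (h'.trans (one_pow 4).symm)
  rw [mul_one, mul_one, ← pow_add, kerPt_pow, kerPt_pow, kerPt_pow, add_nsmul]

theorem kerPt_injective (t : ℚˣ) {i : L} (hi : i ^ 2 = -1) {ζ ζ' : L} (h : ζ ^ 4 = 1)
    (h' : ζ' ^ 4 = 1) (he : kerPt t hi ζ = kerPt t hi ζ') : ζ = ζ' := by
  obtain ⟨m, rfl⟩ := exists_I_pow hi (h.trans (one_pow 4).symm)
  obtain ⟨n, rfl⟩ := exists_I_pow hi (h'.trans (one_pow 4).symm)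
  rw [mul_one, mul_one, kerPt_pow, kerPt_pow] at he
  rw [mul_one, mul_one, I_pow_eq_iff t hi, he]

theorem map_nsmul_ptT {L' : Type*} [Field L'] [Algebra ℚ L'] (t : ℚˣ) (f : L →ₐ[ℚ] L') {i : L}
    (hi : i ^ 2 = -1) (hi' : f i ^ 2 = -1) (m : ℕ) :
    Point.map (W' := E' t) f (m • ptT t i hi) = m • ptT t (f i) hi' := by
  rw [map_nsmul, map_ptT t f hi hi']

/-- Galois equivariance of `μ₄ ≃ E'[φ̂]`: either `f i = i` and `T` is fixed, or `f i = -i = i³` and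
`T` goes to `-T = 3T`. -/
theorem map_kerPt (t : ℚˣ) {i : L} (hi : i ^ 2 = -1) (f : L →ₐ[ℚ] L) {ζ : L} (h : ζ ^ 4 = 1) :
    Point.map (W' := E' t) f (kerPt t hi ζ) = kerPt t hi (f ζ) := by
  obtain ⟨m, rfl⟩ := exists_I_pow hi (h.trans (one_pow 4).symm)
  have hi' : f i ^ 2 = -1 := by rw [← map_pow, hi, map_neg, map_one]
  rw [mul_one, kerPt_pow, map_nsmul_ptT t f hi hi', map_pow]
  rcases sq_eq_sq_iff_eq_or_eq_neg.1 (hi'.trans hi.symm) with h1 | h1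
  · have h2 : ptT t (f i) hi' = ptT t i hi := by congr 1
    rw [h2, h1, kerPt_pow]
  · have h2 : ptT t (f i) hi' = ptT t (-i) (neg_sq_I hi) := by congr 1
    have h3 : -i = i ^ 3 := by linear_combination -i * hi
    rw [h2, ← three_nsmul_ptT t hi, h1, h3, ← pow_mul, kerPt_pow, mul_nsmul]

end

theorem isLocallyConstant_apply (x : QBar) :
    IsLocallyConstant fun σ : QBar ≃ₐ[ℚ] QBar => σ x := by
  rw [IsLocallyConstant.iff_exists_open]
  intro σ
  refine ⟨(fun τ => σ⁻¹ * τ) ⁻¹' (MulAction.stabilizer (QBar ≃ₐ[ℚ] QBar) x : Set (QBar ≃ₐ[ℚ] QBar)),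
    (stabilizer_isOpen_of_isIntegral (K := ℚ) x).preimage (continuous_const_mul _), ?_, ?_⟩
  · simp
  · intro τ hτ
    have h : (σ⁻¹ * τ) x = x := hτ
    rw [AlgEquiv.mul_apply] at h
    calc τ x = σ (σ⁻¹ (τ x)) := (AlgEquiv.apply_symm_apply σ _).symm
      _ = σ x := by rw [h]

theorem dualKernel_eq (t : ℚˣ) {i : QBar} (hi : i ^ 2 = -1) :
    dualKernel t = AddSubgroup.zmultiples (ptT t i hi) := by
  have h : {P | dualIsogeny t QBar P = 0} =
      (AddSubgroup.zmultiples (ptT t i hi) : Set ((E' t)⁄QBar).Point) := by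
    ext P
    exact dualIsogeny_eq_zero_iff_mem t hi
  rw [dualKernel, h, AddSubgroup.closure_eq]

theorem mem_dualKernel_iff (t : ℚˣ) {i : QBar} (hi : i ^ 2 = -1) {P : ((E' t)⁄QBar).Point} :
    P ∈ dualKernel t ↔ ∃ m : ℕ, P = m • ptT t i hi := by
  rw [dualKernel_eq t hi, mem_zmultiples_ptT]

/-- The crossed homomorphism `σ ↦ m T` for `σ δ = i ^ m δ`. -/
def kummerFun (t : ℚˣ) {i : QBar} (hi : i ^ 2 = -1) (δ : QBar) (σ : QBar ≃ₐ[ℚ] QBar) :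
    ((E' t)⁄QBar).Point := kerPt t hi (σ δ / δ)

theorem div_pow_four {d : ℚˣ} {δ : QBar} (h : δ ^ 4 = algebraMap ℚ QBar d)
    (σ : QBar ≃ₐ[ℚ] QBar) : (σ δ / δ) ^ 4 = 1 := by
  have hd : algebraMap ℚ QBar d ≠ 0 := t_ne_zero d QBar
  rw [div_pow, ← map_pow, h, AlgEquiv.commutes, div_self hd]

theorem root_ne_zero {d : ℚˣ} {L : Type*} [Field L] [Algebra ℚ L] {δ : L}
    (h : δ ^ 4 = algebraMap ℚ L d) : δ ≠ 0 := fun h0 =>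
  t_ne_zero d L (by rw [← h, h0, zero_pow (by norm_num)])

theorem kummerFun_mem (t : ℚˣ) {i : QBar} (hi : i ^ 2 = -1) {d : ℚˣ} {δ : QBar}
    (h : δ ^ 4 = algebraMap ℚ QBar d) :
    kummerFun t hi δ ∈ cocycles (galAct (E' t) ℚ QBar) (dualKernel t) := by
  have h0 := root_ne_zero h
  refine ⟨?_, fun σ τ => ?_, fun σ => ?_⟩
  · exact (isLocallyConstant_apply δ).comp fun x => kerPt t hi (x / δ)
  · have h1 : (σ * τ) δ / δ = σ (τ δ / δ) * (σ δ / δ) := by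
      have : σ δ ≠ 0 := (map_ne_zero σ).2 h0
      rw [map_div₀, AlgEquiv.mul_apply]
      field_simp
    have h2 := map_kerPt t hi ((σ : QBar →ₐ[ℚ] QBar).restrictScalars ℚ) (div_pow_four h τ)
    rw [kummerFun, h1, kerPt_mul t hi (by rw [← map_pow, div_pow_four h, map_one])
      (div_pow_four h σ)]
    exact congrArg (· + _) h2.symm
  · obtain ⟨m, hm⟩ := exists_I_pow hi ((div_pow_four h σ).trans (one_pow 4).symm)
    rw [mem_dualKernel_iff t hi]
    exact ⟨m, by rw [kummerFun, hm, mul_one, kerPt_pow]⟩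

/-- The Kummer crossed homomorphism of a fourth root `δ` of `d`. -/
def kummerCocycle (t : ℚˣ) {i : QBar} (hi : i ^ 2 = -1) {d : ℚˣ} {δ : QBar}
    (h : δ ^ 4 = algebraMap ℚ QBar d) : cocycles (galAct (E' t) ℚ QBar) (dualKernel t) :=
  ⟨kummerFun t hi δ, kummerFun_mem t hi h⟩

theorem kummerCocycle_apply (t : ℚˣ) {i : QBar} (hi : i ^ 2 = -1) {d : ℚˣ} {δ : QBar}
    (h : δ ^ 4 = algebraMap ℚ QBar d) {σ : QBar ≃ₐ[ℚ] QBar} {m : ℕ} (hm : σ δ = i ^ m * δ) :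
    (kummerCocycle t hi h).1 σ = m • ptT t i hi := by
  change kerPt t hi (σ δ / δ) = _
  rw [hm, mul_div_cancel_right₀ _ (root_ne_zero h), kerPt_pow]

theorem H1_mk_eq_iff {G M : Type*} [Group G] [TopologicalSpace G] [AddCommGroup M]
    {ρ : G →* AddMonoid.End M} {N : AddSubgroup M} {f g : cocycles ρ N} :
    H1.mk ρ N f = H1.mk ρ N g ↔ ∃ m ∈ N, ∀ σ, g.1 σ = f.1 σ + (ρ σ m - m) := by
  refine QuotientAddGroup.eq.trans (AddSubgroup.mem_addSubgroupOf.trans ?_)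
  refine exists_congr fun m => and_congr_right fun _ => forall_congr' fun σ => ?_
  change -f.1 σ + g.1 σ = _ ↔ _
  rw [neg_add_eq_iff_eq_add]

theorem H1_mk_eq_zero_iff {G M : Type*} [Group G] [TopologicalSpace G] [AddCommGroup M]
    {ρ : G →* AddMonoid.End M} {N : AddSubgroup M} {f : cocycles ρ N} :
    H1.mk ρ N f = 0 ↔ ∃ m ∈ N, ∀ σ, f.1 σ = ρ σ m - m :=
  (QuotientAddGroup.eq_zero_iff _).trans AddSubgroup.mem_addSubgroupOf

theorem galAct_kerPt (t : ℚˣ) {i : QBar} (hi : i ^ 2 = -1) (σ : QBar ≃ₐ[ℚ] QBar) {ζ : QBar}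
    (h : ζ ^ 4 = 1) : galAct (E' t) ℚ QBar σ (kerPt t hi ζ) = kerPt t hi (σ ζ) :=
  map_kerPt t hi ((σ : QBar →ₐ[ℚ] QBar).restrictScalars ℚ) h

/-- Changing the fourth root by the factor `i ^ m` changes the crossed homomorphism by the principal
one of `m T`. -/
theorem kummerClass_congr (t : ℚˣ) {i : QBar} (hi : i ^ 2 = -1) {d : ℚˣ} {δ δ' : QBar}
    (h : δ ^ 4 = algebraMap ℚ QBar d) (h' : δ' ^ 4 = algebraMap ℚ QBar d) :
    H1.mk _ _ (kummerCocycle t hi h) = H1.mk _ _ (kummerCocycle t hi h') := by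
  obtain ⟨m, hm⟩ := exists_I_pow hi (h'.trans h.symm)
  have h0 := root_ne_zero h
  have hI := I_ne_zero hi
  have h4 : (i ^ m) ^ 4 = 1 := by rw [pow_right_comm, I_pow_four hi, one_pow]
  refine H1_mk_eq_iff.2 ⟨m • ptT t i hi, (mem_dualKernel_iff t hi).2 ⟨m, rfl⟩, fun σ => ?_⟩
  change kerPt t hi (σ δ' / δ') = kerPt t hi (σ δ / δ) + _
  have h1 : σ δ' / δ' * i ^ m = σ δ / δ * σ (i ^ m) := by
    rw [hm, map_mul]
    field_simp
  have h2 := congrArg (kerPt t hi) h1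
  rw [kerPt_mul t hi (div_pow_four h' σ) h4, kerPt_mul t hi (div_pow_four h σ)
    (by rw [← map_pow, h4, map_one]), ← galAct_kerPt t hi σ h4, kerPt_pow] at h2
  rw [← add_sub_assoc, ← h2, add_sub_cancel_right]

theorem exists_root (d : ℚˣ) : ∃ δ : QBar, δ ^ 4 = algebraMap ℚ QBar d :=
  IsAlgClosed.exists_pow_nat_eq _ (by norm_num)

theorem exists_sq_eq_neg_one (L : Type*) [Field L] [IsAlgClosed L] : ∃ i : L, i ^ 2 = -1 :=
  IsAlgClosed.exists_pow_nat_eq _ (by norm_num)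

/-- The class of the Kummer crossed homomorphism of `d`. -/
def kummerClass (t : ℚˣ) {i : QBar} (hi : i ^ 2 = -1) (d : ℚˣ) : H1Q (E' t) (dualKernel t) :=
  H1.mk _ _ (kummerCocycle t hi (exists_root d).choose_spec)

theorem kummerClass_eq (t : ℚˣ) {i : QBar} (hi : i ^ 2 = -1) {d : ℚˣ} {δ : QBar}
    (h : δ ^ 4 = algebraMap ℚ QBar d) : kummerClass t hi d = H1.mk _ _ (kummerCocycle t hi h) :=
  kummerClass_congr t hi _ _

theorem kummerClass_mul (t : ℚˣ) {i : QBar} (hi : i ^ 2 = -1) (d e : ℚˣ) :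
    kummerClass t hi (d * e) = kummerClass t hi d + kummerClass t hi e := by
  obtain ⟨δ, hδ⟩ := exists_root d
  obtain ⟨ε, hε⟩ := exists_root e
  have h : (δ * ε) ^ 4 = algebraMap ℚ QBar ((d * e : ℚˣ) : ℚ) := by
    rw [mul_pow, hδ, hε, Units.val_mul, map_mul]
  rw [kummerClass_eq t hi hδ, kummerClass_eq t hi hε, kummerClass_eq t hi h, ← map_add]
  congr 1
  ext1
  funext σ
  change kerPt t hi (σ (δ * ε) / (δ * ε)) = kerPt t hi (σ δ / δ) + kerPt t hi (σ ε / ε)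
  rw [← kerPt_mul t hi (div_pow_four hδ σ) (div_pow_four hε σ), map_mul, mul_div_mul_comm]

theorem exists_rat_of_fixed {x : QBar} (h : ∀ σ : QBar ≃ₐ[ℚ] QBar, σ x = x) :
    ∃ q : ℚ, algebraMap ℚ QBar q = x :=
  (InfiniteGalois.mem_range_algebraMap_iff_fixed (k := ℚ) x).2 h

/-- A trivialization by `m T` says `σ δ / δ = σ ζ / ζ` with `ζ = i ^ m`, so `δ / ζ` is rational, and
its fourth power is `d`. -/
theorem eq_pow_four_of_kummerClass_eq_zero (t : ℚˣ) {i : QBar} (hi : i ^ 2 = -1) {d : ℚˣ}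
    (h : kummerClass t hi d = 0) : ∃ e : ℚˣ, e ^ 4 = d := by
  obtain ⟨δ, hδ⟩ := exists_root d
  have h0 := root_ne_zero hδ
  rw [kummerClass_eq t hi hδ, H1_mk_eq_zero_iff] at h
  obtain ⟨M, hM, h⟩ := h
  obtain ⟨m, rfl⟩ := (mem_dualKernel_iff t hi).1 hM
  have hI := pow_ne_zero m (I_ne_zero hi)
  have h4 : (i ^ m) ^ 4 = 1 := by rw [pow_right_comm, I_pow_four hi, one_pow]
  obtain ⟨q, hq⟩ := exists_rat_of_fixed (x := δ / i ^ m) fun σ => by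
    have h1 : kerPt t hi (σ δ / δ) = _ := h σ
    rw [← kerPt_pow, galAct_kerPt t hi σ h4, eq_sub_iff_add_eq,
      ← kerPt_mul t hi (div_pow_four hδ σ) h4] at h1
    have h2 := kerPt_injective t hi (by rw [mul_pow, div_pow_four hδ, h4, one_mul])
      (by rw [← map_pow, h4, map_one]) h1
    have : σ (i ^ m) ≠ 0 := (map_ne_zero σ).2 hI
    rw [map_div₀, div_eq_div_iff this hI, ← h2]
    field_simp
  have hqd : q ^ 4 = d := by
    apply (algebraMap ℚ QBar).injective
    rw [map_pow, hq, div_pow, hδ, h4, div_one]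
  have hq0 : q ≠ 0 := fun h1 => d.ne_zero (by rw [← hqd, h1, zero_pow (by norm_num)])
  exact ⟨Units.mk0 q hq0, Units.ext hqd⟩

end Kummer

/-! ### Hilbert's Theorem 90 and the Kummer isomorphism -/

section HilbertNinety

open WeierstrassCurve.Affine

/-- Hilbert's Theorem 90 for continuous crossed homomorphisms. -/
theorem exists_eq_mul_of_cocycle (F : (QBar ≃ₐ[ℚ] QBar) → QBar) (hF : IsLocallyConstant F)
    (hF0 : ∀ σ, F σ ≠ 0) (hF1 : ∀ σ τ, F (σ * τ) = σ (F τ) * F σ) :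
    ∃ δ : QBar, δ ≠ 0 ∧ ∀ σ : QBar ≃ₐ[ℚ] QBar, σ δ = F σ * δ := by
  have h1 : F 1 = 1 := by
    have h := hF1 1 1
    rw [mul_one, AlgEquiv.one_apply] at h
    exact (mul_eq_left₀ (hF0 1)).1 h.symm
  -- By continuity `F` is trivial on the automorphisms fixing some finite extension `E`, so `F σ`
  -- depends only on the embedding of `E` that `σ` induces. Sums over the Galois group can be
  -- replaced by finite sums over these embeddings.
  obtain ⟨E, hE, hEU⟩ := (krullTopology_mem_nhds_one_iff ℚ QBar {σ | F σ = 1}).1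
    ((hF.isOpen_fiber 1).mem_nhds h1)
  have hres : ∀ σ τ : QBar ≃ₐ[ℚ] QBar, (∀ x : E, σ x = τ x) → F σ = F τ := fun σ τ h => by
    have h2 : F (σ⁻¹ * τ) = 1 := hEU (by
      rw [SetLike.mem_coe, IntermediateField.mem_fixingSubgroup_iff]
      intro x hx
      rw [AlgEquiv.mul_apply]
      exact (AlgEquiv.symm_apply_eq σ).2 (h ⟨x, hx⟩).symm)
    have h3 := hF1 σ (σ⁻¹ * τ)
    rw [mul_inv_cancel_left, h2, map_one, one_mul] at h3
    exact h3.symm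
  have hlift : ∀ s : E →ₐ[ℚ] QBar, ∃ σ : QBar ≃ₐ[ℚ] QBar, ∀ x : E, σ x = s x := fun s =>
    ⟨AlgEquiv.ofBijective (s.liftNormal QBar) (AlgHom.normal_bijective ℚ QBar QBar _),
      fun x => s.liftNormal_commutes QBar x⟩
  choose lift hlift using hlift
  let _ : Fintype (E →ₐ[ℚ] QBar) := Fintype.ofFinite _
  -- Independence of the embeddings makes some such sum nonzero; its inverse is the required `δ`.
  have hex : ∃ c : E, ∑ s : E →ₐ[ℚ] QBar, F (lift s) * s c ≠ 0 := by
    by_contra! hc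
    have h2 := Fintype.linearIndependent_iff.1 (linearIndependent_toLinearMap ℚ E QBar)
      (fun s => F (lift s)) (LinearMap.ext fun c => by simpa using hc c) E.val
    exact hF0 _ h2
  obtain ⟨c, hc⟩ := hex
  have hσ : ∀ σ : QBar ≃ₐ[ℚ] QBar, F σ * σ (∑ s : E →ₐ[ℚ] QBar, F (lift s) * s c) =
      ∑ s : E →ₐ[ℚ] QBar, F (lift s) * s c := fun σ => by
    rw [map_sum, Finset.mul_sum]
    refine Fintype.sum_bijective (fun s => (σ : QBar →ₐ[ℚ] QBar).comp s)
      (Function.Injective.bijective_of_finite fun s s' h => ?_) _ _ fun s => ?_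
    · exact AlgHom.ext fun x => σ.injective (AlgHom.congr_fun h x)
    · have h2 : F (lift ((σ : QBar →ₐ[ℚ] QBar).comp s)) = F (σ * lift s) :=
        hres _ _ fun x => by
          rw [hlift, AlgEquiv.mul_apply, hlift]
          rfl
      rw [h2, hF1, map_mul]
      change _ = _ * σ (s c)
      ring
  refine ⟨_, inv_ne_zero hc, fun σ => ?_⟩
  have h2 := hσ σ
  have h3 := (map_ne_zero σ).2 hc
  rw [map_inv₀, inv_eq_iff_eq_inv, mul_inv, inv_inv, eq_inv_mul_iff_mul_eq₀ (hF0 σ), h2]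

/-- Read through `μ₄ ≃ E'[φ̂]`, the crossed homomorphism takes values in `ℚ̄ˣ`. Hilbert's Theorem 90
provides `δ` with these values as `σ δ / δ`; they are fourth roots of unity, so `δ⁴` is rational. -/
theorem kummerClass_surjective (t : ℚˣ) {i : QBar} (hi : i ^ 2 = -1)
    (c : H1Q (E' t) (dualKernel t)) : ∃ d : ℚˣ, kummerClass t hi d = c := by
  obtain ⟨f, rfl⟩ := QuotientAddGroup.mk'_surjective _ c
  -- The root of unity is chosen for every point, with value 1 outside the kernel, so that composing
  -- this choice with `f` is visibly locally constant.
  have hroot : ∀ P : ((E' t)⁄QBar).Point, ∃ ζ : QBar, ζ ^ 4 = 1 ∧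
      (P ∈ dualKernel t → kerPt t hi ζ = P) := fun P => by
    by_cases hP : P ∈ dualKernel t
    · obtain ⟨m, rfl⟩ := (mem_dualKernel_iff t hi).1 hP
      exact ⟨i ^ m, by rw [pow_right_comm, I_pow_four hi, one_pow], fun _ => kerPt_pow t hi m⟩
    · exact ⟨1, one_pow 4, fun h => absurd h hP⟩
  choose g hg4 hg using hroot
  have hgf : ∀ σ, kerPt t hi (g (f.1 σ)) = f.1 σ := fun σ => hg _ (f.2.2.2 σ)
  have hg0 : ∀ P, g P ≠ 0 := fun P h => by simpa [h] using hg4 P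
  obtain ⟨δ, hδ0, hδ⟩ := exists_eq_mul_of_cocycle (fun σ => g (f.1 σ)) (f.2.1.comp g)
    (fun σ => hg0 _) fun σ τ => by
      have h4 : σ (g (f.1 τ)) ^ 4 = 1 := by rw [← map_pow, hg4, map_one]
      refine kerPt_injective t hi (hg4 _) (by rw [mul_pow, h4, hg4, one_mul]) ?_
      rw [kerPt_mul t hi h4 (hg4 _), hgf, hgf, f.2.2.1, ← galAct_kerPt t hi σ (hg4 _), hgf]
  obtain ⟨q, hq⟩ := exists_rat_of_fixed (x := δ ^ 4) fun σ => by
    rw [map_pow, hδ, mul_pow, hg4, one_mul]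
  have hq0 : q ≠ 0 := fun h => pow_ne_zero 4 hδ0 (by rw [← hq, h, map_zero])
  have hd : δ ^ 4 = algebraMap ℚ QBar (Units.mk0 q hq0) := hq.symm
  refine ⟨Units.mk0 q hq0, (kummerClass_eq t hi hd).trans ?_⟩
  refine congrArg (H1.mk _ _) (Subtype.ext (funext fun σ => ?_))
  change kerPt t hi (σ δ / δ) = _
  rw [hδ, mul_div_cancel_right₀ _ hδ0, hgf]

/-- The Kummer map on `ℚˣ`. -/
def kummerHom (t : ℚˣ) {i : QBar} (hi : i ^ 2 = -1) :
    ℚˣ →* Multiplicative (H1Q (E' t) (dualKernel t)) :=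
  MonoidHom.mk' (fun d => Multiplicative.ofAdd (kummerClass t hi d)) (kummerClass_mul t hi)

theorem kummerClass_pow_four (t : ℚˣ) {i : QBar} (hi : i ^ 2 = -1) (e : ℚˣ) :
    kummerClass t hi (e ^ 4) = 0 := by
  have h : algebraMap ℚ QBar e ^ 4 = algebraMap ℚ QBar ((e ^ 4 : ℚˣ) : ℚ) := by
    rw [Units.val_pow_eq_pow_val, map_pow]
  refine (kummerClass_eq t hi h).trans (H1_mk_eq_zero_iff.2 ⟨0, zero_mem _, fun σ => ?_⟩)
  rw [map_zero, sub_zero, kummerCocycle_apply t hi h (m := 0)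
    (by rw [AlgEquiv.commutes, pow_zero, one_mul]), zero_nsmul]

theorem kummerHom_eq_one_iff (t : ℚˣ) {i : QBar} (hi : i ^ 2 = -1) (d : ℚˣ) :
    kummerHom t hi d = 1 ↔ d ∈ (powMonoidHom 4 : ℚˣ →* ℚˣ).range := by
  constructor
  · exact fun h => eq_pow_four_of_kummerClass_eq_zero t hi h
  · rintro ⟨e, rfl⟩
    exact congrArg Multiplicative.ofAdd (kummerClass_pow_four t hi e)

/-- The Kummer isomorphism. -/
def kummerEquiv (t : ℚˣ) {i : QBar} (hi : i ^ 2 = -1) :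
    Additive FourthPowerClasses ≃+ H1Q (E' t) (dualKernel t) :=
  AddEquiv.ofBijective (MonoidHom.toAdditiveLeft (QuotientGroup.lift _ (kummerHom t hi)
    fun d => (kummerHom_eq_one_iff t hi d).2)) (by
    constructor
    · refine (injective_iff_map_eq_zero _).2 fun D hD => ?_
      obtain ⟨d, rfl⟩ := QuotientGroup.mk_surjective D.toMul
      exact (QuotientGroup.eq_one_iff d).2 ((kummerHom_eq_one_iff t hi d).1 hD)
    · intro c
      obtain ⟨d, rfl⟩ := kummerClass_surjective t hi c
      exact ⟨Additive.ofMul (d : FourthPowerClasses), rfl⟩)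

theorem kummerEquiv_apply (t : ℚˣ) {i : QBar} (hi : i ^ 2 = -1) (d : ℚˣ) :
    kummerEquiv t hi (Additive.ofMul (d : FourthPowerClasses)) = kummerClass t hi d := rfl

theorem isKummerClass_kummerClass (t : ℚˣ) {i : QBar} (hi : i ^ 2 = -1) (d : ℚˣ) :
    IsKummerClass t d (kummerClass t hi d) := by
  obtain ⟨δ, hδ⟩ := exists_root d
  exact ⟨i, δ, ptT t i hi, kummerCocycle t hi hδ, hi, hδ, ⟨_, rfl⟩, (kummerClass_eq t hi hδ).symm,
    fun σ m h => kummerCocycle_apply t hi hδ h⟩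

end HilbertNinety

/-! ### Rational points of the homogeneous spaces and crossed homomorphisms -/

section Torsor

open WeierstrassCurve.Affine

section

variable {L : Type*} [Field L] [Algebra ℚ L]

theorem theta_proportional_iff (t : ℚˣ) {δ : L} (hδ : δ ≠ 0) {i : L} (hi : i ^ 2 = -1)
    {P Q : ((E' t)⁄L).Point} {m : ℕ} :
    Proportional (theta t (i ^ m * δ) Q) (theta t δ P) ↔ Q = P + m • ptT t i hi := by
  have h1 : Proportional (theta t (i ^ m * δ) (P + m • ptT t i hi)) (theta t δ P) := by
    have h2 : (-i) ^ m * (i ^ m * δ) = δ := by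
      have h3 : -i * i = 1 := by linear_combination -hi
      rw [← mul_assoc, ← mul_pow, h3, one_pow, one_mul]
    have h4 := theta_add_nsmul_ptT t (i ^ m * δ) hi P m
    rwa [h2] at h4
  constructor
  · intro h
    exact theta_injective t (mul_ne_zero (pow_ne_zero m (I_ne_zero hi)) hδ) hi (h.trans h1.symm)
  · rintro rfl
    exact h1

end

/-! ### Local triviality of the Kummer class and rational points of `C'_d` -/

section Local

variable {K L : Type*} [Field K] [Field L] [Algebra ℚ K] [Algebra ℚ L] [Algebra K L]
  [IsScalarTower ℚ K L]

theorem galAct_theta (t : ℚˣ) (τ : L ≃ₐ[K] L) (δ : L) (P : ((E' t)⁄L).Point) (k : Fin 4) :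
    τ (theta t δ P k) = theta t (τ δ) (galAct (E' t) K L τ P) k :=
  map_theta t ((τ : L →ₐ[K] L).restrictScalars ℚ) δ P k

theorem OnSpace.exists_ne_zero {t : ℚˣ} {d : L} {v : Fin 4 → L} (h : OnSpace t d v) :
    ∃ k, v k ≠ 0 := by
  by_contra! h0
  exact h.1 (funext h0)

/-- A point of the homogeneous space is rational if the Galois action fixes it. -/
theorem hasPoint_of_fixed {K L : Type*} [Field K] [Field L] [Algebra ℚ K] [Algebra ℚ L]
    [Algebra K L] [IsGalois K L] (t d : ℚˣ) {v : Fin 4 → L}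
    (hv : OnSpace t (algebraMap ℚ L d) v) (h : ∀ τ : L ≃ₐ[K] L, Proportional (fun k => τ (v k)) v) :
    HasPoint t d K := by
  obtain ⟨l, hl⟩ := hv.exists_ne_zero
  -- Dividing by a nonzero coordinate removes the scaling factor, so the coordinates themselves
  -- become Galois invariant.
  have hw : ∀ k, ∃ x : K, algebraMap K L x = v k / v l := fun k => by
    refine (InfiniteGalois.mem_range_algebraMap_iff_fixed (k := K) _).2 fun τ => ?_
    obtain ⟨r, hr, e⟩ := h τ
    rw [map_div₀, show τ (v k) = _ from e k, show τ (v l) = _ from e l, mul_div_mul_left _ _ hr]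
  choose w hw using hw
  have hvw : Proportional (fun k => algebraMap K L (w k)) v :=
    ⟨(v l)⁻¹, inv_ne_zero hl, fun k => by simp only [hw, div_eq_inv_mul]⟩
  obtain ⟨h0, h1, h2⟩ := hv.of_proportional hvw
  refine ⟨w, fun hw0 => h0 (funext fun k => by rw [hw0]; exact map_zero _), ?_, ?_⟩ <;>
  refine (algebraMap K L).injective ?_
  · simpa [← IsScalarTower.algebraMap_apply] using h1
  · simpa [← IsScalarTower.algebraMap_apply] using h2

variable [Algebra.IsAlgebraic K L] [IsGalois K L]

/-- The class of `d` becomes trivial over `K` if and only if the homogeneous space has a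
`K`-rational point. -/
theorem localize_kummerClass_eq_zero_iff (t : ℚˣ) (ι : QBar →ₐ[ℚ] L) {i : QBar} (hi : i ^ 2 = -1)
    (d : ℚˣ) :
    localize (K := K) (E' t) ι (dualKernel t) (kummerClass t hi d) = 0 ↔ HasPoint t d K := by
  obtain ⟨δ, hδ⟩ := exists_root d
  have h0 : ι δ ≠ 0 := (map_ne_zero ι).2 (root_ne_zero hδ)
  have hι : ι i ^ 2 = -1 := by rw [← map_pow, hi, map_neg, map_one]
  have hδ4 : ι δ ^ 4 = algebraMap ℚ L d := by rw [← map_pow, hδ, AlgHom.commutes]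
  have hτ : ∀ τ : L ≃ₐ[K] L, ∃ m : ℕ, τ (ι δ) = ι i ^ m * ι δ ∧
      Point.map (W' := E' t) ι (kummerFun t hi δ (galRes ι τ)) = m • ptT t (ι i) hι := fun τ => by
    obtain ⟨m, hm⟩ := exists_I_pow hi (δ := δ) (δ' := galRes ι τ δ) (by
      rw [← map_pow, hδ, AlgEquiv.commutes])
    refine ⟨m, ?_, ?_⟩
    · rw [← galRes_commutes, hm, map_mul, map_pow]
    · rw [← map_nsmul_ptT t ι hi]
      exact congrArg _ (kummerCocycle_apply t hi hδ hm)
  -- If `τ δ = i ^ m δ`, then `τ` carries the point of `C'_d` belonging to `M` to the one given by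
  -- `i ^ m δ` and `τ M`. This is the original point exactly when `τ M = M + m T`, so a
  -- trivialization `M` is the same as a Galois-fixed point.
  have key : localize (K := K) (E' t) ι (dualKernel t) (kummerClass t hi d) = 0 ↔
      ∃ M : ((E' t)⁄L).Point, ∀ τ : L ≃ₐ[K] L,
        Proportional (fun k => τ (theta t (ι δ) M k)) (theta t (ι δ) M) := by
    rw [kummerClass_eq t hi hδ]
    refine H1_mk_eq_zero_iff.trans (exists_congr fun M => ?_)
    refine (and_iff_right trivial).trans (forall_congr' fun τ => ?_)
    obtain ⟨m, h1, h2⟩ := hτ τ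
    have h3 : (fun k => τ (theta t (ι δ) M k)) =
        theta t (ι i ^ m * ι δ) (galAct (E' t) K L τ M) := by
      funext k
      rw [galAct_theta, h1]
    rw [h3, theta_proportional_iff t h0 hι, ← sub_eq_iff_eq_add', eq_comm, ← h2]
    rfl
  rw [key]
  constructor
  · rintro ⟨M, hM⟩
    exact hasPoint_of_fixed t d (hδ4 ▸ onSpace_theta t h0 hι M) hM
  · rintro ⟨v, hv0, hv1, hv2⟩
    have hv : OnSpace t (ι δ ^ 4) fun k => algebraMap K L (v k) := by
      rw [hδ4]
      refine ⟨fun h => hv0 (funext fun k => (algebraMap K L).injective ?_), ?_, ?_⟩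
      · rw [Pi.zero_apply, map_zero]
        exact congrFun h k
      · simpa [← IsScalarTower.algebraMap_apply] using congrArg (algebraMap K L) hv1
      · simpa [← IsScalarTower.algebraMap_apply] using congrArg (algebraMap K L) hv2
    obtain ⟨M, r, hr, e⟩ := exists_theta t h0 hι hv
    refine ⟨M, fun τ => ⟨(τ r)⁻¹ * r, mul_ne_zero (inv_ne_zero ((map_ne_zero τ).2 hr)) hr,
      fun k => ?_⟩⟩
    rw [mul_assoc, ← e, eq_inv_mul_iff_mul_eq₀ ((map_ne_zero τ).2 hr), ← map_mul, ← e,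
      AlgEquiv.commutes]

end Local

/-- The map `H¹(Gal(ℚ̄/ℚ), E'[φ̂]) → WC(E'/ℚ)`. -/
def toWC (t : ℚˣ) : H1Q (E' t) (dualKernel t) →+ WC (E' t) :=
  QuotientAddGroup.map _ _ (AddSubgroup.inclusion
      (fun _ h => ⟨h.1, h.2.1, fun _ => AddSubgroup.mem_top _⟩ :
        cocycles (galAct (E' t) ℚ QBar) (dualKernel t) ≤ cocycles (galAct (E' t) ℚ QBar) ⊤)) (by
    rintro ⟨f, hf⟩ ⟨m, hm, hfm⟩
    exact ⟨m, trivial, hfm⟩)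

theorem toWC_mk (t : ℚˣ) (f : cocycles (galAct (E' t) ℚ QBar) (dualKernel t)) :
    toWC t (H1.mk _ _ f) = H1.mk (galAct (E' t) ℚ QBar) ⊤
      ⟨f.1, f.2.1, f.2.2.1, fun _ => trivial⟩ := rfl

theorem localize_toWC {K L : Type*} [Field K] [Field L] [Algebra ℚ K] [Algebra ℚ L] [Algebra K L]
    [IsScalarTower ℚ K L] [Algebra.IsAlgebraic K L] (t : ℚˣ) (ι : QBar →ₐ[ℚ] L)
    (c : H1Q (E' t) (dualKernel t)) :
    localize (K := K) (E' t) ι ⊤ (toWC t c) = localize (K := K) (E' t) ι (dualKernel t) c := by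
  obtain ⟨f, rfl⟩ := QuotientAddGroup.mk'_surjective _ c
  rfl

theorem toWC_mem_Sha_iff (t : ℚˣ) (c : H1Q (E' t) (dualKernel t)) :
    toWC t c ∈ Sha (E' t) ↔ c ∈ selmer t := by
  simp only [Sha, selmer, everywhereLocallyTrivial, AddSubgroup.mem_inf, AddSubgroup.mem_iInf,
    AddMonoidHom.mem_ker, localize_toWC]

theorem kummerClass_mem_selmer_iff (t : ℚˣ) {i : QBar} (hi : i ^ 2 = -1) (d : ℚˣ) :
    kummerClass t hi d ∈ selmer t ↔
      (∀ (p : ℕ) [Fact p.Prime], HasPoint t d ℚ_[p]) ∧ HasPoint t d ℝ := by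
  simp only [selmer, everywhereLocallyTrivial, AddSubgroup.mem_inf, AddSubgroup.mem_iInf,
    AddMonoidHom.mem_ker, localize_kummerClass_eq_zero_iff]

/-- The minus sign arises because the point given by `i ^ m δ` and `σ P` is the one given by `δ` and
`σ P - m T`, so the crossed homomorphism of the space is `σ ↦ -m T`. The condition does not depend
on `P`. -/
theorem isClassOfSpace_iff (t : ℚˣ) {i : QBar} (hi : i ^ 2 = -1) (d : ℚˣ) (c : WC (E' t)) :
    IsClassOfSpace t d c ↔ c = toWC t (-kummerClass t hi d) := by
  have key : ∀ {δ : QBar} (hδ : δ ^ 4 = algebraMap ℚ QBar d)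
      (f : cocycles (galAct (E' t) ℚ QBar) ⊤), (∀ (σ : QBar ≃ₐ[ℚ] QBar)
        (P : ((E' t)⁄QBar).Point), ∃ r : QBar, r ≠ 0 ∧
          ∀ k, σ (thetaInv t δ P k) = r * thetaInv t δ (galAct (E' t) ℚ QBar σ P + f.1 σ) k) ↔
        ∀ σ, f.1 σ = -(kummerCocycle t hi hδ).1 σ := fun {δ} hδ f => by
    refine forall_congr' fun σ => ?_
    obtain ⟨m, hm⟩ := exists_I_pow hi (δ := δ) (δ' := σ δ) (by
      rw [← map_pow, hδ, AlgEquiv.commutes])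
    have h1 : ∀ P : ((E' t)⁄QBar).Point, (∃ r : QBar, r ≠ 0 ∧
          ∀ k, σ (thetaInv t δ P k) = r * thetaInv t δ (galAct (E' t) ℚ QBar σ P + f.1 σ) k) ↔
        f.1 σ = -(kummerCocycle t hi hδ).1 σ := fun P => by
      have h2 : (fun k => σ (theta t δ P k)) =
          theta t (i ^ m * δ) (galAct (E' t) ℚ QBar σ P) := by
        funext k
        rw [galAct_theta, hm]
      rw [thetaInv_eq_theta, kummerCocycle_apply t hi hδ hm]
      change Proportional (fun k => σ (theta t δ P k)) _ ↔ _
      rw [h2, theta_proportional_iff t (root_ne_zero hδ) hi, add_assoc, left_eq_add,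
        add_eq_zero_iff_eq_neg]
    simp only [h1, forall_const]
  constructor
  · rintro ⟨δ, f, hδ, rfl, h⟩
    rw [kummerClass_eq t hi hδ, ← map_neg]
    exact congrArg (H1.mk _ _) (Subtype.ext (funext ((key hδ f).1 h)))
  · rintro rfl
    obtain ⟨δ, hδ⟩ := exists_root d
    rw [kummerClass_eq t hi hδ, ← map_neg, toWC_mk]
    exact ⟨δ, _, hδ, rfl, (key hδ _).2 fun σ => rfl⟩

theorem galAct_dualIsogeny (t : ℚˣ) (σ : QBar ≃ₐ[ℚ] QBar) (P : ((E' t)⁄QBar).Point) :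
    galAct (E t) ℚ QBar σ (dualIsogeny t QBar P) =
      dualIsogeny t QBar (galAct (E' t) ℚ QBar σ P) := by
  rcases P with _ | ⟨X, Y, h⟩
  · rfl
  · change Point.map (W' := E t) _ _ = dualIsogeny t QBar (Point.map (W' := E' t) _ _)
    set s : QBar →ₐ[ℚ] QBar := (σ : QBar →ₐ[ℚ] QBar).restrictScalars ℚ
    have hX : (s X + algebraMap ℚ QBar (A t)) * (s X + 2 * algebraMap ℚ QBar (A t)) =
        s ((X + algebraMap ℚ QBar (A t)) * (X + 2 * algebraMap ℚ QBar (A t))) := by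
      simp [map_ofNat]
    rw [Point.map_some]
    by_cases h0 : (X + algebraMap ℚ QBar (A t)) * (X + 2 * algebraMap ℚ QBar (A t)) = 0
    · rw [dualIsogeny, dif_pos h0, dualIsogeny, dif_pos (by rw [hX, h0, map_zero])]
      rfl
    · rw [dualIsogeny, dif_neg h0, dualIsogeny, dif_neg (by rwa [hX, map_eq_zero]),
        Point.map_some]
      refine point_some_congr ?_ ?_ <;> simp [map_ofNat]

theorem isLocallyConstant_galAct (t : ℚˣ) (P : ((E' t)⁄QBar).Point) :
    IsLocallyConstant fun σ : QBar ≃ₐ[ℚ] QBar => galAct (E' t) ℚ QBar σ P := by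
  rcases P with _ | ⟨X, Y, h⟩
  · exact IsLocallyConstant.const _
  · have h1 := ((isLocallyConstant_apply X).prodMk (isLocallyConstant_apply Y)).comp
      fun x : QBar × QBar =>
        if h : ((E' t)⁄QBar).Nonsingular x.1 x.2 then Point.some _ _ h else 0
    convert h1 using 1
    funext σ
    have h2 : ((E' t)⁄QBar).Nonsingular (σ X) (σ Y) :=
      (WeierstrassCurve.Affine.baseChange_nonsingular (W := E' t)
        (f := (σ : QBar →ₐ[ℚ] QBar).restrictScalars ℚ) σ.injective X Y).2 h
    exact (dif_pos h2).symm

/-- A class is killed by the isogeny if and only if it comes from the kernel. -/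
theorem killedByDual_iff (t : ℚˣ) (c : WC (E' t)) :
    KilledByDual t c ↔ ∃ c' : H1Q (E' t) (dualKernel t), toWC t c' = c := by
  obtain ⟨i, hi⟩ := exists_sq_eq_neg_one QBar
  have hker : ∀ P, P ∈ dualKernel t ↔ dualIsogeny t QBar P = 0 := fun P => by
    rw [dualKernel_eq t hi, dualIsogeny_eq_zero_iff_mem]
  constructor
  · rintro ⟨f, rfl, Q, hQ⟩
    obtain ⟨R, rfl⟩ := dualIsogeny_surjective t Q
    -- Subtracting the principal crossed homomorphism of a preimage `R` of `Q` brings all values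
    -- into the kernel; additivity of the isogeny is needed here.
    have hg : ∀ σ, f.1 σ - (galAct (E' t) ℚ QBar σ R - R) ∈ dualKernel t := fun σ => by
      rw [hker, sub_eq_add_neg, neg_sub, dualIsogeny_add, sub_eq_add_neg, dualIsogeny_add,
        dualIsogeny_neg t hi, hQ, galAct_dualIsogeny]
      abel
    have hR : (fun σ => galAct (E' t) ℚ QBar σ R - R) ∈ cocycles (galAct (E' t) ℚ QBar) ⊤ := by
      refine ⟨?_, fun σ τ => ?_, fun _ => trivial⟩
      · exact (isLocallyConstant_galAct t R).comp fun P => P - R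
      · dsimp only
        have h1 : galAct (E' t) ℚ QBar (σ * τ) R =
            galAct (E' t) ℚ QBar σ (galAct (E' t) ℚ QBar τ R) := by
          rw [map_mul]
          rfl
        rw [h1, map_sub]
        abel
    let g : cocycles (galAct (E' t) ℚ QBar) (dualKernel t) :=
      ⟨fun σ => f.1 σ - (galAct (E' t) ℚ QBar σ R - R), (f.2.1.sub hR.1),
        ((AddSubgroup.sub_mem _ f.2 hR).2.1), hg⟩
    refine ⟨H1.mk _ _ g, ?_⟩
    rw [toWC_mk]
    refine H1_mk_eq_iff.2 ⟨R, trivial, fun σ => ?_⟩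
    exact (sub_add_cancel _ _).symm
  · rintro ⟨c', rfl⟩
    obtain ⟨f, rfl⟩ := QuotientAddGroup.mk'_surjective _ c'
    refine ⟨⟨f.1, f.2.1, f.2.2.1, fun _ => trivial⟩, rfl, 0, fun σ => ?_⟩
    rw [map_zero, sub_zero]
    exact (hker _).1 (f.2.2.2 σ)

end Torsor

/-! ### Local solubility at the good primes -/

section Descent

variable {R : Type*} [CommRing R] [IsDomain R] {π c e s z w u : R}

theorem dvd_of_dvd_mul_sq {R : Type*} [CommRing R] {π c x : R} (hπ : Prime π) (hc : ¬π ∣ c)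
    (h : π ∣ c * x ^ 2) : π ∣ x :=
  hπ.dvd_of_dvd_pow ((hπ.dvd_or_dvd h).resolve_left hc)

/-- These are the equations of `C'_d` with `c = 4t²` and `d = π ^ ν e`. For `0 < ν < 4`, comparing
powers of `π` forces all four coordinates to be divisible by `π`, so there is no primitive solution.
-/
theorem dvd_of_valuation_one (hπ : Prime π) (hc : ¬π ∣ c) (he : ¬π ∣ e)
    (h1 : u * z = w ^ 2 - π ^ 1 * e * s ^ 2) (h2 : c * u ^ 2 = π ^ 1 * e * (c * w * s - z ^ 2)) :
    π ∣ s ∧ π ∣ z ∧ π ∣ w ∧ π ∣ u := by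
  obtain ⟨u, rfl⟩ := dvd_of_dvd_mul_sq (x := u) hπ hc ⟨e * (c * w * s - z ^ 2), by
    linear_combination h2⟩
  obtain ⟨w, rfl⟩ := hπ.dvd_of_dvd_pow (a := w) (n := 2) ⟨u * z + e * s ^ 2, by
    linear_combination -h1⟩
  have h3 : c * π * u ^ 2 = e * (c * π * w * s - z ^ 2) :=
    mul_left_cancel₀ hπ.ne_zero (by linear_combination h2)
  obtain ⟨z, rfl⟩ := dvd_of_dvd_mul_sq (x := z) hπ he ⟨e * c * w * s - c * u ^ 2, by
    linear_combination h3⟩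
  refine ⟨dvd_of_dvd_mul_sq hπ he ⟨w ^ 2 - u * z, mul_left_cancel₀ hπ.ne_zero ?_⟩,
    dvd_mul_right _ _, dvd_mul_right _ _, dvd_mul_right _ _⟩
  linear_combination h1

theorem dvd_of_valuation_two (hπ : Prime π) (hc : ¬π ∣ c) (he : ¬π ∣ e)
    (h1 : u * z = w ^ 2 - π ^ 2 * e * s ^ 2) (h2 : c * u ^ 2 = π ^ 2 * e * (c * w * s - z ^ 2)) :
    π ∣ s ∧ π ∣ z ∧ π ∣ w ∧ π ∣ u := by
  have h0 := hπ.ne_zero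
  obtain ⟨u, rfl⟩ := dvd_of_dvd_mul_sq (x := u) hπ hc ⟨π * e * (c * w * s - z ^ 2), by
    linear_combination h2⟩
  obtain ⟨w, rfl⟩ := hπ.dvd_of_dvd_pow (a := w) (n := 2) ⟨u * z + π * e * s ^ 2, by
    linear_combination -h1⟩
  have h3 : u * z = π * (w ^ 2 - e * s ^ 2) := mul_left_cancel₀ h0 (by linear_combination h1)
  have h4 : c * u ^ 2 = e * (c * π * w * s - z ^ 2) :=
    mul_left_cancel₀ (pow_ne_zero 2 h0) (by linear_combination h2)
  -- The product `u z` is divisible by `π`, and by `h4` each of the two factors is divisible by `π`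
  -- once the other is.
  have h5 : π ∣ u ∧ π ∣ z := by
    rcases hπ.dvd_or_dvd ⟨_, h3⟩ with ⟨u, rfl⟩ | ⟨z, rfl⟩
    · exact ⟨dvd_mul_right _ _, dvd_of_dvd_mul_sq hπ he ⟨e * c * w * s - c * π * u ^ 2, by
        linear_combination h4⟩⟩
    · exact ⟨dvd_of_dvd_mul_sq hπ hc ⟨e * (c * w * s - π * z ^ 2), by
        linear_combination h4⟩, dvd_mul_right _ _⟩
  obtain ⟨⟨u, rfl⟩, ⟨z, rfl⟩⟩ := h5
  have h6 : π * (u * z) = w ^ 2 - e * s ^ 2 := mul_left_cancel₀ h0 (by linear_combination h3)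
  have h7 : c * π * u ^ 2 = e * (c * w * s - π * z ^ 2) :=
    mul_left_cancel₀ h0 (by linear_combination h4)
  have h8 : π ∣ w * s := by
    refine ((hπ.dvd_or_dvd (a := e * c) ⟨c * u ^ 2 + e * z ^ 2, ?_⟩).resolve_left fun h =>
      (hπ.dvd_or_dvd h).elim he hc)
    linear_combination -h7
  refine ⟨?_, dvd_mul_right _ _, dvd_mul_right _ _, dvd_mul_right _ _⟩
  rcases hπ.dvd_or_dvd h8 with ⟨w, rfl⟩ | h
  · exact dvd_of_dvd_mul_sq hπ he ⟨π * w ^ 2 - u * z, by linear_combination h6⟩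
  · exact h

theorem dvd_of_valuation_three (hπ : Prime π) (hc : ¬π ∣ c) (he : ¬π ∣ e)
    (h1 : u * z = w ^ 2 - π ^ 3 * e * s ^ 2) (h2 : c * u ^ 2 = π ^ 3 * e * (c * w * s - z ^ 2)) :
    π ∣ s ∧ π ∣ z ∧ π ∣ w ∧ π ∣ u := by
  have h0 := hπ.ne_zero
  obtain ⟨u, rfl⟩ := dvd_of_dvd_mul_sq (x := u) hπ hc ⟨π ^ 2 * e * (c * w * s - z ^ 2), by
    linear_combination h2⟩
  obtain ⟨u, rfl⟩ := dvd_of_dvd_mul_sq (x := u) hπ hc ⟨e * (c * w * s - z ^ 2),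
    mul_left_cancel₀ (pow_ne_zero 2 h0) (by linear_combination h2)⟩
  obtain ⟨w, rfl⟩ := hπ.dvd_of_dvd_pow (a := w) (n := 2) ⟨π * u * z + π ^ 2 * e * s ^ 2, by
    linear_combination -h1⟩
  have h3 : u * z = w ^ 2 - π * e * s ^ 2 :=
    mul_left_cancel₀ (pow_ne_zero 2 h0) (by linear_combination h1)
  have h4 : c * π * u ^ 2 = e * (c * π * w * s - z ^ 2) :=
    mul_left_cancel₀ (pow_ne_zero 3 h0) (by linear_combination h2)
  obtain ⟨z, rfl⟩ := dvd_of_dvd_mul_sq (x := z) hπ he ⟨e * c * w * s - c * u ^ 2, by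
    linear_combination h4⟩
  have h5 : c * u ^ 2 = e * (c * w * s - π * z ^ 2) :=
    mul_left_cancel₀ h0 (by linear_combination h4)
  obtain ⟨w, rfl⟩ := hπ.dvd_of_dvd_pow (a := w) (n := 2) ⟨u * z + e * s ^ 2, by
    linear_combination -h3⟩
  obtain ⟨u, rfl⟩ := dvd_of_dvd_mul_sq (x := u) hπ hc ⟨e * (c * w * s - z ^ 2), by
    linear_combination h5⟩
  refine ⟨dvd_of_dvd_mul_sq hπ he ⟨w ^ 2 - u * z, mul_left_cancel₀ h0 ?_⟩,
    dvd_mul_right _ _, dvd_mul_right _ _, dvd_mul_right _ _⟩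
  linear_combination h3

theorem dvd_of_valuation (hπ : Prime π) (hc : ¬π ∣ c) (he : ¬π ∣ e) {ν : ℕ} (h0 : ν ≠ 0)
    (h4 : ν < 4) (h1 : u * z = w ^ 2 - π ^ ν * e * s ^ 2)
    (h2 : c * u ^ 2 = π ^ ν * e * (c * w * s - z ^ 2)) : π ∣ s ∧ π ∣ z ∧ π ∣ w ∧ π ∣ u := by
  interval_cases ν
  · exact absurd rfl h0
  · exact dvd_of_valuation_one hπ hc he h1 h2
  · exact dvd_of_valuation_two hπ hc he h1 h2
  · exact dvd_of_valuation_three hπ hc he h1 h2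

end Descent

/-! ### Solubility of `C'_d` over `ℚ_p` at primes outside `Σ`, and the support of `d` -/

section GoodPrimes

theorem OnSpace.smul {L : Type*} [Field L] [Algebra ℚ L] {t : ℚˣ} {d : L} {v : Fin 4 → L}
    (h : OnSpace t d v) {c : L} (hc : c ≠ 0) :
    OnSpace t (d * c ^ 4) ![v 0, c * v 1, c ^ 2 * v 2, c ^ 3 * v 3] := by
  obtain ⟨h0, h1, h2⟩ := h
  refine ⟨fun h => h0 (funext (forall_fin_four ?_ ?_ ?_ ?_)), ?_, ?_⟩
  · exact congrFun h 0
  · exact (mul_eq_zero.1 (congrFun h 1)).resolve_left hc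
  · exact (mul_eq_zero.1 (congrFun h 2)).resolve_left (pow_ne_zero 2 hc)
  · exact (mul_eq_zero.1 (congrFun h 3)).resolve_left (pow_ne_zero 3 hc)
  · simp only [Matrix.cons_val]
    linear_combination c ^ 4 * h1
  · simp only [Matrix.cons_val]
    linear_combination c ^ 6 * h2

theorem HasPoint.mul_pow_four {L : Type*} [Field L] [Algebra ℚ L] {t d : ℚˣ} (h : HasPoint t d L)
    (c : ℚˣ) : HasPoint t (d * c ^ 4) L := by
  obtain ⟨v, hv⟩ := h
  have h1 := OnSpace.smul (c := algebraMap ℚ L c) hv (t_ne_zero c L)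
  rw [← map_pow, ← map_mul, ← Units.val_pow_eq_pow_val, ← Units.val_mul] at h1
  exact ⟨_, h1⟩

variable {p : ℕ} [hp : Fact p.Prime]

theorem norm_ratCast_eq_one {x : ℚ} (hx : x ≠ 0) (h : p ∉ x.num.natAbs.primeFactors)
    (h' : p ∉ x.den.primeFactors) : ‖(x : ℚ_[p])‖ = 1 := by
  have h1 : ¬p ∣ x.num.natAbs := fun h1 => h (Nat.mem_primeFactors.2
    ⟨hp.out, h1, Int.natAbs_ne_zero.2 (Rat.num_ne_zero.2 hx)⟩)
  have h2 : ¬p ∣ x.den := fun h1 => h' (Nat.mem_primeFactors.2 ⟨hp.out, h1, x.den_ne_zero⟩)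
  rw [Padic.eq_padicNorm, padicNorm.eq_zpow_of_nonzero hx, padicValRat_def, padicValInt,
    padicValNat.eq_zero_of_not_dvd h1, padicValNat.eq_zero_of_not_dvd h2]
  simp

theorem ne_two_of_notMem_badPrimes {t : ℚˣ} (hpt : p ∉ badPrimes t) : p ≠ 2 := by
  rintro rfl
  simp [badPrimes] at hpt

theorem norm_t_eq_one {t : ℚˣ} (hpt : p ∉ badPrimes t) : ‖((t : ℚ) : ℚ_[p])‖ = 1 := by
  simp only [badPrimes, Finset.mem_union, not_or] at hpt
  exact norm_ratCast_eq_one t.ne_zero hpt.1.2.1 hpt.1.2.2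

theorem norm_t_sq_add_four_eq_one {t : ℚˣ} (hpt : p ∉ badPrimes t) :
    ‖(((t : ℚ) ^ 2 + 4 : ℚ) : ℚ_[p])‖ = 1 := by
  simp only [badPrimes, Finset.mem_union, not_or] at hpt
  exact norm_ratCast_eq_one (by positivity) hpt.2.1 hpt.2.2

theorem toZMod_two_ne_zero (h2 : p ≠ 2) : (2 : ZMod p) ≠ 0 := fun h =>
  h2 ((Nat.prime_dvd_prime_iff_eq hp.out Nat.prime_two).1
    ((ZMod.natCast_eq_zero_iff 2 p).1 (by exact_mod_cast h)))

theorem toZMod_ne_zero_of_norm {x : ℤ_[p]} (h : ‖(x : ℚ_[p])‖ = 1) : PadicInt.toZMod x ≠ 0 :=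
  fun h0 => (toZMod_eq_zero_iff.1 h0).ne h

theorem norm_eq_one_of_isSupported {t d : ℚˣ} (hd : IsSupported t d) (hpt : p ∉ badPrimes t) :
    ‖((d : ℚ) : ℚ_[p])‖ = 1 := by
  obtain ⟨ε, e, h⟩ := hd
  have hq : ∀ q ∈ badPrimes t, ‖((q : ℕ) : ℚ_[p])‖ = 1 := fun q hq => by
    have hq' : q.Prime := by
      simp only [badPrimes, Finset.mem_union, Finset.mem_singleton, Nat.mem_primeFactors] at hq
      rcases hq with (rfl | h | h) | h | h
      exacts [Nat.prime_two, h.1, h.1, h.1, h.1]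
    exact Padic.norm_natCast_eq_one_iff.2 ((Nat.coprime_primes hp.out hq').2 fun h =>
      hpt (h ▸ hq))
  rw [h, Rat.cast_mul, Rat.cast_prod, norm_mul, norm_prod, Finset.prod_eq_one, mul_one]
  · rcases Int.units_eq_one_or ε with rfl | rfl <;> simp
  · intro q hq'
    rw [Rat.cast_zpow, Rat.cast_natCast, norm_zpow, hq q hq', one_zpow]

/-- At a good prime the homogeneous space of a unit has a point. -/
theorem hasPoint_of_norm_eq_one {t d : ℚˣ} (hd : ‖((d : ℚ) : ℚ_[p])‖ = 1)
    (hpt : p ∉ badPrimes t) : HasPoint t d ℚ_[p] := by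
  have ht := norm_t_eq_one hpt
  have ht4 := norm_t_sq_add_four_eq_one hpt
  obtain ⟨T, hT⟩ : ∃ T : ℤ_[p], (T : ℚ_[p]) = ((t : ℚ) : ℚ_[p]) := ⟨⟨_, ht.le⟩, rfl⟩
  obtain ⟨e, he⟩ : ∃ e : ℤ_[p], (e : ℚ_[p]) = ((d : ℚ) : ℚ_[p]) := ⟨⟨_, hd.le⟩, rfl⟩
  rw [← hT] at ht
  rw [← he] at hd
  push_cast at ht4
  rw [← hT] at ht4
  obtain ⟨s, z, w, u, h0, h1, h2⟩ := hasIntegralPoint_of_toZMod_ne_zero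
    (toZMod_two_ne_zero (ne_two_of_notMem_badPrimes hpt)) (toZMod_ne_zero_of_norm ht)
    (toZMod_ne_zero_of_norm (by push_cast; exact ht4)) (toZMod_ne_zero_of_norm hd)
  replace h1 := congrArg ((↑) : ℤ_[p] → ℚ_[p]) h1
  replace h2 := congrArg ((↑) : ℤ_[p] → ℚ_[p]) h2
  push_cast at h1 h2
  rw [he] at h1
  rw [hT, he, show ((4 : ℤ_[p]) : ℚ_[p]) = 4 from rfl] at h2
  have ha := a_eq t ℚ_[p]
  have ht0 := t_ne_zero t ℚ_[p]
  rw [eq_ratCast] at ha ht0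
  refine ⟨![(s : ℚ_[p]), z, w, u], fun h => ?_, ?_, ?_⟩
  · rcases h0 with h0 | h0
    · exact h0 (PadicInt.ext (congrFun h 0))
    · exact h0 (PadicInt.ext (congrFun h 1))
  · simp only [Matrix.cons_val, eq_ratCast]
    linear_combination h1
  · simp only [Matrix.cons_val, eq_ratCast] at ha ⊢
    have h4 := four_ne_zero_of_rat ℚ_[p]
    refine mul_left_cancel₀ (mul_ne_zero h4 (pow_ne_zero 2 ht0)) ?_
    linear_combination h2 - ((d : ℚ) : ℚ_[p]) * z ^ 2 * ha

/-- A point over `ℚ_p` has primitive integral coordinates. -/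
theorem exists_primitive {t : ℚˣ} {D : ℚ_[p]} {v : Fin 4 → ℚ_[p]} (hv : OnSpace t D v) :
    ∃ x : Fin 4 → ℤ_[p], OnSpace t D (fun k => (x k : ℚ_[p])) ∧ ∃ l, x l = 1 := by
  -- Dividing by a coordinate of maximal norm makes all of them integral and that one equal to 1.
  obtain ⟨l, -, hl⟩ := Finset.exists_max_image Finset.univ (fun k => ‖v k‖) ⟨0, Finset.mem_univ 0⟩
  have hl0 : v l ≠ 0 := fun h => by
    obtain ⟨k, hk⟩ := hv.exists_ne_zero
    have h1 := hl k (Finset.mem_univ k)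
    rw [h, norm_zero] at h1
    exact hk (norm_le_zero_iff.1 h1)
  refine ⟨fun k => ⟨v k / v l, ?_⟩, hv.of_proportional ⟨(v l)⁻¹, inv_ne_zero hl0, fun k =>
    div_eq_inv_mul _ _⟩, l, PadicInt.ext (div_self hl0)⟩
  rw [norm_div]
  exact div_le_one_of_le₀ (hl k (Finset.mem_univ k)) (norm_nonneg _)

theorem not_dvd_of_norm {x : ℤ_[p]} (h : ‖(x : ℚ_[p])‖ = 1) : ¬(p : ℤ_[p]) ∣ x := fun h0 =>
  (PadicInt.norm_lt_one_iff_dvd x).2 h0 |>.ne h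

/-- At a good prime `p` a homogeneous space can have a point only if `4` divides `v_p(d)`. -/
theorem four_dvd_of_hasPoint {t d : ℚˣ} (h : HasPoint t d ℚ_[p]) (hpt : p ∉ badPrimes t) :
    4 ∣ padicValRat p d := by
  have hp0 : (p : ℚ) ≠ 0 := Nat.cast_ne_zero.2 hp.out.ne_zero
  set v := padicValRat p d with hv
  obtain ⟨ν, hν⟩ : ∃ ν : ℕ, v % 4 = ν :=
    ⟨_, (Int.toNat_of_nonneg (Int.emod_nonneg v (by norm_num))).symm⟩
  by_contra h4
  have hν0 : ν ≠ 0 := by omega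
  have hν4 : ν < 4 := by omega
  -- Removing the fourth power `p ^ (4 ⌊v / 4⌋)` leaves `p ^ ν` times a unit with `ν = v mod 4`,
  -- which is 1, 2 or 3 under the assumption to be refuted.
  obtain ⟨y, hy⟩ := h.mul_pow_four (Units.mk0 (p : ℚ) hp0 ^ (-(v / 4)))
  have hd0 : ((d : ℚ) : ℚ_[p]) ≠ 0 := by exact_mod_cast d.ne_zero
  have hpp : (p : ℚ_[p]) ≠ 0 := by exact_mod_cast hp0
  have hD : algebraMap ℚ ℚ_[p] (d * (Units.mk0 (p : ℚ) hp0 ^ (-(v / 4))) ^ 4 : ℚˣ) =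
      (p : ℚ_[p]) ^ ν * (((d : ℚ) : ℚ_[p]) * (p : ℚ_[p]) ^ (-v)) := by
    rw [eq_ratCast]
    push_cast
    rw [Units.val_mk0, mul_left_comm, ← zpow_natCast (p : ℚ_[p]) ν,
      ← zpow_add₀ hpp]
    push_cast
    rw [← zpow_natCast, ← zpow_mul]
    congr 2
    push_cast
    omega
  have he : ‖((d : ℚ) : ℚ_[p]) * (p : ℚ_[p]) ^ (-v)‖ = 1 := by
    rw [norm_mul, Padic.norm_p_zpow, Padic.norm_eq_zpow_neg_valuation hd0,
      Padic.valuation_ratCast, ← zpow_add₀ (by exact_mod_cast hp0), ← hv]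
    simp
  obtain ⟨x, ⟨-, h1, h2⟩, l, hl⟩ := exists_primitive ((mem_spaceVectors _ _ _).1 hy)
  rw [hD] at h1 h2
  have ht := norm_t_eq_one hpt
  have h2p : ‖((2 : ℤ_[p]) : ℚ_[p])‖ = 1 := by
    have := Padic.norm_natCast_eq_one_iff (p := p).2 ((Nat.coprime_primes hp.out Nat.prime_two).2
      (ne_two_of_notMem_badPrimes hpt))
    exact_mod_cast this
  let T : ℤ_[p] := ⟨((t : ℚ) : ℚ_[p]), ht.le⟩
  let e : ℤ_[p] := ⟨((d : ℚ) : ℚ_[p]) * (p : ℚ_[p]) ^ (-v), he.le⟩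
  have hc : ‖((2 ^ 2 * T ^ 2 : ℤ_[p]) : ℚ_[p])‖ = 1 := by
    rw [PadicInt.coe_mul, PadicInt.coe_pow, PadicInt.coe_pow, norm_mul, norm_pow, norm_pow, h2p,
      show ‖(T : ℚ_[p])‖ = 1 from ht, one_pow, one_mul]
  have ha := a_eq t ℚ_[p]
  rw [eq_ratCast] at ha
  have h3 : (p : ℤ_[p]) ∣ x 0 ∧ (p : ℤ_[p]) ∣ x 1 ∧ (p : ℤ_[p]) ∣ x 2 ∧ (p : ℤ_[p]) ∣ x 3 := by
    refine dvd_of_valuation PadicInt.prime_p (not_dvd_of_norm hc)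
      (not_dvd_of_norm (x := e) he) hν0 hν4 (PadicInt.ext ?_) (PadicInt.ext ?_)
    · push_cast
      exact h1
    · push_cast
      change 2 ^ 2 * ((t : ℚ) : ℚ_[p]) ^ 2 * _ = _ ^ ν * (((d : ℚ) : ℚ_[p]) * (p : ℚ_[p]) ^ (-v)) *
        (2 ^ 2 * ((t : ℚ) : ℚ_[p]) ^ 2 * _ * _ - _)
      linear_combination 4 * ((t : ℚ) : ℚ_[p]) ^ 2 * h2 +
        (p : ℚ_[p]) ^ ν * (((d : ℚ) : ℚ_[p]) * (p : ℚ_[p]) ^ (-v)) * (x 1 : ℚ_[p]) ^ 2 * ha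
  have h5 : ∀ k, (p : ℤ_[p]) ∣ x k := forall_fin_four h3.1 h3.2.1 h3.2.2.1 h3.2.2.2
  exact PadicInt.prime_p.not_isUnit (isUnit_of_dvd_one (hl ▸ h5 l))

theorem prod_zpow_factorization (d : ℚˣ) {S : Finset ℕ} (h : (d : ℚ).num.natAbs.primeFactors ⊆ S)
    (h' : (d : ℚ).den.primeFactors ⊆ S) : (d : ℚ) = ((d : ℚ).num.sign : ℚ) *
      ∏ q ∈ S, (q : ℚ) ^ (((d : ℚ).num.natAbs.factorization q : ℤ) - (d : ℚ).den.factorization q) :=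
          by
  have key : ∀ {n : ℕ}, n ≠ 0 → n.primeFactors ⊆ S →
      ∏ q ∈ S, ((q : ℕ) : ℚ) ^ n.factorization q = n := fun {n} hn hS => by
    have h1 := Nat.prod_factorization_pow_eq_self hn
    rw [Finsupp.prod_of_support_subset _ (s := S) (by rwa [Nat.support_factorization]) _
      (by simp)] at h1
    exact_mod_cast congrArg (Nat.cast : ℕ → ℚ) h1
  have hq : ∀ q ∈ S, (q : ℚ) ^ (((d : ℚ).num.natAbs.factorization q : ℤ) -
      (d : ℚ).den.factorization q) =
      (q : ℚ) ^ (d : ℚ).num.natAbs.factorization q / (q : ℚ) ^ (d : ℚ).den.factorization q :=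
    fun q _ => by
      rcases eq_or_ne q 0 with rfl | h0
      · simp
      · rw [zpow_sub₀ (Nat.cast_ne_zero.2 h0), zpow_natCast, zpow_natCast]
  rw [Finset.prod_congr rfl hq, Finset.prod_div_distrib,
    key (Int.natAbs_ne_zero.2 (Rat.num_ne_zero.2 d.ne_zero)) h, key (d : ℚ).den_ne_zero h',
    ← mul_div_assoc]
  conv_lhs => rw [← Rat.num_div_den (d : ℚ), ← Int.sign_mul_natAbs (d : ℚ).num]
  rw [Int.cast_mul, Int.cast_natCast]

/-- If the valuations of `d` at the good primes are divisible by `4`, then `d` agrees up to a fourth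
power with a number that is supported at the bad primes. -/
theorem exists_isSupported {t d : ℚˣ}
    (h : ∀ q : ℕ, q.Prime → q ∉ badPrimes t → 4 ∣ padicValRat q d) :
    ∃ c : ℚˣ, IsSupported t (d * c ^ 4) := by
  set N := (d : ℚ).num.natAbs.primeFactors ∪ (d : ℚ).den.primeFactors
  set e : ℕ → ℤ := fun q =>
    ((d : ℚ).num.natAbs.factorization q : ℤ) - (d : ℚ).den.factorization q
  have hN : ∀ q ∈ N \ badPrimes t, q.Prime ∧ 4 ∣ e q := fun q hq => by
    obtain ⟨hq, hq'⟩ := Finset.mem_sdiff.1 hq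
    have hp : q.Prime := by
      rcases Finset.mem_union.1 hq with hq | hq <;> exact Nat.prime_of_mem_primeFactors hq
    refine ⟨hp, ?_⟩
    have h1 := h q hp hq'
    rw [padicValRat_def, padicValInt] at h1
    rwa [← Nat.factorization_def _ hp, ← Nat.factorization_def _ hp] at h1
  -- The fourth power of `c` cancels the part of `d` at the good primes, whose exponents are
  -- multiples of 4.
  set c : ℚ := ∏ q ∈ N \ badPrimes t, (q : ℚ) ^ (-(e q / 4))
  have hc0 : c ≠ 0 := Finset.prod_ne_zero_iff.2 fun q hq =>
    zpow_ne_zero _ (Nat.cast_ne_zero.2 (hN q hq).1.ne_zero)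
  have hd := prod_zpow_factorization d (S := N ∪ badPrimes t)
    (Finset.subset_union_left.trans Finset.subset_union_left)
    (Finset.subset_union_right.trans Finset.subset_union_left)
  obtain ⟨ε, hε⟩ := Int.isUnit_iff.2 ((Int.sign_trichotomy (d : ℚ).num).imp_right fun h =>
    h.resolve_left fun h0 => Rat.num_ne_zero.2 d.ne_zero (Int.sign_eq_zero_iff_zero.1 h0))
  refine ⟨Units.mk0 c hc0, ε, e, ?_⟩
  have hc : (∏ q ∈ N \ badPrimes t, (q : ℚ) ^ e q) * c ^ 4 = 1 := by
    rw [← Finset.prod_pow, ← Finset.prod_mul_distrib]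
    refine Finset.prod_eq_one fun q hq => ?_
    obtain ⟨hp, k, hk⟩ := hN q hq
    have hq0 : (q : ℚ) ≠ 0 := Nat.cast_ne_zero.2 hp.ne_zero
    rw [← zpow_natCast, ← zpow_mul, ← zpow_add₀ hq0, hk]
    have : 4 * k + -(4 * k / 4) * ((4 : ℕ) : ℤ) = 0 := by omega
    rw [this, zpow_zero]
  rw [Units.val_mul, Units.val_pow_eq_pow_val, Units.val_mk0, hd, hε,
    ← Finset.sdiff_union_self_eq_union, Finset.prod_union Finset.sdiff_disjoint]
  linear_combination (((d : ℚ).num.sign : ℚ) * ∏ q ∈ badPrimes t, (q : ℚ) ^ e q) * hc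

end GoodPrimes

/-! ### The Selmer group and the Shafarevich–Tate group -/

section Conclusion

theorem kummerClass_congr_of_mk_eq (t : ℚˣ) {i : QBar} (hi : i ^ 2 = -1) {d e : ℚˣ}
    (h : (d : FourthPowerClasses) = e) : kummerClass t hi d = kummerClass t hi e := by
  rw [← kummerEquiv_apply, ← kummerEquiv_apply, h]

theorem mk_mul_pow_four (d c : ℚˣ) : ((d * c ^ 4 : ℚˣ) : FourthPowerClasses) = d :=
  QuotientGroup.mk_mul_of_mem d ⟨c, rfl⟩

/-- The Selmer group is cut out by the local conditions at the bad places. -/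
theorem kummerEquiv_mem_selmer_iff (t : ℚˣ) {i : QBar} (hi : i ^ 2 = -1) (D : FourthPowerClasses) :
    kummerEquiv t hi (Additive.ofMul D) ∈ selmer t ↔
      ∃ d : ℚˣ, (d : FourthPowerClasses) = D ∧ IsSupported t d ∧ SolubleAtBadPlaces t d := by
  obtain ⟨d, rfl⟩ := QuotientGroup.mk_surjective D
  rw [kummerEquiv_apply]
  constructor
  · intro h
    obtain ⟨hp, -⟩ := (kummerClass_mem_selmer_iff t hi d).1 h
    obtain ⟨c, hc⟩ := exists_isSupported (t := t) (d := d) fun q hq hqt => by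
      have := Fact.mk hq
      exact four_dvd_of_hasPoint (hp q) hqt
    have h1 := mk_mul_pow_four d c
    rw [← kummerClass_congr_of_mk_eq t hi h1, kummerClass_mem_selmer_iff] at h
    exact ⟨_, h1, hc, fun p _ _ => h.1 p, h.2⟩
  · rintro ⟨e, he, hs, hp, hR⟩
    rw [← kummerClass_congr_of_mk_eq t hi he, kummerClass_mem_selmer_iff]
    -- A number supported on `Σ` is a unit at all other primes, where a point exists without further
    -- condition.
    refine ⟨fun p _ => ?_, hR⟩
    by_cases hpt : p ∈ badPrimes t
    · exact hp p hpt
    · exact hasPoint_of_norm_eq_one (norm_eq_one_of_isSupported hs hpt) hpt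

/-- The classes of the homogeneous spaces as a function on `ℚˣ / (ℚˣ)⁴`. -/
def spaceClass (t : ℚˣ) {i : QBar} (hi : i ^ 2 = -1) (D : FourthPowerClasses) : WC (E' t) :=
  toWC t (-kummerEquiv t hi (Additive.ofMul D))

/-- The sign relating spaces to Kummer classes does no harm: the Selmer group is stable under
negation, so `D` may be replaced by its inverse. -/
theorem mem_ShaDual_iff (t : ℚˣ) {i : QBar} (hi : i ^ 2 = -1) (c : WC (E' t)) :
    c ∈ ShaDual t ↔ ∃ D : FourthPowerClasses,
      c = spaceClass t hi D ∧ kummerEquiv t hi (Additive.ofMul D) ∈ selmer t := by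
  constructor
  · rintro ⟨h, hk⟩
    obtain ⟨c', rfl⟩ := (killedByDual_iff t c).1 hk
    obtain ⟨D, hD⟩ := (kummerEquiv t hi).surjective (-c')
    have hD' : kummerEquiv t hi (Additive.ofMul D.toMul) = -c' := hD
    refine ⟨D.toMul, ?_, ?_⟩
    · rw [spaceClass, hD', neg_neg]
    · rw [hD']
      exact neg_mem ((toWC_mem_Sha_iff t c').1 h)
  · rintro ⟨D, rfl, hD⟩
    exact ⟨(toWC_mem_Sha_iff t _).2 (neg_mem hD), (killedByDual_iff t _).2 ⟨_, rfl⟩⟩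

end Conclusion

end FourDescent

end

theorem mainTheorem7 (t : ℚˣ) :
    (∃ κ : Additive FourDescent.FourthPowerClasses ≃+
        FourDescent.H1Q (FourDescent.E' t) (FourDescent.dualKernel t),
      (∀ d : ℚˣ, FourDescent.IsKummerClass t d
        (κ (Additive.ofMul (d : FourDescent.FourthPowerClasses)))) ∧
      ∀ D : FourDescent.FourthPowerClasses, κ (Additive.ofMul D) ∈ FourDescent.selmer t ↔
        ∃ d : ℚˣ, (d : FourDescent.FourthPowerClasses) = D ∧ FourDescent.IsSupported t d ∧
          FourDescent.SolubleAtBadPlaces t d) ∧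
    (∃ cls : FourDescent.FourthPowerClasses → FourDescent.WC (FourDescent.E' t),
      (∀ (d : ℚˣ) (c : FourDescent.WC (FourDescent.E' t)),
        FourDescent.IsClassOfSpace t d c ↔ c = cls d) ∧
      FourDescent.ShaDual t = {c | ∃ d : ℚˣ, c = cls d ∧ FourDescent.IsSupported t d ∧
        FourDescent.SolubleAtBadPlaces t d}) := by
  obtain ⟨i, hi⟩ := FourDescent.exists_sq_eq_neg_one FourDescent.QBar
  refine ⟨⟨FourDescent.kummerEquiv t hi, FourDescent.isKummerClass_kummerClass t hi,
    FourDescent.kummerEquiv_mem_selmer_iff t hi⟩, FourDescent.spaceClass t hi,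
    FourDescent.isClassOfSpace_iff t hi, ?_⟩
  ext c
  rw [FourDescent.mem_ShaDual_iff t hi]
  constructor
  · rintro ⟨D, rfl, hD⟩
    obtain ⟨d, rfl, h1, h2⟩ := (FourDescent.kummerEquiv_mem_selmer_iff t hi D).1 hD
    exact ⟨d, rfl, h1, h2⟩
  · rintro ⟨d, rfl, h1, h2⟩
    exact ⟨d, rfl, (FourDescent.kummerEquiv_mem_selmer_iff t hi _).2 ⟨d, rfl, h1, h2⟩⟩
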